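/- Let $0<\alpha<1$ and $k\in\mathbb R$. Let $b\in C^\infty(\mathbb R)$ with $0\le b\le 1$, $b=0$ on $(-\infty,\tfrac12]$, $b=1$ on $[1,\infty)$, $|b'|\le 10$, $|b''|\le 100$, and put $$\psi_\alpha(r,\theta)=|r\theta|\,b\!\left(\frac{|\theta|}{|r|^{1/\alpha}}\right)b\!\left(\frac{|r|}{|\theta|^{1/\alpha}}\right)\ (r\theta\ne0),\qquad \psi_\alpha(r,\theta)=0\ (r\theta=0).$$ Let $\chi\in C_c^\infty(\mathbb R^2)$ with $0\le\chi\le1$, $\chi=1$ on $[-1,1]^2$, $\chi=0$ outside $[-2,2]^2$, let $$\rho_*=\min\left\{\frac14,\ \frac1{4(1+|k|)},\ \frac1{4(1+|k|)\left(15+\frac{10}{\alpha}\right)\sqrt{1+\sec^2(1/2)}}\right\},$$ and let $\varphi_{\alpha,k}(r,\theta)=1+k\,\chi(r/\rho_*,\theta/\rho_*)\,\psi_\alpha(r,\theta)$. On $S^2$ use the latitude $r\in(-\frac\pi2,\frac\pi2)$ and longitude $\theta\in(-\pi,\pi]$ centred at a point $p$, so that $g_{S^2}=dr^2+\cos^2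 r\,d\theta^2$, extend $\varphi_{\alpha,k}$ by $1$ to all of $S^2$, and let $$g_{\alpha,k}=\varphi_{\alpha,k}^{-2}\,g_{S^2}+\varphi_{\alpha,k}^2\,d\xi^2\quad\text{on } M=S^2\times S^1,$$ where $S^1=\mathbb R/2\pi\mathbb Z\ni\xi$. Let $\Gamma=\{p\}\times S^1$ and let $q$ be the point $(r,\theta,\xi)=(0,0,0)$. Let $$0<\rho_0\le\min\left\{\tfrac12\rho_*,\ \sqrt{1+\alpha^2}\,\alpha^{\frac{\alpha}{1-\alpha}}\right\},$$ and let $\Omega=\Omega_+\cup\Omega_-\subset T_qM$, where, writing $(x,y,z)$ for $x\partial_r+y\partial_\theta+z\partial_\xi$, $$\Omega_\pm=\left\{(x,y,z):\ \sqrt{x^2+y^2}\le\rho_0,\ \pm xy>0,\ \alpha|x|\le|y|\le\tfrac1\alpha|x|,\ |z|<\tfrac{\sqrt3}2\rho_0\right\}.$$ For all sufficiently small $t>0$ and every $v\in t\Omega$ there is exactly one geodesic $\gamma:[0,1]\to M$ of $g_{\alpha,k}$ in the coordinate region $|r|<\frac\pi2$ with $\gamma(0)=q$, $\gamma'(0)=v$,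 so that $\exp_q(v)=\gamma(1)$ is well defined on $t\Omega$, and, as $t\to0^+$, $$\mathrm{Vol}_{g_{\alpha,k}}\bigl(\exp_q(t\Omega)\bigr)-t^3\,\mathrm{Vol}_E(\Omega)=\frac{\sqrt3\,\rho_0^5}{6}\left[k\,\frac{1-\alpha^2}{1+\alpha^2}-\left(\arctan\frac1\alpha-\arctan\alpha\right)\right]t^5+O(t^6).$$ Consequently the coefficient of $t^5$ is positive if and only if $k>K_*(\alpha)$, where $$K_*(\alpha)=\frac{1+\alpha^2}{1-\alpha^2}\left(\arctan\frac1\alpha-\arctan\alpha\right).$$ On the other hand, $g_{\alpha,k}$ is smooth on $M\setminus\Gamma$, and if moreover $|\nabla\chi|\le2$ on $\mathbb R^2$, then its scalar curvature satisfies $\mathrm{Scalar}_{g_{\alpha,k}}\ge\frac58>0$ on $M\setminus\Gamma$. -/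

import Mathlib

open Set Filter Topology
open scoped ContDiff

noncomputable section

/-! ### Coordinate Riemannian geometry in dimension three

A metric in coordinates is a matrix-valued function `G` of `x : Fin 3 → ℝ`. -/

/-- Partial derivative `∂ᵢ f (x)`. -/
def partialDeriv (i : Fin 3) (f : (Fin 3 → ℝ) → ℝ) (x : Fin 3 → ℝ) : ℝ :=
  fderiv ℝ f x (Pi.single i 1)

/-- Christoffel symbol `Γᵏᵢⱼ = ½ gᵏˡ (∂ᵢ gⱼₗ + ∂ⱼ gᵢₗ - ∂ₗ gᵢⱼ)`. -/
def christoffel (G : (Fin 3 → ℝ) → Matrix (Fin 3) (Fin 3) ℝ) (k i j : Fin 3)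
    (x : Fin 3 → ℝ) : ℝ :=
  (1 / 2) * ∑ l, (G x)⁻¹ k l *
    (partialDeriv i (fun y => G y j l) x + partialDeriv j (fun y => G y i l) x
      - partialDeriv l (fun y => G y i j) x)

/-- `Ricᵢⱼ = ∂ₖ Γᵏᵢⱼ - ∂ⱼ Γᵏᵢₖ + Γᵏₖₗ Γˡᵢⱼ - Γᵏⱼₗ Γˡᵢₖ`. -/
def ricciCoord (G : (Fin 3 → ℝ) → Matrix (Fin 3) (Fin 3) ℝ) (i j : Fin 3)
    (x : Fin 3 → ℝ) : ℝ :=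
  ∑ k, (partialDeriv k (christoffel G k i j) x - partialDeriv j (christoffel G k i k) x
    + ∑ l, (christoffel G k k l x * christoffel G l i j x
      - christoffel G k j l x * christoffel G l i k x))

/-- Scalar curvature `gⁱʲ Ricᵢⱼ`. -/
def scalarCoord (G : (Fin 3 → ℝ) → Matrix (Fin 3) (Fin 3) ℝ) (x : Fin 3 → ℝ) : ℝ :=
  ∑ i, ∑ j, (G x)⁻¹ i j * ricciCoord G i j x

/-! ### The manifold `S² × S¹` inside `ℝ³ × ℂ` -/

/-- The ambient space `ℝ³ × ℂ`. -/
abbrev Amb : Type := EuclideanSpace ℝ (Fin 3) × ℂ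

/-- `S² × S¹`, the product of the unit sphere of `ℝ³` and the unit circle of `ℂ`. -/
def sphereCircle : Set Amb := {p | ‖p.1‖ = 1 ∧ ‖p.2‖ = 1}

/-- The base point `p` of `S²`. -/
def basePt : EuclideanSpace ℝ (Fin 3) := !₂[1, 0, 0]

/-- The circle `Γ = {p} × S¹`. -/
def singularCircle : Set Amb := {p | p.1 = basePt ∧ ‖p.2‖ = 1}

/-- The coordinates `(r, θ, ξ) = (x 0, x 1, x 2)`: `r` is the latitude and `θ` the longitude on `S²`
(so that `g_{S²} = dr² + cos² r dθ²`), and `ξ` is the angle on `S¹`. The pair `(r, θ) = (0, 0)`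
corresponds to `basePt`. -/
def polarParam (x : Fin 3 → ℝ) : Amb :=
  (!₂[Real.cos (x 0) * Real.cos (x 1), Real.cos (x 0) * Real.sin (x 1), Real.sin (x 0)],
    Complex.exp (x 2 * Complex.I))

/-- The coordinates obtained from `polarParam` by permuting the axes of `ℝ³` cyclically; they cover
the two poles that `polarParam` misses. -/
def polarParamAlt (x : Fin 3 → ℝ) : Amb :=
  (!₂[Real.sin (x 0), Real.cos (x 0) * Real.cos (x 1), Real.cos (x 0) * Real.sin (x 1)],
    Complex.exp (x 2 * Complex.I))

open Classical in
/-- A local parametrization of `S² × S¹` around `p`: `polarParam`, unless the sphere component of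
`p` is one of the poles `(0, 0, ±1)`. -/
def localParam (p : Amb) : (Fin 3 → ℝ) → Amb :=
  if p.1 0 = 0 ∧ p.1 1 = 0 then polarParamAlt else polarParam

open Classical in
/-- The coordinates of `p` in the parametrization `localParam p`. -/
def localCoords (p : Amb) : Fin 3 → ℝ :=
  if p.1 0 = 0 ∧ p.1 1 = 0 then
    ![Real.arcsin (p.1 0), Complex.arg ⟨p.1 1, p.1 2⟩, Complex.arg p.2]
  else
    ![Real.arcsin (p.1 2), Complex.arg ⟨p.1 0, p.1 1⟩, Complex.arg p.2]

/-! ### The warping function and the metric -/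

/-- The hypotheses on the one-variable cutoff `b`. -/
structure IsTransition (b : ℝ → ℝ) : Prop where
  smooth : ContDiff ℝ ∞ b
  eq_zero : ∀ x, x ≤ 1 / 2 → b x = 0
  eq_one : ∀ x, 1 ≤ x → b x = 1
  nonneg : ∀ x, 0 ≤ b x
  le_one : ∀ x, b x ≤ 1
  deriv_le : ∀ x, |deriv b x| ≤ 10
  deriv_two_le : ∀ x, |deriv (deriv b) x| ≤ 100

/-- The hypotheses on the plane cutoff `χ`: smooth with values in `[0, 1]`, equal to `1` on
`[-1, 1]²` and to `0` outside `[-2, 2]²`. -/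
structure IsPlaneCutoff (χ : ℝ × ℝ → ℝ) : Prop where
  smooth : ContDiff ℝ ∞ χ
  nonneg : ∀ x, 0 ≤ χ x
  le_one : ∀ x, χ x ≤ 1
  eq_one : ∀ x, |x.1| ≤ 1 → |x.2| ≤ 1 → χ x = 1
  eq_zero : ∀ x, ¬ (|x.1| ≤ 2 ∧ |x.2| ≤ 2) → χ x = 0

/-- The profile `ψ_α(r, θ) = |rθ| b(|θ| / |r|^{1/α}) b(|r| / |θ|^{1/α})`; the first factor makes it
`0` when `rθ = 0`. -/
def psi (α : ℝ) (b : ℝ → ℝ) (r θ : ℝ) : ℝ :=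
  |r * θ| * b (|θ| / |r| ^ (1 / α)) * b (|r| / |θ| ^ (1 / α))

/-- `ρ_*`, where `sec (1/2) = 1 / cos (1/2)`. -/
def rhoStar (α k : ℝ) : ℝ :=
  min (1 / 4) (min (1 / (4 * (1 + |k|)))
    (1 / (4 * (1 + |k|) * (15 + 10 / α) * √(1 + (1 / Real.cos (1 / 2)) ^ 2))))

/-- The warping function `1 + k χ(r/ρ_*, θ/ρ_*) ψ_α(r, θ)` in the coordinates `(r, θ)`. -/
def warpCoord (α k : ℝ) (b : ℝ → ℝ) (χ : ℝ × ℝ → ℝ) (r θ : ℝ) : ℝ :=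
  1 + k * χ (r / rhoStar α k, θ / rhoStar α k) * psi α b r θ

/-- The warping function `φ_{α,k}` on `S²`: latitude `r = arcsin p₂`, longitude
`θ = arg (p₀ + i p₁) ∈ (-π, π]`. It equals `1` away from a neighbourhood of `basePt`. -/
def warp (α k : ℝ) (b : ℝ → ℝ) (χ : ℝ × ℝ → ℝ) (p : EuclideanSpace ℝ (Fin 3)) : ℝ :=
  warpCoord α k b χ (Real.arcsin (p 2)) (Complex.arg ⟨p 0, p 1⟩)

/-- The metric `φ⁻² g_{S²} + φ² dξ²` at `p ∈ S² × S¹`, on vectors `v, w` tangent to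
`S² × S¹ ⊂ ℝ³ × ℂ`. -/
def warpedMetric (α k : ℝ) (b : ℝ → ℝ) (χ : ℝ × ℝ → ℝ) (p v w : Amb) : ℝ :=
  (warp α k b χ p.1 ^ 2)⁻¹ * inner ℝ v.1 w.1 + warp α k b χ p.1 ^ 2 * inner ℝ v.2 w.2

/-- The matrix `gᵢⱼ(x) = g(∂ᵢF, ∂ⱼF)` of the metric in a parametrization `F` of `S² × S¹`. -/
def metricMatrix (α k : ℝ) (b : ℝ → ℝ) (χ : ℝ × ℝ → ℝ) (F : (Fin 3 → ℝ) → Amb)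
    (x : Fin 3 → ℝ) : Matrix (Fin 3) (Fin 3) ℝ :=
  Matrix.of fun i j => warpedMetric α k b χ (F x)
    (fderiv ℝ F x (Pi.single i 1)) (fderiv ℝ F x (Pi.single j 1))

/-- Scalar curvature at a point `p ∈ S² × S¹` (meaningful where the metric is smooth). -/
def scalarCurvature (α k : ℝ) (b : ℝ → ℝ) (χ : ℝ × ℝ → ℝ) (p : Amb) : ℝ :=
  scalarCoord (metricMatrix α k b χ (localParam p)) (localCoords p)

/-- The metric is smooth near `p ∈ S² × S¹`. -/
def SmoothMetricAt (α k : ℝ) (b : ℝ → ℝ) (χ : ℝ × ℝ → ℝ) (p : Amb) : Prop :=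
  ∀ i j, ContDiffAt ℝ ∞ (fun x => metricMatrix α k b χ (localParam p) x i j) (localCoords p)

/-- A box that `polarParam` maps bijectively onto `S² × S¹` minus the two circles over the poles,
which have measure zero. -/
def polarBox : Set (Fin 3 → ℝ) :=
  {x | x 0 ∈ Ioo (-(Real.pi / 2)) (Real.pi / 2) ∧ x 1 ∈ Ioc (-Real.pi) Real.pi ∧
    x 2 ∈ Ioc (-Real.pi) Real.pi}

/-- The Riemannian volume `∫ √det g dr dθ dξ` of a set of points of `S² × S¹`. -/
def riemVol (α k : ℝ) (b : ℝ → ℝ) (χ : ℝ × ℝ → ℝ) (A : Set Amb) : ENNReal :=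
  ∫⁻ x in polarBox ∩ polarParam ⁻¹' A,
    ENNReal.ofReal (√ (metricMatrix α k b χ polarParam x).det)

/-- `c : [0, 1] → ℝ³` is the coordinate expression of a geodesic `polarParam ∘ c` of the metric that
starts at `q = (0, 0, 0)` with initial velocity `v = v₀ ∂_r + v₁ ∂_θ + v₂ ∂_ξ`; `w` is the velocity
of `c`. The coordinate domain is `|r| < π/2`, where `polarParam` is a local diffeomorphism (a
covering of `S² × S¹` minus the two circles over the poles). -/
structure IsGeodesicFrom (α k : ℝ) (b : ℝ → ℝ) (χ : ℝ × ℝ → ℝ) (v : Fin 3 → ℝ)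
    (c w : ℝ → Fin 3 → ℝ) : Prop where
  start_pos : c 0 = 0
  start_vel : w 0 = v
  mem_domain : ∀ s ∈ Icc (0 : ℝ) 1, |c s 0| < Real.pi / 2
  hasDeriv_pos : ∀ s ∈ Icc (0 : ℝ) 1, HasDerivWithinAt c (w s) (Icc 0 1) s
  hasDeriv_vel : ∀ s ∈ Icc (0 : ℝ) 1, HasDerivWithinAt w
    (fun m => - ∑ i, ∑ j, christoffel (metricMatrix α k b χ polarParam) m i j (c s)
      * w s i * w s j) (Icc 0 1) s

open Classical in
/-- The local exponential map at `q`: `exp_q v = γ(1)` for the geodesic `γ` on `[0, 1]` with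
`γ(0) = q`, `γ'(0) = v` (the value `q` is used when there is no such geodesic). -/
def expAt (α k : ℝ) (b : ℝ → ℝ) (χ : ℝ × ℝ → ℝ) (v : Fin 3 → ℝ) : Amb :=
  if h : ∃ c : ℝ → Fin 3 → ℝ, ∃ w, IsGeodesicFrom α k b χ v c w then polarParam (h.choose 1)
  else polarParam 0

/-! ### The wedge -/

/-- `Ω_+` (for `σ = 1`) and `Ω_-` (for `σ = -1`) in `T_q M`, in the orthonormal basis
`∂_r, ∂_θ, ∂_ξ`. -/
def wedgePart (σ α ρ₀ : ℝ) : Set (Fin 3 → ℝ) :=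
  {v | √(v 0 ^ 2 + v 1 ^ 2) ≤ ρ₀ ∧ 0 < σ * (v 0 * v 1) ∧
    α * |v 0| ≤ |v 1| ∧ |v 1| ≤ 1 / α * |v 0| ∧
    v 2 ∈ Ioo (-(√3 / 2 * ρ₀)) (√3 / 2 * ρ₀)}

/-- `Ω = Ω_+ ∪ Ω_-`. -/
def wedge (α ρ₀ : ℝ) : Set (Fin 3 → ℝ) := wedgePart 1 α ρ₀ ∪ wedgePart (-1) α ρ₀

/-- The dilated set `t Ω`. -/
def dilate (t : ℝ) (Ω : Set (Fin 3 → ℝ)) : Set (Fin 3 → ℝ) := (fun v => t • v) '' Ω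

/-- The coefficient of `t⁵`. -/
def fifthCoeff (α k ρ₀ : ℝ) : ℝ :=
  √3 * ρ₀ ^ 5 / 6 *
    (k * ((1 - α ^ 2) / (1 + α ^ 2)) - (Real.arctan (1 / α) - Real.arctan α))

/-- The threshold `K_*(α)`. -/
def kStar (α : ℝ) : ℝ :=
  (1 + α ^ 2) / (1 - α ^ 2) * (Real.arctan (1 / α) - Real.arctan α)

/-! ### Consistency of the coordinates -/

theorem localParam_localCoords {p : Amb} (hp : p ∈ sphereCircle) :
    localParam p (localCoords p) = p := by
  obtain ⟨⟨p1⟩, z⟩ := p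
  obtain ⟨h1, h2⟩ := hp
  have hs : p1 0 ^ 2 + p1 1 ^ 2 + p1 2 ^ 2 = 1 := by
    have := EuclideanSpace.norm_sq_eq (WithLp.toLp 2 p1)
    simp only [Fin.sum_univ_three, Real.norm_eq_abs, sq_abs] at this
    simp only at h1
    rw [h1] at this
    linarith
  have hz : Complex.exp (z.arg * Complex.I) = z := by
    have := Complex.norm_mul_exp_arg_mul_I z
    simp only at h2
    rwa [h2, Complex.ofReal_one, one_mul] at this
  -- latitude and longitude recover a unit vector `(a, b, c)`
  have key : ∀ a b c : ℝ, a ^ 2 + b ^ 2 + c ^ 2 = 1 →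
      Real.cos (Real.arcsin c) * Real.cos (Complex.arg ⟨a, b⟩) = a ∧
      Real.cos (Real.arcsin c) * Real.sin (Complex.arg ⟨a, b⟩) = b ∧
      Real.sin (Real.arcsin c) = c := by
    intro a b c h
    have hn : Real.cos (Real.arcsin c) = ‖(⟨a, b⟩ : ℂ)‖ := by
      rw [Real.cos_arcsin, Complex.norm_def, Complex.normSq_mk]
      congr 1
      linarith
    refine ⟨?_, ?_, Real.sin_arcsin ?_ ?_⟩
    · rw [hn]; exact Complex.norm_mul_cos_arg ⟨a, b⟩
    · rw [hn]; exact Complex.norm_mul_sin_arg ⟨a, b⟩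
    · nlinarith [sq_nonneg a, sq_nonneg b]
    · nlinarith [sq_nonneg a, sq_nonneg b]
  by_cases hpole : p1 0 = 0 ∧ p1 1 = 0
  · obtain ⟨k1, k2, k3⟩ := key (p1 1) (p1 2) (p1 0) (by linarith)
    ext i
    · fin_cases i <;> simp_all [localParam, localCoords, polarParamAlt]
    · simp [localParam, localCoords, polarParamAlt, hpole, hz]
  · obtain ⟨k1, k2, k3⟩ := key (p1 0) (p1 1) (p1 2) hs
    ext i
    · fin_cases i <;> simp [localParam, localCoords, polarParam, hpole, k1, k2, k3]
    · simp [localParam, localCoords, polarParam, hpole, hz]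

/-- In the coordinates `(r, θ, ξ)` the warping function is `warpCoord`. -/
theorem warp_polarParam (α k : ℝ) (b : ℝ → ℝ) (χ : ℝ × ℝ → ℝ) (x : Fin 3 → ℝ)
    (h0 : |x 0| < Real.pi / 2) (h1 : |x 1| < Real.pi) :
    warp α k b χ (polarParam x).1 = warpCoord α k b χ (x 0) (x 1) := by
  rw [abs_lt] at h0 h1
  have hc : 0 < Real.cos (x 0) := Real.cos_pos_of_mem_Ioo ⟨by linarith, by linarith⟩
  have hz : (⟨Real.cos (x 0) * Real.cos (x 1), Real.cos (x 0) * Real.sin (x 1)⟩ : ℂ)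
      = (Real.cos (x 0) : ℝ) * (Complex.cos (x 1 : ℝ) + Complex.sin (x 1 : ℝ) * Complex.I) := by
    rw [← Complex.ofReal_cos (x 1), ← Complex.ofReal_sin (x 1)]
    apply Complex.ext <;> simp [-Complex.ofReal_cos, -Complex.ofReal_sin]
  simp only [warp, polarParam]
  congr 1
  · simp [Real.arcsin_sin h0.1.le h0.2.le]
  · simp only [Matrix.cons_val_zero, Matrix.cons_val_one]
    rw [hz, Complex.arg_mul_cos_add_sin_mul_I hc ⟨h1.1, h1.2.le⟩]

/-- In the coordinates `(r, θ, ξ)` the metric is `φ⁻² (dr² + cos² r dθ²) + φ² dξ²`. -/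
theorem metricMatrix_polarParam (α k : ℝ) (b : ℝ → ℝ) (χ : ℝ × ℝ → ℝ) (x : Fin 3 → ℝ) :
    metricMatrix α k b χ polarParam x = Matrix.diagonal
      ![(warp α k b χ (polarParam x).1 ^ 2)⁻¹,
        (warp α k b χ (polarParam x).1 ^ 2)⁻¹ * Real.cos (x 0) ^ 2,
        warp α k b χ (polarParam x).1 ^ 2] := by
  set f : Fin 3 → ((Fin 3 → ℝ) →L[ℝ] ℝ) := fun i => ContinuousLinearMap.proj i with hf
  have hx : ∀ i, HasFDerivAt (fun y : Fin 3 → ℝ => y i) (f i) x := fun i =>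
    (ContinuousLinearMap.proj (R := ℝ) (φ := fun _ : Fin 3 => ℝ) i).hasFDerivAt
  have e1 : HasFDerivAt (fun y : Fin 3 → ℝ => Real.cos (y 0) * Real.cos (y 1)) _ x :=
    (hx 0).cos.mul (hx 1).cos
  have e2 : HasFDerivAt (fun y : Fin 3 → ℝ => Real.cos (y 0) * Real.sin (y 1)) _ x :=
    (hx 0).cos.mul (hx 1).sin
  have e3 : HasFDerivAt (fun y : Fin 3 → ℝ => Real.sin (y 0)) _ x := (hx 0).sin
  have e4 : HasFDerivAt (fun y : Fin 3 → ℝ => Complex.exp ((y 2 : ℝ) * Complex.I)) _ x :=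
    ((Complex.ofRealCLM.hasFDerivAt.comp x (hx 2)).mul_const Complex.I).cexp
  have hdiff : DifferentiableAt ℝ polarParam x := by
    refine DifferentiableAt.prodMk ?_ e4.differentiableAt
    rw [differentiableAt_euclidean]
    intro i
    fin_cases i
    · exact e1.differentiableAt
    · exact e2.differentiableAt
    · exact e3.differentiableAt
  have hL := hdiff.hasFDerivAt
  set L := fderiv ℝ polarParam x with hLdef
  have c (i : Fin 3) : HasFDerivAt (fun y : Fin 3 → ℝ => (polarParam y).1 i)
      (((EuclideanSpace.proj (𝕜 := ℝ) i).comp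
        (ContinuousLinearMap.fst ℝ (EuclideanSpace ℝ (Fin 3)) ℂ)).comp L) x :=
    ((EuclideanSpace.proj (𝕜 := ℝ) i).comp
      (ContinuousLinearMap.fst ℝ (EuclideanSpace ℝ (Fin 3)) ℂ)).hasFDerivAt.comp x hL
  have c4 : HasFDerivAt (fun y : Fin 3 → ℝ => (polarParam y).2)
      ((ContinuousLinearMap.snd ℝ (EuclideanSpace ℝ (Fin 3)) ℂ).comp L) x :=
    (ContinuousLinearMap.snd ℝ (EuclideanSpace ℝ (Fin 3)) ℂ).hasFDerivAt.comp x hL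
  have u1 (v : Fin 3 → ℝ) : (L v).1 0 = Real.cos (x 0) * (-Real.sin (x 1) * v 1)
      + Real.cos (x 1) * (-Real.sin (x 0) * v 0) := DFunLike.congr_fun ((c 0).unique e1) v
  have u2 (v : Fin 3 → ℝ) : (L v).1 1 = Real.cos (x 0) * (Real.cos (x 1) * v 1)
      + Real.sin (x 1) * (-Real.sin (x 0) * v 0) := DFunLike.congr_fun ((c 1).unique e2) v
  have u3 (v : Fin 3 → ℝ) : (L v).1 2 = Real.cos (x 0) * v 0 :=
    DFunLike.congr_fun ((c 2).unique e3) v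
  have u4 (v : Fin 3 → ℝ) : (L v).2 = Complex.exp ((x 2 : ℝ) * Complex.I)
      * (Complex.I * (v 2 : ℝ)) := DFunLike.congr_fun (c4.unique e4) v
  have hs0 := Real.sin_sq_add_cos_sq (x 0)
  have hs1 := Real.sin_sq_add_cos_sq (x 1)
  ext i j
  simp only [metricMatrix, Matrix.of_apply, warpedMetric, PiLp.inner_apply, Fin.sum_univ_three,
    u1, u2, u3, u4, ← hLdef]
  generalize warp α k b χ (polarParam x).1 = φ
  fin_cases i <;> fin_cases j <;>
    simp [mul_pow]
  · have : Real.cos (x 1) ^ 2 * Real.sin (x 0) ^ 2 + Real.sin (x 1) ^ 2 * Real.sin (x 0) ^ 2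
        + Real.cos (x 0) ^ 2 = 1 := by linear_combination Real.sin (x 0) ^ 2 * hs1 + hs0
    rw [this, mul_one]
  · right; ring
  · right; ring
  · left; linear_combination Real.cos (x 0) ^ 2 * hs1

end

/-! On each half of the wedge the product rθ has a fixed sign σ. In a cone β|r| ≤ |θ| ≤ |r|/β both
cutoff factors `b` equal 1 near the origin, because |r|^{1/α} = o(|r|) for α < 1. There the warping
function is 1 + κrθ with κ = kσ, so the singular metric coincides with a metric that is smooth near
q, the model metric. A geodesic leaving q with small velocity in the cone stays in a slightly wider
cone (`IsModelFlow.mem_planeCone`), hence is a model geodesic and is unique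
(`IsModelFlow.isGeodesicFrom`). At q itself it suffices that φ - 1 = O(|rθ|): the Christoffel
symbols there are those of the model.

For the model metric the volume distortion of the exponential map is 1 - Ric(v,v)/6 + ..., where
Ric(v,v) = x² + y² - 2κxy at q. The mixed term would average to zero over a ball, but κxy = k|xy| on
both halves of the wedge, so the wedge sees it with one sign. A large k therefore makes the
fifth-order coefficient positive although the scalar curvature of the model at q does not depend on
k.

No higher differentiability of the exponential map is used. Picard–Lindelöf gives Lipschitz
dependence on the velocity, and `VanishOrd` records the size and the Lipschitz constant of a
remainder together. Integrating the geodesic equation twice yields a cubic expansion with remainder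
of order four (`IsModelFlow.pos_expansion`). After `flatten` has turned Riemannian volume into
Lebesgue measure, two maps that agree to order four have images of tΩ whose volumes differ by a
relative error O(t³), that is O(t⁶) (`volume_image_sub_isBigO`). What remains is a polynomial map
with explicit Jacobian (`volume_flatTaylor_image`) and an integral in polar coordinates
(`integral_wedgePart`).

The curvature bound comes from the formula 2(φ² - |∇φ|²) of `scalarCoord_warpDiag`: ρ_* is small
enough that φ ≥ 3/4 and |∇φ| ≤ 1/2, and 2(9/16 - 1/4) = 5/8. -/

/-! ### Curvature of a metric `f⁻² (dr² + cos² r dθ²) + f² dξ²` -/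

/-- The matrix of `f⁻² (dr² + cos² r dθ²) + f² dξ²`. -/
noncomputable def warpDiag (f : (Fin 3 → ℝ) → ℝ) (x : Fin 3 → ℝ) : Matrix (Fin 3) (Fin 3) ℝ :=
  Matrix.diagonal ![(f x ^ 2)⁻¹, (f x ^ 2)⁻¹ * Real.cos (x 0) ^ 2, f x ^ 2]

theorem inv_warpDiag {f : (Fin 3 → ℝ) → ℝ} {x : Fin 3 → ℝ} (hf : f x ≠ 0)
    (hc : Real.cos (x 0) ≠ 0) :
    (warpDiag f x)⁻¹ = Matrix.diagonal ![f x ^ 2, f x ^ 2 / Real.cos (x 0) ^ 2, (f x ^ 2)⁻¹] := by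
  apply Matrix.inv_eq_right_inv
  rw [warpDiag, Matrix.diagonal_mul_diagonal, ← Matrix.diagonal_one]
  congr 1
  ext i
  fin_cases i <;> simp <;> field_simp

theorem hasFDerivAt_coord (i : Fin 3) (x : Fin 3 → ℝ) :
    HasFDerivAt (fun y : Fin 3 → ℝ => y i)
      (ContinuousLinearMap.proj (R := ℝ) (φ := fun _ : Fin 3 => ℝ) i) x :=
  (ContinuousLinearMap.proj (R := ℝ) (φ := fun _ : Fin 3 => ℝ) i).hasFDerivAt

theorem partialDeriv_congr {f g : (Fin 3 → ℝ) → ℝ} {x : Fin 3 → ℝ} (h : f =ᶠ[𝓝 x] g) (i : Fin 3) :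
    partialDeriv i f x = partialDeriv i g x := by
  rw [partialDeriv, partialDeriv, h.fderiv_eq]

@[simp] theorem partialDeriv_const (i : Fin 3) (a : ℝ) (x : Fin 3 → ℝ) :
    partialDeriv i (fun _ => a) x = 0 := by
  simp [partialDeriv]

/-- The partial derivatives of the coefficients of `warpDiag f`. -/
theorem partialDeriv_warpDiag {f : (Fin 3 → ℝ) → ℝ} {x : Fin 3 → ℝ} (hd : DifferentiableAt ℝ f x)
    (hf : f x ≠ 0) (i a b : Fin 3) :
    partialDeriv i (fun y => warpDiag f y a b) x = Matrix.diagonal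
      ![-2 * partialDeriv i f x / f x ^ 3,
        -2 * partialDeriv i f x / f x ^ 3 * Real.cos (x 0) ^ 2
          - (f x ^ 2)⁻¹ * (2 * Real.cos (x 0) * Real.sin (x 0)) * (Pi.single i 1 : Fin 3 → ℝ) 0,
        2 * f x * partialDeriv i f x] a b := by
  have e1 := hd.hasFDerivAt.pow 2
  have e2 := (hasDerivAt_inv (pow_ne_zero 2 hf)).comp_hasFDerivAt x e1
  have e3 := e2.mul ((hasFDerivAt_coord 0 x).cos.pow 2)
  by_cases hab : a = b
  · subst hab
    fin_cases a
    · have : (fun y => warpDiag f y 0 0) = (fun y => y⁻¹) ∘ fun y => f y ^ 2 := by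
        ext y; simp [warpDiag]
      simp only [Fin.zero_eta, partialDeriv, this]
      rw [e2.fderiv]
      simp
      field_simp
    · have : (fun y => warpDiag f y 1 1) =
          ((fun y => y⁻¹) ∘ fun y => f y ^ 2) * fun y => Real.cos (y 0) ^ 2 := by
        ext y; simp [warpDiag]
      simp only [Fin.mk_one, partialDeriv, this]
      rw [e3.fderiv]
      simp
      field_simp
      ring
    · have : (fun y => warpDiag f y 2 2) = fun y => f y ^ 2 := by
        ext y; simp [warpDiag]
      simp only [Fin.reduceFinMk, partialDeriv, this]
      rw [e1.fderiv]
      simp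
  · simp [warpDiag, Matrix.diagonal_apply_ne _ hab]

/-- The Christoffel symbols of `warpDiag f` with `p, q` the logarithmic derivatives of `f`. -/
noncomputable def warpChristoffel (k i j : Fin 3) (f p q r : ℝ) : ℝ :=
  (![!![-p, -q, 0; -q, p * Real.cos r ^ 2 + Real.cos r * Real.sin r, 0; 0, 0, -(f ^ 4 * p)],
    !![q / Real.cos r ^ 2, -p - Real.sin r / Real.cos r, 0;
      -p - Real.sin r / Real.cos r, -q, 0; 0, 0, -(f ^ 4 * q / Real.cos r ^ 2)],
    !![0, 0, p; 0, 0, q; p, q, 0]] : Fin 3 → Matrix (Fin 3) (Fin 3) ℝ) k i j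

theorem christoffel_warpDiag {f : (Fin 3 → ℝ) → ℝ} {x : Fin 3 → ℝ} (hd : DifferentiableAt ℝ f x)
    (hf : f x ≠ 0) (hc : Real.cos (x 0) ≠ 0) (h2 : partialDeriv 2 f x = 0) (k i j : Fin 3) :
    christoffel (warpDiag f) k i j x = warpChristoffel k i j (f x) (partialDeriv 0 f x / f x)
      (partialDeriv 1 f x / f x) (x 0) := by
  unfold christoffel
  simp only [partialDeriv_warpDiag hd hf, inv_warpDiag hf hc, Fin.sum_univ_three]
  fin_cases k <;> fin_cases i <;> fin_cases j <;>
    simp [warpChristoffel, h2] <;> field_simp <;> ring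

theorem christoffel_congr {G H : (Fin 3 → ℝ) → Matrix (Fin 3) (Fin 3) ℝ} {x : Fin 3 → ℝ}
    (h : G =ᶠ[𝓝 x] H) (k i j : Fin 3) : christoffel G k i j x = christoffel H k i j x := by
  have h' (a b : Fin 3) : (fun y => G y a b) =ᶠ[𝓝 x] fun y => H y a b :=
    h.mono fun y hy => by simp only [hy]
  simp only [christoffel, h.self_of_nhds, partialDeriv_congr (h' _ _)]

theorem christoffel_eventuallyEq {G H : (Fin 3 → ℝ) → Matrix (Fin 3) (Fin 3) ℝ} {x : Fin 3 → ℝ}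
    (h : G =ᶠ[𝓝 x] H) (k i j : Fin 3) : christoffel G k i j =ᶠ[𝓝 x] christoffel H k i j :=
  h.eventuallyEq_nhds.mono fun _ hy => christoffel_congr hy k i j

theorem scalarCoord_congr {G H : (Fin 3 → ℝ) → Matrix (Fin 3) (Fin 3) ℝ} {x : Fin 3 → ℝ}
    (h : G =ᶠ[𝓝 x] H) : scalarCoord G x = scalarCoord H x := by
  simp only [scalarCoord, ricciCoord, christoffel_congr h, h.self_of_nhds,
    partialDeriv_congr (christoffel_eventuallyEq h _ _ _)]

/-- Only diagonal Ricci components enter the scalar curvature of a diagonal metric. These are the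
derivatives they require beyond those of ±p and ±q. -/
theorem partialDeriv_christoffel_entries {f p q : (Fin 3 → ℝ) → ℝ} {x : Fin 3 → ℝ}
    (hf : DifferentiableAt ℝ f x) (hp : DifferentiableAt ℝ p x) (hq : DifferentiableAt ℝ q x)
    (hc : Real.cos (x 0) ≠ 0) :
    (partialDeriv 1 (fun y => q y / Real.cos (y 0) ^ 2) x =
          partialDeriv 1 q x / Real.cos (x 0) ^ 2) ∧
    (partialDeriv 0 (fun y => p y * Real.cos (y 0) ^ 2 + Real.cos (y 0) * Real.sin (y 0)) x =
          partialDeriv 0 p x * Real.cos (x 0) ^ 2 - 2 * p x * Real.cos (x 0) * Real.sin (x 0)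
            + Real.cos (x 0) ^ 2 - Real.sin (x 0) ^ 2) ∧
    (partialDeriv 0 (fun y => f y ^ 4 * p y) x =
          f x ^ 4 * partialDeriv 0 p x + 4 * f x ^ 3 * partialDeriv 0 f x * p x) ∧
    (partialDeriv 1 (fun y => f y ^ 4 * q y / Real.cos (y 0) ^ 2) x =
          (f x ^ 4 * partialDeriv 1 q x + 4 * f x ^ 3 * partialDeriv 1 f x * q x)
            / Real.cos (x 0) ^ 2) ∧
    (partialDeriv 0 (fun y => - p y - Real.sin (y 0) / Real.cos (y 0)) x =
          - partialDeriv 0 p x - 1 / Real.cos (x 0) ^ 2) := by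
  have ef := hf.hasFDerivAt
  have ep := hp.hasFDerivAt
  have eq := hq.hasFDerivAt
  have ec := (hasFDerivAt_coord 0 x).cos
  have es := (hasFDerivAt_coord 0 x).sin
  have e2 : HasFDerivAt (fun y : Fin 3 → ℝ => (Real.cos (y 0) ^ 2)⁻¹) _ x :=
    (hasDerivAt_inv (pow_ne_zero 2 hc)).comp_hasFDerivAt x (ec.pow 2)
  have e3 : HasFDerivAt (fun y : Fin 3 → ℝ => (Real.cos (y 0))⁻¹) _ x :=
    (hasDerivAt_inv hc).comp_hasFDerivAt x ec
  refine ⟨?_, ?_, ?_, ?_, ?_⟩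
  · rw [partialDeriv]
    simp only [div_eq_mul_inv]
    rw [(eq.fun_mul e2).fderiv]
    simp [partialDeriv]
    ring
  · rw [partialDeriv, ((ep.fun_mul (ec.pow 2)).fun_add (ec.fun_mul es)).fderiv]
    simp [partialDeriv]
    ring
  · rw [partialDeriv, ((ef.pow 4).fun_mul ep).fderiv]
    simp [partialDeriv]
    ring
  · rw [partialDeriv]
    simp only [div_eq_mul_inv]
    rw [(((ef.pow 4).fun_mul eq).fun_mul e2).fderiv]
    simp [partialDeriv]
    ring
  · rw [partialDeriv]
    simp only [div_eq_mul_inv]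
    rw [(ep.fun_neg.fun_sub (es.fun_mul e3)).fderiv]
    simp [partialDeriv]
    field_simp
    linear_combination Real.sin_sq_add_cos_sq (x 0)

/-- The scalar curvature of `f⁻² (dr² + cos² r dθ²) + f² dξ²` is `2 (f² - |∇f|²)`. -/
theorem scalarCoord_warpDiag {f : (Fin 3 → ℝ) → ℝ} {x : Fin 3 → ℝ} (hd : ContDiffAt ℝ 2 f x)
    (hf : f x ≠ 0) (hc : Real.cos (x 0) ≠ 0) (h2 : partialDeriv 2 f =ᶠ[𝓝 x] 0) :
    scalarCoord (warpDiag f) x = 2 * f x ^ 2 -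
      2 * (partialDeriv 0 f x ^ 2 + partialDeriv 1 f x ^ 2 / Real.cos (x 0) ^ 2) := by
  -- The Ricci tensor differentiates the Christoffel symbols, so their formula is needed on a
  -- neighbourhood and not just at x.
  have hΓ (k i j : Fin 3) : christoffel (warpDiag f) k i j =ᶠ[𝓝 x] fun y =>
      warpChristoffel k i j (f y) (partialDeriv 0 f y / f y) (partialDeriv 1 f y / f y) (y 0) := by
    filter_upwards [hd.eventually (by simp), hd.continuousAt.eventually_ne hf,
      ContinuousAt.eventually_ne
        (g := fun y : Fin 3 → ℝ => Real.cos (y 0))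
        (Real.continuous_cos.comp (continuous_apply 0)).continuousAt hc, h2]
      with y h1 h2 h3 h4
    exact christoffel_warpDiag (h1.differentiableAt (by simp)) h2 h3 h4 k i j
  have hdiff : DifferentiableAt ℝ f x := hd.differentiableAt (by simp)
  have hp (i : Fin 3) : DifferentiableAt ℝ (partialDeriv i f) x := by
    have : DifferentiableAt ℝ (fderiv ℝ f) x :=
      (hd.fderiv_right (m := 1) (by norm_num)).differentiableAt (by simp)
    exact this.clm_apply (differentiableAt_const _)
  have ef := hdiff.hasFDerivAt
  have ei := (hasDerivAt_inv hf).comp_hasFDerivAt x ef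
  have hpq (k : Fin 3) : DifferentiableAt ℝ (fun y => partialDeriv k f y / f y) x := by
    simp only [div_eq_mul_inv]
    exact (hp k).fun_mul ei.differentiableAt
  unfold scalarCoord ricciCoord
  simp only [hΓ _ _ _ |>.eq_of_nhds, partialDeriv_congr (hΓ _ _ _), inv_warpDiag hf hc,
    Fin.sum_univ_three]
  simp only [warpChristoffel]
  have n (i : Fin 3) (g : (Fin 3 → ℝ) → ℝ) :
      partialDeriv i (fun y => - g y) x = - partialDeriv i g x := by
    simp [partialDeriv]
  have hE := partialDeriv_christoffel_entries hdiff (hpq 0) (hpq 1) hc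
  obtain ⟨a1, a2, a3, a4, a5⟩ := hE
  have hsc : Real.sin (x 0) ^ 2 = 1 - Real.cos (x 0) ^ 2 := Real.sin_sq (x 0)
  simp [n, a1, a2, a3, a4, a5]
  -- Second derivatives of log f occur only through these two quantities, and they cancel in the
  -- trace.
  generalize partialDeriv 0 (fun y => partialDeriv 0 f y / f y) x = p'
  generalize partialDeriv 1 (fun y => partialDeriv 1 f y / f y) x = q'
  generalize hP : partialDeriv 0 f x / f x = P
  generalize hQ : partialDeriv 1 f x / f x = Q
  rw [div_eq_iff hf] at hP hQ
  rw [hP, hQ]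
  generalize Real.sin (x 0) = σ at *
  generalize Real.cos (x 0) = c at *
  field_simp
  linear_combination -hsc

/-! ### The warping function away from the singular circle -/

theorem rhoStar_pos {α k : ℝ} (hα : 0 < α) : 0 < rhoStar α k := by
  have hs : 0 < √(1 + (1 / Real.cos (1 / 2)) ^ 2) := Real.sqrt_pos.mpr (by positivity)
  unfold rhoStar
  positivity

theorem rhoStar_le_quarter (α k : ℝ) : rhoStar α k ≤ 1 / 4 := min_le_left _ _

/-- The second entry of the minimum defining ρ_* serves to keep the warping function above 3/4. -/
theorem abs_mul_rhoStar_le (α k : ℝ) : |k| * rhoStar α k ≤ 1 / 4 := by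
  have h : rhoStar α k ≤ 1 / (4 * (1 + |k|)) := (min_le_right _ _).trans (min_le_left _ _)
  calc |k| * rhoStar α k ≤ |k| * (1 / (4 * (1 + |k|))) := by gcongr
    _ ≤ 1 / 4 := by
      rw [mul_one_div, div_le_div_iff₀ (by positivity) (by norm_num)]
      linarith

/-- The third entry of the minimum is designed for this bound. The first factors bound each partial
derivative of φ, and the square root converts this into a bound for the round gradient when |r| ≤
1/2. -/
theorem rhoStar_gradient_le {α k : ℝ} (hα : 0 < α) :
    |k| * (15 + 10 / α) * (2 * rhoStar α k) * √(1 + (1 / Real.cos (1 / 2)) ^ 2) ≤ 1 / 2 := by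
  have hs : 0 < √(1 + (1 / Real.cos (1 / 2)) ^ 2) := Real.sqrt_pos.mpr (by positivity)
  have h : rhoStar α k ≤ 1 / (4 * (1 + |k|) * (15 + 10 / α) *
      √(1 + (1 / Real.cos (1 / 2)) ^ 2)) := (min_le_right _ _).trans (min_le_right _ _)
  calc |k| * (15 + 10 / α) * (2 * rhoStar α k) * √(1 + (1 / Real.cos (1 / 2)) ^ 2)
      ≤ |k| * (15 + 10 / α) * (2 * (1 / (4 * (1 + |k|) * (15 + 10 / α) *
      √(1 + (1 / Real.cos (1 / 2)) ^ 2)))) * √(1 + (1 / Real.cos (1 / 2)) ^ 2) := by gcongr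
    _ = |k| / (1 + |k|) / 2 := by
      field_simp
      norm_num
    _ ≤ 1 / 2 := by
      have : |k| / (1 + |k|) ≤ 1 := by
        rw [div_le_one (by positivity)]
        linarith
      linarith

theorem psi_comm (α : ℝ) (b : ℝ → ℝ) (r θ : ℝ) : psi α b r θ = psi α b θ r := by
  unfold psi
  rw [mul_comm r θ]
  ring

theorem psi_nonneg {b : ℝ → ℝ} (hb : IsTransition b) (α r θ : ℝ) : 0 ≤ psi α b r θ :=
  mul_nonneg (mul_nonneg (abs_nonneg _) (hb.nonneg _)) (hb.nonneg _)

theorem psi_le {b : ℝ → ℝ} (hb : IsTransition b) (α r θ : ℝ) : psi α b r θ ≤ |r * θ| := by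
  unfold psi
  rw [mul_assoc]
  exact mul_le_of_le_one_right (abs_nonneg _)
    (mul_le_one₀ (hb.le_one _) (hb.nonneg _) (hb.le_one _))

/-- As r tends to 0 with θ away from 0, the argument |r|/|θ|^{1/α} drops below 1/2, where `b`
vanishes. -/
theorem psi_eventuallyEq_zero {b : ℝ → ℝ} (hb : IsTransition b) (α : ℝ) {θ : ℝ} (hθ : θ ≠ 0) :
    (fun p : ℝ × ℝ => psi α b p.1 p.2) =ᶠ[𝓝 (0, θ)] fun _ => 0 := by
  have hθ' : |θ| ^ (1 / α) ≠ 0 := (Real.rpow_pos_of_pos (abs_pos.mpr hθ) _).ne'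
  have hc : ContinuousAt (fun p : ℝ × ℝ => |p.1| / |p.2| ^ (1 / α)) (0, θ) := by
    refine ContinuousAt.div (by fun_prop) ?_ hθ'
    exact ContinuousAt.rpow_const (by fun_prop) (Or.inl (abs_ne_zero.mpr hθ))
  have : ∀ᶠ p : ℝ × ℝ in 𝓝 (0, θ), |p.1| / |p.2| ^ (1 / α) < 1 / 2 :=
    hc.eventually_lt continuousAt_const (by simp)
  filter_upwards [this] with p hp
  rw [psi, hb.eq_zero _ hp.le, mul_zero]

/-- The absolute values and powers are smooth off the axes, and near an axis point other than the
origin the profile is identically 0. -/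
theorem psi_contDiffAt {b : ℝ → ℝ} (hb : IsTransition b) (α : ℝ) {p : ℝ × ℝ} (hp : p ≠ 0) :
    ContDiffAt ℝ ∞ (fun p : ℝ × ℝ => psi α b p.1 p.2) p := by
  obtain ⟨r, θ⟩ := p
  by_cases hr : r = 0
  · subst hr
    have hθ : θ ≠ 0 := fun h => hp (by simp [h])
    exact contDiffAt_const.congr_of_eventuallyEq (psi_eventuallyEq_zero hb α hθ)
  by_cases hθ : θ = 0
  · subst hθ
    have h : Tendsto Prod.swap (𝓝 ((r, 0) : ℝ × ℝ)) (𝓝 (0, r)) :=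
      continuous_swap.tendsto ((r, 0) : ℝ × ℝ)
    refine contDiffAt_const.congr_of_eventuallyEq (f := fun _ => (0 : ℝ)) ?_
    filter_upwards [h.eventually (psi_eventuallyEq_zero hb α hr)] with p hp
    rw [psi_comm]
    exact hp
  have h1 : ContDiffAt ℝ ∞ (fun p : ℝ × ℝ => |p.1|) (r, θ) :=
    (contDiffAt_abs hr).comp (r, θ) contDiffAt_fst
  have h2 : ContDiffAt ℝ ∞ (fun p : ℝ × ℝ => |p.2|) (r, θ) :=
    (contDiffAt_abs hθ).comp (r, θ) contDiffAt_snd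
  have hr' := abs_pos.mpr hr
  have hθ' := abs_pos.mpr hθ
  have h3 := h2.div (h1.rpow_const_of_ne (p := 1 / α) hr'.ne') (Real.rpow_pos_of_pos hr' _).ne'
  have h4 := h1.div (h2.rpow_const_of_ne (p := 1 / α) hθ'.ne') (Real.rpow_pos_of_pos hθ' _).ne'
  have h5 := ((h1.mul h2).mul (hb.smooth.contDiffAt.comp (r, θ) h3)).mul
    (hb.smooth.contDiffAt.comp (r, θ) h4)
  refine h5.congr_of_eventuallyEq (Eventually.of_forall fun p => ?_)
  simp [psi, abs_mul]

/-- The derivative vanishes beyond 1, so the factor x costs nothing. This scale-invariant bound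
absorbs the singular derivatives of the two ratios in `psi`. -/
theorem IsTransition.abs_deriv_mul_le {b : ℝ → ℝ} (hb : IsTransition b) {x : ℝ} (hx : 0 ≤ x) :
    |deriv b x| * x ≤ 10 := by
  rcases le_or_gt x 1 with h | h
  · calc |deriv b x| * x ≤ 10 * 1 := mul_le_mul (hb.deriv_le x) h hx (by norm_num)
      _ = 10 := by norm_num
  · have : b =ᶠ[𝓝 x] fun _ => 1 := by
      filter_upwards [lt_mem_nhds h] with y hy using hb.eq_one y hy.le
    simp [this.deriv_eq]

/-- The derivative of `psi` in the first variable is at most `(11 + 10 / α) |θ|`. -/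
theorem psi_hasDerivAt {b : ℝ → ℝ} (hb : IsTransition b) {α : ℝ} (hα : 0 < α) (r θ : ℝ) :
    ∃ d, HasDerivAt (fun r => psi α b r θ) d r ∧ |d| ≤ (11 + 10 / α) * |θ| := by
  by_cases hθ : θ = 0
  · subst hθ
    exact ⟨0, by simpa [psi] using hasDerivAt_const r (0 : ℝ), by simp⟩
  by_cases hr : r = 0
  · subst hr
    refine ⟨0, ?_, by simp; positivity⟩
    have h : Tendsto (fun r : ℝ => (r, θ)) (𝓝 0) (𝓝 (0, θ)) :=
      (Continuous.prodMk_left θ).tendsto 0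
    exact (hasDerivAt_const (0 : ℝ) (0 : ℝ)).congr_of_eventuallyEq
      (h.eventually (psi_eventuallyEq_zero hb α hθ))
  have hr' := abs_pos.mpr hr
  have hθ' := abs_pos.mpr hθ
  set ε : ℝ := (SignType.sign r : ℝ) with hε
  have hε1 : |ε| ≤ 1 := by
    rcases lt_or_gt_of_ne hr with h | h <;> simp [hε, h]
  have habs : HasDerivAt (fun r : ℝ => |r|) ε r := hasDerivAt_abs hr
  set A := |θ| / |r| ^ (1 / α) with hA
  set C := |r| / |θ| ^ (1 / α) with hC
  have hA0 : 0 ≤ A := by positivity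
  have hC0 : 0 ≤ C := by positivity
  have hdb (x : ℝ) : HasDerivAt b (deriv b x) x :=
    (hb.smooth.differentiable (by simp) x).hasDerivAt
  have hpow := habs.rpow_const (p := 1 / α) (Or.inl hr'.ne')
  have hA' : HasDerivAt (fun r : ℝ => |θ| / |r| ^ (1 / α)) (-(ε * (1 / α) * A / |r|)) r := by
    have hq := (Real.rpow_pos_of_pos hr' (1 / α)).ne'
    refine ((hasDerivAt_const r |θ|).div hpow hq).congr_deriv ?_
    rw [hA, Real.rpow_sub_one hr'.ne']
    field_simp
    ring
  have hC' : HasDerivAt (fun r : ℝ => |r| / |θ| ^ (1 / α)) (ε / |θ| ^ (1 / α)) r :=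
    habs.div_const _
  have hd := ((habs.mul_const |θ|).mul ((hdb A).comp r hA')).mul ((hdb C).comp r hC')
  refine ⟨_, hd.congr_of_eventuallyEq (Eventually.of_forall fun p => ?_), ?_⟩
  · simp [psi, abs_mul]
  simp only [Function.comp_apply, Pi.mul_apply, ← hA, ← hC]
  -- Logarithmic differentiation of the ratios A and C turns the derivative into |θ| times a bounded
  -- bracket. Its three terms are at most 1, 10/α and 10, which gives 11 + 10/α.
  have e : (ε * |θ| * b A + |r| * |θ| * (deriv b A * -(ε * (1 / α) * A / |r|))) * b C
      + |r| * |θ| * b A * (deriv b C * (ε / |θ| ^ (1 / α)))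
      = ε * |θ| * (b A * b C - 1 / α * (deriv b A * A) * b C + b A * (deriv b C * C)) := by
    rw [hC]
    field_simp
    ring
  have hbA := abs_of_nonneg (hb.nonneg A)
  have hbC := abs_of_nonneg (hb.nonneg C)
  have k1 : |b A * b C| ≤ 1 := by
    rw [abs_mul, hbA, hbC]
    exact mul_le_one₀ (hb.le_one _) (hb.nonneg _) (hb.le_one _)
  have k2 : |1 / α * (deriv b A * A) * b C| ≤ 10 / α := by
    rw [abs_mul, abs_mul, abs_mul, hbC, abs_of_nonneg hA0, abs_of_pos (by positivity : 0 < 1 / α)]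
    calc 1 / α * (|deriv b A| * A) * b C ≤ 1 / α * 10 * 1 := by
          gcongr
          · exact hb.nonneg _
          · exact hb.abs_deriv_mul_le hA0
          · exact hb.le_one _
      _ = 10 / α := by ring
  have k3 : |b A * (deriv b C * C)| ≤ 10 := by
    rw [abs_mul, abs_mul, hbA, abs_of_nonneg hC0]
    calc b A * (|deriv b C| * C) ≤ 1 * 10 := by
          gcongr
          · exact hb.le_one _
          · exact hb.abs_deriv_mul_le hC0
      _ = 10 := by ring
  rw [e, abs_mul, abs_mul, abs_abs, mul_comm]
  refine mul_le_mul ?_ (mul_le_of_le_one_left (abs_nonneg _) hε1) (by positivity) (by positivity)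
  calc _ ≤ |b A * b C| + |1 / α * (deriv b A * A) * b C| + |b A * (deriv b C * C)| :=
        (abs_add_le _ _).trans (by gcongr; exact abs_sub _ _)
    _ ≤ _ := by linarith

theorem cutoff_eq_zero {χ : ℝ × ℝ → ℝ} (hχ : IsPlaneCutoff χ) {ρ r θ : ℝ} (hρ : 0 < ρ)
    (h : 2 * ρ < |r| ∨ 2 * ρ < |θ|) : χ (r / ρ, θ / ρ) = 0 := by
  refine hχ.eq_zero _ fun ⟨h1, h2⟩ => ?_
  simp only [abs_div, abs_of_pos hρ, div_le_iff₀ hρ] at h1 h2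
  rcases h with h | h <;> linarith

theorem warpCoord_eq_one {χ : ℝ × ℝ → ℝ} (hχ : IsPlaneCutoff χ) {α : ℝ} (hα : 0 < α) (k : ℝ)
    (b : ℝ → ℝ) {r θ : ℝ} (h : 2 * rhoStar α k < |r| ∨ 2 * rhoStar α k < |θ|) :
    warpCoord α k b χ r θ = 1 := by
  simp [warpCoord, cutoff_eq_zero hχ (rhoStar_pos hα) h]

/-- On the support of the cutoff |rθ| ≤ 4ρ_*² ≤ ρ_*, so the perturbation is at most |k|ρ_* ≤ 1/4. -/
theorem warpCoord_ge {χ : ℝ × ℝ → ℝ} (hχ : IsPlaneCutoff χ) {b : ℝ → ℝ} (hb : IsTransition b)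
    {α : ℝ} (hα : 0 < α) (k r θ : ℝ) : 3 / 4 ≤ warpCoord α k b χ r θ := by
  by_cases h : 2 * rhoStar α k < |r| ∨ 2 * rhoStar α k < |θ|
  · rw [warpCoord_eq_one hχ hα k b h]
    norm_num
  push Not at h
  have hρ := rhoStar_pos (k := k) hα
  have h1 : psi α b r θ ≤ rhoStar α k := by
    calc psi α b r θ ≤ |r| * |θ| := by rw [← abs_mul]; exact psi_le hb α r θ
      _ ≤ (2 * rhoStar α k) * (2 * rhoStar α k) :=
        mul_le_mul h.1 h.2 (abs_nonneg _) (by positivity)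
      _ ≤ rhoStar α k := by nlinarith [rhoStar_le_quarter α k]
  have h2 : |k * χ (r / rhoStar α k, θ / rhoStar α k) * psi α b r θ| ≤ 1 / 4 := by
    rw [abs_mul, abs_mul, abs_of_nonneg (hχ.nonneg _), abs_of_nonneg (psi_nonneg hb _ _ _)]
    calc _ ≤ |k| * 1 * rhoStar α k := by
          gcongr
          · exact psi_nonneg hb _ _ _
          · exact hχ.le_one _
      _ ≤ 1 / 4 := by rw [mul_one]; exact abs_mul_rhoStar_le α k
  rw [warpCoord]
  linarith [(abs_le.mp h2).1]

theorem warpCoord_comm (α k : ℝ) (b : ℝ → ℝ) (χ : ℝ × ℝ → ℝ) (r θ : ℝ) :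
    warpCoord α k b χ r θ = warpCoord α k b (χ ∘ Prod.swap) θ r := by
  simp [warpCoord, psi_comm α b r θ]

theorem warpCoord_contDiffAt {χ : ℝ × ℝ → ℝ} (hχ : IsPlaneCutoff χ) {b : ℝ → ℝ}
    (hb : IsTransition b) (α k : ℝ) {p : ℝ × ℝ} (hp : p ≠ 0) :
    ContDiffAt ℝ ∞ (fun p : ℝ × ℝ => warpCoord α k b χ p.1 p.2) p := by
  have h1 : ContDiffAt ℝ ∞ (fun p : ℝ × ℝ => χ (p.1 / rhoStar α k, p.2 / rhoStar α k)) p :=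
    hχ.smooth.contDiffAt.comp p
      ((contDiffAt_fst.div_const _).prodMk (contDiffAt_snd.div_const _))
  exact contDiffAt_const.add ((contDiffAt_const.mul h1).mul (psi_contDiffAt hb α hp))

theorem IsPlaneCutoff.swap {χ : ℝ × ℝ → ℝ} (hχ : IsPlaneCutoff χ) :
    IsPlaneCutoff (χ ∘ Prod.swap) where
  smooth := hχ.smooth.comp (contDiff_snd.prodMk contDiff_fst)
  nonneg _ := hχ.nonneg _
  le_one _ := hχ.le_one _
  eq_one _ h1 h2 := hχ.eq_one _ h2 h1
  eq_zero _ h := hχ.eq_zero _ fun h' => h h'.symm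

/-- By the product rule, differentiating the cutoff costs (2/ρ_*)·2ρ_*|θ| = 4|θ| and differentiating
the profile costs (11 + 10/α)|θ|. With |θ| ≤ 2ρ_* on the support this gives the constant 15 + 10/α.
The last clause holds because the support lies in |r|, |θ| ≤ 2ρ_* ≤ 1/2. -/
theorem warpCoord_hasDerivAt {χ : ℝ × ℝ → ℝ} (hχ : IsPlaneCutoff χ) {b : ℝ → ℝ}
    (hb : IsTransition b) {α : ℝ} (hα : 0 < α) (k : ℝ) (hgrad : ∀ x, |fderiv ℝ χ x (1, 0)| ≤ 2)
    (r θ : ℝ) : ∃ d, HasDerivAt (fun r => warpCoord α k b χ r θ) d r ∧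
      |d| ≤ |k| * (15 + 10 / α) * (2 * rhoStar α k) ∧ (1 / 2 < |r| ∨ 1 / 2 < |θ| → d = 0) := by
  have hρ := rhoStar_pos (k := k) hα
  have hρ4 := rhoStar_le_quarter α k
  by_cases h : 2 * rhoStar α k < |r| ∨ 2 * rhoStar α k < |θ|
  · refine ⟨0, ?_, by simp; positivity, fun _ => rfl⟩
    refine (hasDerivAt_const r (1 : ℝ)).congr_of_eventuallyEq ?_
    rcases h with h | h
    · filter_upwards [continuous_abs.continuousAt.eventually (lt_mem_nhds h)] with s hs
      exact warpCoord_eq_one hχ hα k b (Or.inl hs)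
    · exact Eventually.of_forall fun s => warpCoord_eq_one hχ hα k b (Or.inr h)
  push Not at h
  set ρ := rhoStar α k with hρdef
  obtain ⟨d, hd, hd'⟩ := psi_hasDerivAt hb hα r θ
  have h1 : HasDerivAt (fun r => χ (r / ρ, θ / ρ))
      (fderiv ℝ χ (r / ρ, θ / ρ) (1 / ρ, 0)) r :=
    (hχ.smooth.differentiable (by simp) _).hasFDerivAt.comp_hasDerivAt r
      (((hasDerivAt_id r).div_const ρ).prodMk (hasDerivAt_const r (θ / ρ)))
  have h2 : fderiv ℝ χ (r / ρ, θ / ρ) (1 / ρ, 0) =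
      (1 / ρ) * fderiv ℝ χ (r / ρ, θ / ρ) (1, 0) := by
    rw [← smul_eq_mul, ← map_smul]
    simp
  refine ⟨_, ((h1.const_mul k).mul hd).const_add 1, ?_, ?_⟩
  · rw [h2]
    generalize hG : fderiv ℝ χ (r / ρ, θ / ρ) (1, 0) = G
    have hG2 : |G| ≤ 2 := hG ▸ hgrad _
    have t1 : |k * (1 / ρ * G) * psi α b r θ| ≤ |k| * (4 * |θ|) := by
      rw [abs_mul, abs_mul, abs_mul, abs_of_pos (by positivity : 0 < 1 / ρ),
        abs_of_nonneg (psi_nonneg hb _ _ _)]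
      have : psi α b r θ ≤ 2 * ρ * |θ| := by
        refine (psi_le hb α r θ).trans ?_
        rw [abs_mul]
        gcongr
        exact h.1
      calc |k| * (1 / ρ * |G|) * psi α b r θ ≤ |k| * (1 / ρ * 2) * (2 * ρ * |θ|) := by
            gcongr
            exact psi_nonneg hb _ _ _
        _ = |k| * (4 * |θ|) := by field_simp; ring
    have t2 : |k * χ (r / ρ, θ / ρ) * d| ≤ |k| * ((11 + 10 / α) * |θ|) := by
      rw [abs_mul, abs_mul, abs_of_nonneg (hχ.nonneg _)]
      calc _ ≤ |k| * 1 * ((11 + 10 / α) * |θ|) := by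
            gcongr
            exact hχ.le_one _
        _ = _ := by ring
    calc _ ≤ |k| * (4 * |θ|) + |k| * ((11 + 10 / α) * |θ|) := (abs_add_le _ _).trans (by gcongr)
      _ = |k| * (15 + 10 / α) * |θ| := by ring
      _ ≤ _ := by gcongr; exact h.2
  · intro h'
    exfalso
    rcases h' with h' | h' <;> linarith

/-! ### The metric in the two charts of S² × S¹ -/

theorem metricMatrix_polarParam_eq (α k : ℝ) (b : ℝ → ℝ) (χ : ℝ × ℝ → ℝ) :
    metricMatrix α k b χ polarParam = warpDiag fun x => warp α k b χ (polarParam x).1 :=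
  funext fun x => metricMatrix_polarParam α k b χ x

theorem metricMatrix_polarParamAlt_eq (α k : ℝ) (b : ℝ → ℝ) (χ : ℝ × ℝ → ℝ) :
    metricMatrix α k b χ polarParamAlt = warpDiag fun x => warp α k b χ (polarParamAlt x).1 := by
  funext x
  have hx := fun i => hasFDerivAt_coord i x
  have e1 : HasFDerivAt (fun y : Fin 3 → ℝ => Real.cos (y 0) * Real.cos (y 1)) _ x :=
    (hx 0).cos.mul (hx 1).cos
  have e2 : HasFDerivAt (fun y : Fin 3 → ℝ => Real.cos (y 0) * Real.sin (y 1)) _ x :=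
    (hx 0).cos.mul (hx 1).sin
  have e3 : HasFDerivAt (fun y : Fin 3 → ℝ => Real.sin (y 0)) _ x := (hx 0).sin
  have e4 : HasFDerivAt (fun y : Fin 3 → ℝ => Complex.exp ((y 2 : ℝ) * Complex.I)) _ x :=
    ((Complex.ofRealCLM.hasFDerivAt.comp x (hx 2)).mul_const Complex.I).cexp
  have hdiff : DifferentiableAt ℝ polarParamAlt x := by
    refine DifferentiableAt.prodMk ?_ e4.differentiableAt
    rw [differentiableAt_euclidean]
    intro i
    fin_cases i
    · exact e3.differentiableAt
    · exact e1.differentiableAt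
    · exact e2.differentiableAt
  have hL := hdiff.hasFDerivAt
  set L := fderiv ℝ polarParamAlt x with hLdef
  have c (i : Fin 3) : HasFDerivAt (fun y : Fin 3 → ℝ => (polarParamAlt y).1 i)
      (((EuclideanSpace.proj (𝕜 := ℝ) i).comp
        (ContinuousLinearMap.fst ℝ (EuclideanSpace ℝ (Fin 3)) ℂ)).comp L) x :=
    ((EuclideanSpace.proj (𝕜 := ℝ) i).comp
      (ContinuousLinearMap.fst ℝ (EuclideanSpace ℝ (Fin 3)) ℂ)).hasFDerivAt.comp x hL
  have c4 : HasFDerivAt (fun y : Fin 3 → ℝ => (polarParamAlt y).2)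
      ((ContinuousLinearMap.snd ℝ (EuclideanSpace ℝ (Fin 3)) ℂ).comp L) x :=
    (ContinuousLinearMap.snd ℝ (EuclideanSpace ℝ (Fin 3)) ℂ).hasFDerivAt.comp x hL
  have u1 (v : Fin 3 → ℝ) : (L v).1 1 = Real.cos (x 0) * (-Real.sin (x 1) * v 1)
      + Real.cos (x 1) * (-Real.sin (x 0) * v 0) := DFunLike.congr_fun ((c 1).unique e1) v
  have u2 (v : Fin 3 → ℝ) : (L v).1 2 = Real.cos (x 0) * (Real.cos (x 1) * v 1)
      + Real.sin (x 1) * (-Real.sin (x 0) * v 0) := DFunLike.congr_fun ((c 2).unique e2) v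
  have u3 (v : Fin 3 → ℝ) : (L v).1 0 = Real.cos (x 0) * v 0 :=
    DFunLike.congr_fun ((c 0).unique e3) v
  have u4 (v : Fin 3 → ℝ) : (L v).2 = Complex.exp ((x 2 : ℝ) * Complex.I)
      * (Complex.I * (v 2 : ℝ)) := DFunLike.congr_fun (c4.unique e4) v
  have hs0 := Real.sin_sq_add_cos_sq (x 0)
  have hs1 := Real.sin_sq_add_cos_sq (x 1)
  ext i j
  simp only [metricMatrix, Matrix.of_apply, warpedMetric, PiLp.inner_apply, Fin.sum_univ_three,
    u1, u2, u3, u4, ← hLdef, warpDiag]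
  generalize warp α k b χ (polarParamAlt x).1 = φ
  fin_cases i <;> fin_cases j <;>
    simp [mul_pow]
  · have : Real.cos (x 0) ^ 2 + Real.cos (x 1) ^ 2 * Real.sin (x 0) ^ 2
        + Real.sin (x 1) ^ 2 * Real.sin (x 0) ^ 2 = 1 := by
      linear_combination Real.sin (x 0) ^ 2 * hs1 + hs0
    rw [this, mul_one]
  · right; ring
  · right; ring
  · left; linear_combination Real.cos (x 0) ^ 2 * hs1

theorem continuous_polarParamAlt : Continuous polarParamAlt := by
  unfold polarParamAlt
  refine Continuous.prodMk ?_ (by fun_prop)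
  refine (PiLp.continuous_toLp 2 _).comp (continuous_pi fun i => ?_)
  fin_cases i <;> simp <;> fun_prop

/-- Near every point of the coordinate region the warping function is given by `warpCoord`. -/
theorem warp_polarParam_eventuallyEq {χ : ℝ × ℝ → ℝ} (hχ : IsPlaneCutoff χ) {α : ℝ} (hα : 0 < α)
    (k : ℝ) (b : ℝ → ℝ) {x : Fin 3 → ℝ} (h0 : |x 0| < Real.pi / 2)
    (h1 : x 1 ∈ Ioc (-Real.pi) Real.pi) :
    (fun y => warp α k b χ (polarParam y).1) =ᶠ[𝓝 x] fun y => warpCoord α k b χ (y 0) (y 1) := by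
  have hρ := rhoStar_le_quarter α k
  have n0 : ∀ᶠ y : Fin 3 → ℝ in 𝓝 x, |y 0| < Real.pi / 2 :=
    (continuous_abs.comp (continuous_apply 0)).continuousAt.eventually (gt_mem_nhds h0)
  rcases h1.2.lt_or_eq with h | h
  · have n1 : ∀ᶠ y : Fin 3 → ℝ in 𝓝 x, |y 1| < Real.pi :=
      (continuous_abs.comp (continuous_apply 1)).continuousAt.eventually
        (gt_mem_nhds (abs_lt.mpr ⟨h1.1, h⟩))
    filter_upwards [n0, n1] with y y0 y1 using warp_polarParam α k b χ y y0 y1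
  -- At the seam θ = π the argument jumps by 2π, but on both sides it exceeds π/2 > 2ρ_* in absolute
  -- value, so both expressions equal 1.
  · have hpi := Real.pi_gt_three
    have n1 : ∀ᶠ y : Fin 3 → ℝ in 𝓝 x, Real.pi / 2 < y 1 ∧ y 1 < Real.pi + Real.pi / 2 :=
      (continuous_apply 1).continuousAt.eventually
        (Ioo_mem_nhds (by simp only [h]; linarith) (by simp only [h]; linarith))
    filter_upwards [n0, n1] with y y0 y1
    rw [warpCoord_eq_one hχ hα k b (Or.inr (by rw [abs_of_pos] <;> linarith [y1.1]))]
    refine warpCoord_eq_one hχ hα k b (Or.inr ?_)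
    have hre : ¬ |Complex.arg ⟨(polarParam y).1 0, (polarParam y).1 1⟩| ≤ Real.pi / 2 := by
      rw [Complex.abs_arg_le_pi_div_two_iff, not_le]
      exact mul_neg_of_pos_of_neg (Real.cos_pos_of_mem_Ioo (abs_lt.mp y0))
        (Real.cos_neg_of_pi_div_two_lt_of_lt y1.1 (by linarith))
    linarith [not_le.mp hre]

/-- In suitable coordinates the metric near a point off the singular circle is `warpDiag f` with
`f` smooth. -/
structure IsLocalWarp (F : (Fin 3 → ℝ) → Matrix (Fin 3) (Fin 3) ℝ) (D : Prop) (B : ℝ)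
    (f : (Fin 3 → ℝ) → ℝ) (x : Fin 3 → ℝ) : Prop where
  eventuallyEq : F =ᶠ[𝓝 x] warpDiag f
  contDiffAt : ContDiffAt ℝ ∞ f x
  ge : 3 / 4 ≤ f x
  cos_pos : 0 < Real.cos (x 0)
  partialDeriv_two : partialDeriv 2 f =ᶠ[𝓝 x] 0
  bound : D → |partialDeriv 0 f x| ≤ B ∧ |partialDeriv 1 f x| ≤ B ∧
    (|x 0| ≤ 1 / 2 ∨ partialDeriv 0 f x = 0 ∧ partialDeriv 1 f x = 0)

theorem partialDeriv_comp_zero {g : ℝ × ℝ → ℝ} {x : Fin 3 → ℝ}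
    (hg : DifferentiableAt ℝ g (x 0, x 1)) :
    partialDeriv 0 (fun y => g (y 0, y 1)) x = fderiv ℝ g (x 0, x 1) (1, 0) ∧
    partialDeriv 1 (fun y => g (y 0, y 1)) x = fderiv ℝ g (x 0, x 1) (0, 1) ∧
    partialDeriv 2 (fun y => g (y 0, y 1)) x = 0 := by
  have h : HasFDerivAt (fun y : Fin 3 → ℝ => g (y 0, y 1)) _ x :=
    hg.hasFDerivAt.comp x ((hasFDerivAt_coord 0 x).prodMk (hasFDerivAt_coord 1 x))
  simp only [partialDeriv, h.fderiv]
  simp [← Prod.zero_eq_mk]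

/-- At a pole the warping function is 1 nearby, since the latitude there is close to ±π/2 and beyond
2ρ_*, so the rotated chart shows the round product metric. Elsewhere the polar chart gives
`warpCoord`, which is smooth because the point is not over the origin. -/
theorem exists_isLocalWarp {χ : ℝ × ℝ → ℝ} (hχ : IsPlaneCutoff χ) {b : ℝ → ℝ}
    (hb : IsTransition b) {α : ℝ} (hα : 0 < α) (k : ℝ) {p : Amb}
    (hp : p ∈ sphereCircle \ singularCircle) :
    ∃ f, IsLocalWarp (metricMatrix α k b χ (localParam p))
      (∀ x, fderiv ℝ χ x (1, 0) ^ 2 + fderiv ℝ χ x (0, 1) ^ 2 ≤ 4)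
      (|k| * (15 + 10 / α) * (2 * rhoStar α k)) f (localCoords p) := by
  have hρ := rhoStar_pos (k := k) hα
  have hρ4 := rhoStar_le_quarter α k
  have hpi := Real.pi_gt_three
  have hpar := localParam_localCoords hp.1
  by_cases hpole : p.1 0 = 0 ∧ p.1 1 = 0
  · have hx : localCoords p = ![0, Complex.arg ⟨p.1 1, p.1 2⟩, Complex.arg p.2] := by
      simp [localCoords, hpole]
    have hF : localParam p = polarParamAlt := by simp [localParam, hpole]
    rw [hF] at hpar ⊢
    refine ⟨fun _ => 1, ?_, contDiffAt_const, by norm_num, by simp [hx], ?_, fun _ => ?_⟩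
    · rw [metricMatrix_polarParamAlt_eq]
      have h2 : 1 / 2 < |Real.arcsin (p.1 2)| := by
        have hn : p.1 2 ^ 2 = 1 := by
          have := EuclideanSpace.norm_sq_eq p.1
          rw [hp.1.1] at this
          simp [Fin.sum_univ_three, hpole] at this
          linarith
        rw [sq, mul_self_eq_one_iff] at hn
        rcases hn with h | h <;> simp [h, abs_of_pos (Real.pi_div_two_pos)] <;> linarith
      have h3 : ∀ᶠ y in 𝓝 (localCoords p), 1 / 2 < |Real.arcsin ((polarParamAlt y).1 2)| := by
        have hc : Continuous fun y => |Real.arcsin ((polarParamAlt y).1 2)| :=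
          (Real.continuous_arcsin.comp ((EuclideanSpace.proj (𝕜 := ℝ) (2 : Fin 3)).continuous.comp
            continuous_polarParamAlt.fst)).abs
        refine hc.continuousAt.eventually (lt_mem_nhds ?_)
        simpa only [hpar] using h2
      filter_upwards [h3] with y hy
      simp only [warpDiag]
      rw [show warp α k b χ (polarParamAlt y).1 = 1 from
        warpCoord_eq_one hχ hα k b (Or.inl (by linarith))]
    · exact Eventually.of_forall fun y => by simp
    · simp
      positivity
  · have hx : localCoords p =
        ![Real.arcsin (p.1 2), Complex.arg ⟨p.1 0, p.1 1⟩, Complex.arg p.2] := by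
      simp [localCoords, hpole]
    have hF : localParam p = polarParam := by simp [localParam, hpole]
    rw [hF] at hpar ⊢
    have hcos : 0 < Real.cos (localCoords p 0) := by
      refine lt_of_le_of_ne ?_ fun h => hpole ?_
      · rw [hx]; exact Real.cos_arcsin_nonneg _
      · rw [← hpar]; simp [polarParam, ← h]
    have hx0 : |localCoords p 0| < Real.pi / 2 := by
      rw [abs_lt]
      refine ⟨lt_of_le_of_ne ?_ fun h => ?_, lt_of_le_of_ne ?_ fun h => ?_⟩
      · rw [hx]; exact Real.neg_pi_div_two_le_arcsin _
      · rw [← h] at hcos; simp at hcos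
      · rw [hx]; exact Real.arcsin_le_pi_div_two _
      · rw [h] at hcos; simp at hcos
    have hx1 : localCoords p 1 ∈ Ioc (-Real.pi) Real.pi := by
      rw [hx]; exact Complex.arg_mem_Ioc _
    have hne : (localCoords p 0, localCoords p 1) ≠ (0 : ℝ × ℝ) := by
      intro h
      simp only [Prod.mk_eq_zero] at h
      refine hp.2 ⟨?_, hp.1.2⟩
      rw [← hpar]
      simp [polarParam, h, basePt]
    set x := localCoords p
    set g : ℝ × ℝ → ℝ := fun q => warpCoord α k b χ q.1 q.2 with hg
    have hgd : ContDiffAt ℝ ∞ g (x 0, x 1) := warpCoord_contDiffAt hχ hb α k hne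
    have hpr : Tendsto (fun y : Fin 3 → ℝ => (y 0, y 1)) (𝓝 x) (𝓝 (x 0, x 1)) :=
      Continuous.tendsto (by fun_prop) x
    have hgd' : DifferentiableAt ℝ g (x 0, x 1) := hgd.differentiableAt (by simp)
    refine ⟨fun y => g (y 0, y 1), ?_, ?_, warpCoord_ge hχ hb hα k _ _, hcos, ?_, fun hD => ?_⟩
    · rw [metricMatrix_polarParam_eq]
      filter_upwards [warp_polarParam_eventuallyEq hχ hα k b hx0 hx1] with y hy
      simp only [warpDiag, hy, hg]
    · exact ContDiffAt.comp (g := g) (f := fun y : Fin 3 → ℝ => (y 0, y 1)) x hgd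
        ((contDiff_apply ℝ ℝ (0 : Fin 3)).prodMk (contDiff_apply ℝ ℝ (1 : Fin 3))).contDiffAt
    · filter_upwards [hpr.eventually
        ((hgd.of_le (by simp : (1 : WithTop ℕ∞) ≤ ∞)).eventually (by simp))] with y hy
      exact (partialDeriv_comp_zero (hy.differentiableAt (by simp))).2.2
    · obtain ⟨d, hd, hd1, hd2⟩ := warpCoord_hasDerivAt hχ hb hα k
        (fun y => abs_le_of_sq_le_sq (by nlinarith [hD y, sq_nonneg (fderiv ℝ χ y (0, 1))])
          (by norm_num)) (x 0) (x 1)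
      -- The θ-derivative is obtained from the r-derivative bound by the symmetry exchanging r and
      -- θ, which swaps the arguments of the cutoff.
      have hsw (y : ℝ × ℝ) : fderiv ℝ (χ ∘ Prod.swap) y (1, 0) = fderiv ℝ χ y.swap (0, 1) := by
        have : HasFDerivAt (χ ∘ Prod.swap) _ y :=
          (hχ.smooth.differentiable (by simp) y.swap).hasFDerivAt.comp y
            (hasFDerivAt_snd.prodMk hasFDerivAt_fst)
        simp [this.fderiv]
      obtain ⟨e, he, he1, he2⟩ := warpCoord_hasDerivAt hχ.swap hb hα k
        (fun y => by
          rw [hsw]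
          exact abs_le_of_sq_le_sq (by nlinarith [hD y.swap, sq_nonneg (fderiv ℝ χ y.swap (1, 0))])
            (by norm_num)) (x 1) (x 0)
      simp only [← warpCoord_comm] at he
      obtain ⟨q0, q1, -⟩ := partialDeriv_comp_zero hgd'
      have hd' : fderiv ℝ g (x 0, x 1) (1, 0) = d :=
        (HasFDerivAt.comp_hasDerivAt (l := g) (f := fun s => (s, x 1)) (x 0) hgd'.hasFDerivAt
          ((hasDerivAt_id (x 0)).prodMk (hasDerivAt_const (x 0) (x 1)))).unique hd
      have he' : fderiv ℝ g (x 0, x 1) (0, 1) = e :=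
        (HasFDerivAt.comp_hasDerivAt (l := g) (f := fun s => (x 0, s)) (x 1) hgd'.hasFDerivAt
          ((hasDerivAt_const (x 1) (x 0)).prodMk (hasDerivAt_id (x 1)))).unique he
      rw [q0, q1, hd', he']
      refine ⟨hd1, he1, ?_⟩
      rcases le_or_gt |x 0| (1 / 2) with h | h
      · exact Or.inl h
      · exact Or.inr ⟨hd2 (Or.inl h), he2 (Or.inr h)⟩

/-! ### Smoothness and the scalar curvature bound -/

theorem smoothMetricAt {χ : ℝ × ℝ → ℝ} (hχ : IsPlaneCutoff χ) {b : ℝ → ℝ}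
    (hb : IsTransition b) {α : ℝ} (hα : 0 < α) (k : ℝ) {p : Amb}
    (hp : p ∈ sphereCircle \ singularCircle) : SmoothMetricAt α k b χ p := by
  obtain ⟨f, hf⟩ := exists_isLocalWarp hχ hb hα k hp
  intro i j
  have hfd := hf.contDiffAt
  have hf0 : f (localCoords p) ≠ 0 := by linarith [hf.ge]
  have hc : ContDiffAt ℝ ∞ (fun y : Fin 3 → ℝ => Real.cos (y 0)) (localCoords p) :=
    (Real.contDiff_cos.comp (contDiff_apply ℝ ℝ 0)).contDiffAt
  have hi := (hfd.pow 2).inv (pow_ne_zero 2 hf0)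
  have : ContDiffAt ℝ ∞ (fun y => warpDiag f y i j) (localCoords p) := by
    by_cases hij : i = j
    · subst hij
      fin_cases i
      · simp only [warpDiag]; exact hi
      · simp only [warpDiag]; exact hi.mul (hc.pow 2)
      · simpa [warpDiag] using hfd.pow 2
    · simpa [warpDiag, Matrix.diagonal_apply_ne _ hij] using contDiffAt_const
  exact this.congr_of_eventuallyEq (hf.eventuallyEq.mono fun y hy => by simp only [hy])

theorem scalarCurvature_ge {χ : ℝ × ℝ → ℝ} (hχ : IsPlaneCutoff χ) {b : ℝ → ℝ}
    (hb : IsTransition b) {α : ℝ} (hα : 0 < α) (k : ℝ)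
    (hgrad : ∀ x, fderiv ℝ χ x (1, 0) ^ 2 + fderiv ℝ χ x (0, 1) ^ 2 ≤ 4) {p : Amb}
    (hp : p ∈ sphereCircle \ singularCircle) : 5 / 8 ≤ scalarCurvature α k b χ p := by
  obtain ⟨f, hf⟩ := exists_isLocalWarp hχ hb hα k hp
  have hc := hf.cos_pos
  rw [scalarCurvature, scalarCoord_congr hf.eventuallyEq,
    scalarCoord_warpDiag (hf.contDiffAt.of_le (by norm_cast))
      (by linarith [hf.ge]) hc.ne' hf.partialDeriv_two]
  obtain ⟨h0, h1, h2⟩ := hf.bound hgrad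
  have hB := rhoStar_gradient_le (k := k) hα
  have hB0 : 0 ≤ |k| * (15 + 10 / α) * (2 * rhoStar α k) := by
    have := rhoStar_pos (k := k) hα
    positivity
  generalize |k| * (15 + 10 / α) * (2 * rhoStar α k) = B at *
  set x := localCoords p
  -- The factor 1/cos² r is controlled because the derivatives vanish outside |r| ≤ 1/2.
  have hg : partialDeriv 0 f x ^ 2 + partialDeriv 1 f x ^ 2 / Real.cos (x 0) ^ 2 ≤ 1 / 4 := by
    rcases h2 with h2 | ⟨h2, h3⟩
    · have hcos : Real.cos (1 / 2) ≤ Real.cos (x 0) := by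
        rw [← Real.cos_abs (x 0)]
        exact Real.cos_le_cos_of_nonneg_of_le_pi (abs_nonneg _) (by linarith [Real.pi_gt_three]) h2
      have hc2 : 0 < Real.cos (1 / 2) :=
        Real.cos_pos_of_mem_Ioo ⟨by linarith [Real.pi_gt_three], by linarith [Real.pi_gt_three]⟩
      calc _ ≤ B ^ 2 + B ^ 2 / Real.cos (1 / 2) ^ 2 := by
            have i0 := sq_le_sq' (by linarith [(abs_le.mp h0).1]) (abs_le.mp h0).2
            have i1 := sq_le_sq' (by linarith [(abs_le.mp h1).1]) (abs_le.mp h1).2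
            gcongr
        _ = (B * √(1 + (1 / Real.cos (1 / 2)) ^ 2)) ^ 2 := by
            rw [mul_pow, Real.sq_sqrt (by positivity)]
            ring
        _ ≤ (1 / 2) ^ 2 := by gcongr
        _ = 1 / 4 := by norm_num
    · rw [h2, h3]
      norm_num
  nlinarith [hf.ge]

/-! ### Functions vanishing to a given order, in the Lipschitz sense -/

section

open Asymptotics

/-- Pairs of small vectors together with a time in `[0, 1]`. -/
def pairFilter : Filter (((Fin 3 → ℝ) × (Fin 3 → ℝ)) × ℝ) := 𝓝 0 ×ˢ 𝓟 (Icc 0 1)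

/-- `f v s` vanishes at `v = 0` to order `m + 1` in the Lipschitz sense:
`|f v s - f v' s| ≤ C (‖v‖ + ‖v'‖)^m ‖v - v'‖` for small `v, v'`, uniformly in `s ∈ [0, 1]`. -/
structure VanishOrd (m : ℕ) (f : (Fin 3 → ℝ) → ℝ → ℝ) : Prop where
  zero : ∀ s ∈ Icc (0 : ℝ) 1, f 0 s = 0
  isBigO : (fun q : ((Fin 3 → ℝ) × (Fin 3 → ℝ)) × ℝ => f q.1.1 q.2 - f q.1.2 q.2)
    =O[pairFilter] fun q => (‖q.1.1‖ + ‖q.1.2‖) ^ m * ‖q.1.1 - q.1.2‖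

theorem eventually_pairFilter_mem : ∀ᶠ q in pairFilter, q.2 ∈ Icc (0 : ℝ) 1 :=
  tendsto_snd.eventually (eventually_mem_set.mpr (mem_principal_self _))

theorem tendsto_pairFilter_fst : Tendsto (fun q : ((Fin 3 → ℝ) × (Fin 3 → ℝ)) × ℝ => q.1.1)
    pairFilter (𝓝 0) :=
  (continuous_fst.tendsto (0 : (Fin 3 → ℝ) × (Fin 3 → ℝ))).comp tendsto_fst

theorem tendsto_pairFilter_snd : Tendsto (fun q : ((Fin 3 → ℝ) × (Fin 3 → ℝ)) × ℝ => q.1.2)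
    pairFilter (𝓝 0) :=
  (continuous_snd.tendsto (0 : (Fin 3 → ℝ) × (Fin 3 → ℝ))).comp tendsto_fst

theorem tendsto_pairFilter_size :
    Tendsto (fun q : ((Fin 3 → ℝ) × (Fin 3 → ℝ)) × ℝ => ‖q.1.1‖ + ‖q.1.2‖) pairFilter (𝓝 0) := by
  simpa using tendsto_pairFilter_fst.norm.add tendsto_pairFilter_snd.norm

namespace VanishOrd

variable {m n : ℕ} {f g : (Fin 3 → ℝ) → ℝ → ℝ}

theorem mono (hf : VanishOrd n f) (h : m ≤ n) : VanishOrd m f where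
  zero := hf.zero
  isBigO := by
    refine hf.isBigO.trans (IsBigO.mul ?_ (isBigO_refl _ _))
    refine IsBigO.of_bound 1 ?_
    filter_upwards [tendsto_pairFilter_size.eventually (gt_mem_nhds one_pos)] with q hq
    have h0 : 0 ≤ ‖q.1.1‖ + ‖q.1.2‖ := by positivity
    rw [Real.norm_of_nonneg (by positivity), Real.norm_of_nonneg (by positivity), one_mul]
    exact pow_le_pow_of_le_one h0 hq.le h

theorem congr (hf : VanishOrd m f) (h : ∀ v s, f v s = g v s) : VanishOrd m g := by
  rwa [show g = f from funext₂ fun v s => (h v s).symm]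

theorem add (hf : VanishOrd m f) (hg : VanishOrd m g) : VanishOrd m fun v s => f v s + g v s where
  zero s hs := by simp [hf.zero s hs, hg.zero s hs]
  isBigO := (hf.isBigO.add hg.isBigO).congr_left fun q => by ring

theorem const_mul (a : ℝ) (hf : VanishOrd m f) : VanishOrd m fun v s => a * f v s where
  zero s hs := by simp [hf.zero s hs]
  isBigO := (hf.isBigO.const_mul_left a).congr_left fun q => by ring

theorem neg (hf : VanishOrd m f) : VanishOrd m fun v s => - f v s :=
  (hf.const_mul (-1)).congr fun v s => by ring

theorem sub (hf : VanishOrd m f) (hg : VanishOrd m g) : VanishOrd m fun v s => f v s - g v s :=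
  (hf.add hg.neg).congr fun v s => by ring

/-- Comparison with v' = 0, where the function vanishes, turns the Lipschitz estimate into a size
estimate of one order more. -/
theorem isBigO_fst (hf : VanishOrd m f) :
    (fun q : ((Fin 3 → ℝ) × (Fin 3 → ℝ)) × ℝ => f q.1.1 q.2)
      =O[pairFilter] fun q => (‖q.1.1‖ + ‖q.1.2‖) ^ (m + 1) := by
  have ht : Tendsto (fun q : ((Fin 3 → ℝ) × (Fin 3 → ℝ)) × ℝ => (((q.1.1, 0), q.2) :
      ((Fin 3 → ℝ) × (Fin 3 → ℝ)) × ℝ)) pairFilter pairFilter :=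
    (tendsto_pairFilter_fst.prodMk_nhds tendsto_const_nhds).prodMk tendsto_snd
  have h1 := hf.isBigO.comp_tendsto ht
  refine (h1.congr' ?_ (EventuallyEq.refl _ _)).trans ?_
  · filter_upwards [eventually_pairFilter_mem] with q hq
    simp [hf.zero _ hq]
  · refine IsBigO.of_bound 1 (Eventually.of_forall fun q => ?_)
    simp only [Function.comp_apply, norm_zero, add_zero, sub_zero]
    rw [← pow_succ, Real.norm_of_nonneg (by positivity), Real.norm_of_nonneg (by positivity),
      one_mul]
    gcongr
    exact le_add_of_nonneg_right (norm_nonneg _)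

theorem isBigO_snd (hf : VanishOrd m f) :
    (fun q : ((Fin 3 → ℝ) × (Fin 3 → ℝ)) × ℝ => f q.1.2 q.2)
      =O[pairFilter] fun q => (‖q.1.1‖ + ‖q.1.2‖) ^ (m + 1) := by
  have ht : Tendsto (fun q : ((Fin 3 → ℝ) × (Fin 3 → ℝ)) × ℝ => (((q.1.2, q.1.1), q.2) :
      ((Fin 3 → ℝ) × (Fin 3 → ℝ)) × ℝ)) pairFilter pairFilter :=
    (tendsto_pairFilter_snd.prodMk_nhds tendsto_pairFilter_fst).prodMk tendsto_snd
  exact (hf.isBigO_fst.comp_tendsto ht).congr_right fun q => by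
    simp [add_comm]

theorem tendsto (hf : VanishOrd m f) :
    Tendsto (fun q : ((Fin 3 → ℝ) × (Fin 3 → ℝ)) × ℝ => (f q.1.1 q.2, f q.1.2 q.2))
      pairFilter (𝓝 0) := by
  have h := tendsto_pairFilter_size.pow (m + 1)
  rw [zero_pow m.succ_ne_zero] at h
  exact (hf.isBigO_fst.trans_tendsto h).prodMk_nhds (hf.isBigO_snd.trans_tendsto h)

theorem eventually_abs_lt (hf : VanishOrd m f) {ε : ℝ} (hε : 0 < ε) :
    ∀ᶠ v in 𝓝 0, ∀ s ∈ Icc (0 : ℝ) 1, |f v s| < ε := by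
  have h1 : ∀ᶠ q in pairFilter, |f q.1.1 q.2| < ε :=
    ((continuous_fst.abs.tendsto (0 : ℝ × ℝ)).comp hf.tendsto).eventually
      (gt_mem_nhds (by simpa using hε))
  have ht : Tendsto (fun v : Fin 3 → ℝ => (v, v)) (𝓝 0) (𝓝 0) :=
    (continuous_id.prodMk continuous_id).tendsto' _ _ rfl
  exact ht.eventually (eventually_prod_principal_iff.mp h1)

/-- In fg - f'g' = f(g - g') + (f - f')g' each term pairs a size of order m+1 or n+1 with a
Lipschitz difference. The true orders m+1 and n+1 add up, so the index becomes m+n+1. -/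
theorem mul (hf : VanishOrd m f) (hg : VanishOrd n g) :
    VanishOrd (m + n + 1) fun v s => f v s * g v s where
  zero s hs := by simp [hf.zero s hs]
  isBigO := by
    have h1 := hf.isBigO_fst.mul hg.isBigO
    have h2 := hf.isBigO.mul hg.isBigO_snd
    have h1' := h1.congr_right (g₂ := fun q : ((Fin 3 → ℝ) × (Fin 3 → ℝ)) × ℝ =>
      (‖q.1.1‖ + ‖q.1.2‖) ^ (m + n + 1) * ‖q.1.1 - q.1.2‖) fun q => by ring
    have h2' := h2.congr_right (g₂ := fun q : ((Fin 3 → ℝ) × (Fin 3 → ℝ)) × ℝ =>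
      (‖q.1.1‖ + ‖q.1.2‖) ^ (m + n + 1) * ‖q.1.1 - q.1.2‖) fun q => by ring
    exact (h1'.add h2').congr_left fun q => by ring

/-- A product of functions of orders at least `m + 1` and `n + 1`. -/
theorem mul_le {l : ℕ} (hf : VanishOrd m f) (hg : VanishOrd n g) (h : l ≤ m + n + 1) :
    VanishOrd l fun v s => f v s * g v s :=
  (hf.mul hg).mono h

theorem coord (i : Fin 3) : VanishOrd 0 fun v _ => v i where
  zero _ _ := rfl
  isBigO := by
    refine IsBigO.of_bound 1 (Eventually.of_forall fun q => ?_)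
    rw [pow_zero, one_mul, one_mul, norm_norm, ← Pi.sub_apply]
    exact norm_le_pi_norm _ i

theorem time_mul (hf : VanishOrd m f) : VanishOrd m fun v s => s * f v s where
  zero s hs := by simp [hf.zero s hs]
  isBigO := by
    refine IsBigO.trans ?_ hf.isBigO
    refine IsBigO.of_bound 1 ?_
    filter_upwards [eventually_pairFilter_mem] with q hq
    rw [← mul_sub, norm_mul, Real.norm_of_nonneg hq.1]
    gcongr
    exact hq.2

theorem eval_one (hf : VanishOrd m f) : VanishOrd m fun v _ => f v 1 where
  zero _ _ := hf.zero 1 (by simp)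
  isBigO := by
    have ht : Tendsto (fun q : ((Fin 3 → ℝ) × (Fin 3 → ℝ)) × ℝ => ((q.1, 1) :
        ((Fin 3 → ℝ) × (Fin 3 → ℝ)) × ℝ)) pairFilter pairFilter :=
      tendsto_fst.prodMk (tendsto_principal.mpr (Eventually.of_forall fun _ => by simp))
    exact hf.isBigO.comp_tendsto ht

/-- Composition with a function that vanishes at `0` together with its derivatives up to order
`j`. -/
theorem comp {h : ℝ → ℝ} {j : ℕ} (h0 : h 0 = 0)
    (hh : (fun p : ℝ × ℝ => h p.1 - h p.2) =O[𝓝 0] fun p => (|p.1| + |p.2|) ^ j * |p.1 - p.2|)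
    (hf : VanishOrd m f) : VanishOrd ((m + 1) * j + m) fun v s => h (f v s) where
  zero s hs := by simp [hf.zero s hs, h0]
  isBigO := by
    refine (hh.comp_tendsto hf.tendsto).trans ?_
    -- The j factors |f| contribute (m+1)j to the exponent, and the remaining difference of values
    -- of f contributes m.
    have h1 := (hf.isBigO_fst.norm_left.add hf.isBigO_snd.norm_left).pow j
    exact (h1.mul hf.isBigO.norm_left).congr_right fun q => by
      rw [← pow_mul, pow_add, mul_assoc]

/-- A function of `s` with `s`-derivative of order `m + 1`. -/
theorem of_hasDerivWithinAt (hg : VanishOrd m g) (h0 : ∀ᶠ v in 𝓝 0, f v 0 = 0)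
    (hz : ∀ s ∈ Icc (0 : ℝ) 1, f 0 s = 0)
    (hd : ∀ᶠ v in 𝓝 0, ∀ s ∈ Icc (0 : ℝ) 1, HasDerivWithinAt (f v) (g v s) (Icc 0 1) s) :
    VanishOrd m f where
  zero := hz
  isBigO := by
    obtain ⟨C, hC⟩ := hg.isBigO.bound
    have hC' := eventually_prod_principal_iff.mp hC
    refine IsBigO.of_bound C (eventually_prod_principal_iff.mpr ?_)
    have hd' := hd.and h0
    filter_upwards [hC', (continuous_fst.tendsto (0 : (Fin 3 → ℝ) × (Fin 3 → ℝ))).eventually hd',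
      (continuous_snd.tendsto (0 : (Fin 3 → ℝ) × (Fin 3 → ℝ))).eventually hd'] with q h1 h2 h3 s hs
    set B := C * ‖(‖q.1‖ + ‖q.2‖) ^ m * ‖q.1 - q.2‖‖ with hB
    -- The mean value inequality is applied to the difference of two solutions, so that the
    -- Lipschitz estimate of g, and not merely its size, passes to f.
    have hder : ∀ s ∈ Icc (0 : ℝ) 1, HasDerivWithinAt (fun s => f q.1 s - f q.2 s)
        (g q.1 s - g q.2 s) (Icc 0 1) s := fun s hs => (h2.1 s hs).fun_sub (h3.1 s hs)
    have hB0 : 0 ≤ B := (norm_nonneg _).trans (h1 0 (by simp))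
    have := (convex_Icc (0 : ℝ) 1).norm_image_sub_le_of_norm_hasDerivWithin_le hder
      (fun s hs => h1 s hs) (left_mem_Icc.mpr zero_le_one) hs
    rw [h2.2, h3.2, sub_zero, sub_zero, sub_zero, Real.norm_of_nonneg hs.1] at this
    exact this.trans (mul_le_of_le_one_right hB0 hs.2)

/-- Replacing the factors of a triple product by functions that agree to order `3`. -/
theorem triple_sub {f₁ f₂ f₃ g₁ g₂ g₃ : (Fin 3 → ℝ) → ℝ → ℝ} (hf₂ : VanishOrd 0 f₂)
    (hf₃ : VanishOrd 0 f₃) (hg₁ : VanishOrd 0 g₁) (hg₂ : VanishOrd 0 g₂)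
    (h₁ : VanishOrd 2 fun v s => f₁ v s - g₁ v s) (h₂ : VanishOrd 2 fun v s => f₂ v s - g₂ v s)
    (h₃ : VanishOrd 2 fun v s => f₃ v s - g₃ v s) :
    VanishOrd 3 fun v s => f₁ v s * f₂ v s * f₃ v s - g₁ v s * g₂ v s * g₃ v s := by
  have a := (h₁.mul hf₂).mul hf₃
  have b := (h₂.mul hg₁).mul hf₃
  have c := (h₃.mul hg₁).mul hg₂
  refine (((a.add b).add c).mono (by norm_num)).congr fun v s => ?_
  ring

end VanishOrd

/-- A function whose derivative is `O(|x|^j)` near `0`. -/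
theorem isBigO_sub_of_deriv {h h' : ℝ → ℝ} {j : ℕ} (hd : ∀ᶠ x in 𝓝 0, HasDerivAt h (h' x) x)
    (hO : h' =O[𝓝 0] fun x => |x| ^ j) :
    (fun p : ℝ × ℝ => h p.1 - h p.2) =O[𝓝 0] fun p => (|p.1| + |p.2|) ^ j * |p.1 - p.2| := by
  obtain ⟨C, hC⟩ := hO.bound
  obtain ⟨ε, hε, hball⟩ := Metric.eventually_nhds_iff.mp (hd.and hC)
  simp only [dist_zero_right, Real.norm_eq_abs] at hball
  refine IsBigO.of_bound (max C 0) ?_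
  have t1 : ∀ᶠ p : ℝ × ℝ in 𝓝 0, |p.1| < ε :=
    (continuous_fst.abs.tendsto (0 : ℝ × ℝ)).eventually (gt_mem_nhds (by simpa using hε))
  have t2 : ∀ᶠ p : ℝ × ℝ in 𝓝 0, |p.2| < ε :=
    (continuous_snd.abs.tendsto (0 : ℝ × ℝ)).eventually (gt_mem_nhds (by simpa using hε))
  filter_upwards [t1, t2] with p h1 h2
  have hsub : ∀ x ∈ uIcc p.2 p.1, |x| ≤ |p.1| ⊔ |p.2| := fun x hx => by
    rw [sup_comm]
    rw [mem_uIcc] at hx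
    rcases hx with hx | hx
    · exact abs_le_max_abs_abs hx.1 hx.2
    · rw [sup_comm]; exact abs_le_max_abs_abs hx.1 hx.2
  have key := (convex_uIcc p.2 p.1).norm_image_sub_le_of_norm_hasDerivWithin_le (f := h)
    (f' := h') (C := max C 0 * (|p.1| + |p.2|) ^ j) (fun x hx =>
      (hball ((hsub x hx).trans_lt (max_lt h1 h2))).1.hasDerivWithinAt) (fun x hx => ?_)
      left_mem_uIcc right_mem_uIcc
  · rw [Real.norm_of_nonneg (by positivity : 0 ≤ (|p.1| + |p.2|) ^ j * |p.1 - p.2|), ← mul_assoc]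
    exact key
  · have hx' := hsub x hx
    refine (hball (hx'.trans_lt (max_lt h1 h2))).2.trans ?_
    rw [abs_of_nonneg (by positivity)]
    gcongr
    · exact le_max_left _ _
    · exact hx'.trans (max_le_add_of_nonneg (abs_nonneg _) (abs_nonneg _))

theorem isBigO_sub_of_contDiffAt {h : ℝ → ℝ} (hc : ContDiffAt ℝ 1 h 0) :
    (fun p : ℝ × ℝ => h p.1 - h p.2) =O[𝓝 0] fun p => (|p.1| + |p.2|) ^ 0 * |p.1 - p.2| := by
  refine isBigO_sub_of_deriv (h' := deriv h) ?_ ?_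
  · filter_upwards [hc.eventually (by simp)] with x hx using
      (hx.differentiableAt (by simp)).hasDerivAt
  · have : ContinuousAt (deriv h) 0 := by
      have := (hc.fderiv_right (m := 0) (by norm_num)).continuousAt
      exact this.clm_apply continuousAt_const
    simpa using this.isBigO_one ℝ

theorem isBigO_sub_of_deriv_eq_zero {h : ℝ → ℝ} (hc : ContDiffAt ℝ 2 h 0) (h0 : deriv h 0 = 0) :
    (fun p : ℝ × ℝ => h p.1 - h p.2) =O[𝓝 0] fun p => (|p.1| + |p.2|) ^ 1 * |p.1 - p.2| := by
  refine isBigO_sub_of_deriv (h' := deriv h) ?_ ?_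
  · filter_upwards [hc.eventually (by simp)] with x hx using
      (hx.differentiableAt (by simp)).hasDerivAt
  · have : DifferentiableAt ℝ (deriv h) 0 := by
      have := (hc.fderiv_right (m := 1) (by norm_num)).differentiableAt (by simp)
      exact this.clm_apply (differentiableAt_const _)
    simpa [h0] using this.isBigO_sub.norm_right

end

/-! ### Geodesics of the model metric with warping function `1 + κ r θ` -/

/-- The acceleration of a geodesic of the metric with warping function `f`, in terms of the
logarithmic derivatives `p, q` of `f`. -/
noncomputable def warpAccel (f p q : ℝ) (r : ℝ) (w : Fin 3 → ℝ) : Fin 3 → ℝ :=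
  ![p * w 0 ^ 2 + 2 * q * w 0 * w 1 - (p * Real.cos r ^ 2 + Real.cos r * Real.sin r) * w 1 ^ 2
      + f ^ 4 * p * w 2 ^ 2,
    -(q / Real.cos r ^ 2) * w 0 ^ 2 + 2 * (p + Real.sin r / Real.cos r) * w 0 * w 1 + q * w 1 ^ 2
      + f ^ 4 * q / Real.cos r ^ 2 * w 2 ^ 2,
    -2 * (p * w 0 + q * w 1) * w 2]

theorem neg_sum_warpChristoffel (f p q r : ℝ) (w : Fin 3 → ℝ) :
    (fun m => - ∑ i, ∑ j, warpChristoffel m i j f p q r * w i * w j) = warpAccel f p q r w := by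
  funext m
  fin_cases m <;> simp [warpChristoffel, warpAccel, Fin.sum_univ_three] <;> ring

/-- The acceleration for the warping function `1 + κ r θ`. -/
noncomputable def modelAccel (κ : ℝ) (c w : Fin 3 → ℝ) : Fin 3 → ℝ :=
  warpAccel (1 + κ * (c 0 * c 1)) (κ * c 1 / (1 + κ * (c 0 * c 1)))
    (κ * c 0 / (1 + κ * (c 0 * c 1))) (c 0) w

/-- The geodesic field of the model metric. -/
noncomputable def modelField (κ : ℝ) (y : (Fin 3 → ℝ) × (Fin 3 → ℝ)) :
    (Fin 3 → ℝ) × (Fin 3 → ℝ) :=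
  (y.2, modelAccel κ y.1 y.2)

theorem modelField_contDiffAt {κ : ℝ} {y : (Fin 3 → ℝ) × (Fin 3 → ℝ)}
    (hf : 1 + κ * (y.1 0 * y.1 1) ≠ 0) (hc : Real.cos (y.1 0) ≠ 0) :
    ContDiffAt ℝ 1 (modelField κ) y := by
  have c1 (i : Fin 3) : ContDiffAt ℝ 1 (fun y : (Fin 3 → ℝ) × (Fin 3 → ℝ) => y.1 i) y :=
    ((contDiff_apply ℝ ℝ i).comp contDiff_fst).contDiffAt
  have c2 (i : Fin 3) : ContDiffAt ℝ 1 (fun y : (Fin 3 → ℝ) × (Fin 3 → ℝ) => y.2 i) y :=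
    ((contDiff_apply ℝ ℝ i).comp contDiff_snd).contDiffAt
  have hF : ContDiffAt ℝ 1 (fun y : (Fin 3 → ℝ) × (Fin 3 → ℝ) => 1 + κ * (y.1 0 * y.1 1)) y :=
    contDiffAt_const.add (contDiffAt_const.mul ((c1 0).mul (c1 1)))
  have hcos : ContDiffAt ℝ 1 (fun y : (Fin 3 → ℝ) × (Fin 3 → ℝ) => Real.cos (y.1 0)) y :=
    (c1 0).cos
  have hsin : ContDiffAt ℝ 1 (fun y : (Fin 3 → ℝ) × (Fin 3 → ℝ) => Real.sin (y.1 0)) y :=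
    (c1 0).sin
  have hp := (contDiffAt_const (c := κ).mul (c1 1)).div hF hf
  have hq := (contDiffAt_const (c := κ).mul (c1 0)).div hF hf
  refine contDiffAt_snd.prodMk (contDiffAt_pi.mpr fun i => ?_)
  fin_cases i
  · exact (((hp.mul ((c2 0).pow 2)).add ((((contDiffAt_const (c := 2)).mul hq).mul (c2 0)).mul
      (c2 1))).sub (((hp.mul (hcos.pow 2)).add (hcos.mul hsin)).mul ((c2 1).pow 2))).add
      (((hF.pow 4).mul hp).mul ((c2 2).pow 2))
  · exact ((((hq.div (hcos.pow 2) (pow_ne_zero 2 hc)).neg.mul ((c2 0).pow 2)).add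
      ((((contDiffAt_const (c := 2)).mul (hp.add (hsin.div hcos hc))).mul (c2 0)).mul (c2 1))).add
      (hq.mul ((c2 1).pow 2))).add ((((hF.pow 4).mul hq).div (hcos.pow 2) (pow_ne_zero 2 hc)).mul
      ((c2 2).pow 2))
  · exact ((contDiffAt_const (c := -2)).mul ((hp.mul (c2 0)).add (hq.mul (c2 1)))).mul (c2 2)

/-- Quadratic homogeneity in the velocity permits a change of the time scale, used to bring a
short-time flow to the interval [0, 1]. -/
theorem modelAccel_smul (κ a : ℝ) (c w : Fin 3 → ℝ) :
    modelAccel κ c (a • w) = a ^ 2 • modelAccel κ c w := by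
  ext i
  fin_cases i <;> simp [modelAccel, warpAccel] <;> ring

/-- Two curves that solve the same differential equation wherever they are close agree. -/
theorem eqOn_of_locally_solution {E : Type*} [NormedAddCommGroup E] [NormedSpace ℝ E]
    {F : E → E} {β γ : ℝ → E}
    (hβ : ∀ s ∈ Icc (0 : ℝ) 1, HasDerivWithinAt β (F (β s)) (Icc 0 1) s)
    (hF : ∀ s ∈ Icc (0 : ℝ) 1, ContDiffAt ℝ 1 F (β s)) (h0 : β 0 = γ 0)
    (hγc : ContinuousOn γ (Icc 0 1))
    (hγ : ∀ s ∈ Ico (0 : ℝ) 1, β s = γ s →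
      ∀ᶠ u in 𝓝[≥] s, HasDerivWithinAt γ (F (γ u)) (Icc 0 1) u) :
    EqOn β γ (Icc 0 1) := by
  have hβc : ContinuousOn β (Icc 0 1) := fun s hs => (hβ s hs).continuousWithinAt
  have hclosed : IsClosed ({s | β s = γ s} ∩ Icc (0 : ℝ) 1) := by
    have : {s | β s = γ s} ∩ Icc (0 : ℝ) 1 = Icc 0 1 ∩ (fun s => (β s, γ s)) ⁻¹' diagonal E := by
      ext s
      simp [and_comm]
    rw [this]
    exact (hβc.prodMk hγc).preimage_isClosed_of_isClosed isClosed_Icc isClosed_diagonal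
  refine hclosed.Icc_subset_of_forall_mem_nhdsWithin h0 fun s hs => ?_
  obtain ⟨hs1, hs2⟩ := hs
  -- The set of agreement is closed. It extends to the right of each of its points because the field
  -- is Lipschitz near the common value and both curves solve the equation for a short time
  -- afterwards.
  obtain ⟨K, U, hU, hLip⟩ := (hF s (Ico_subset_Icc_self hs2)).exists_lipschitzOnWith
  have hsub : 𝓝[≥] s ≤ 𝓝[Icc 0 1] s := by
    rw [← nhdsWithin_Icc_eq_nhdsGE hs2.2]
    exact nhdsWithin_mono _ (Icc_subset_Icc_left hs2.1)
  have e1 : ∀ᶠ u in 𝓝[≥] s, β u ∈ U := hsub ((hβc s (Ico_subset_Icc_self hs2)) hU)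
  have e2 : ∀ᶠ u in 𝓝[≥] s, γ u ∈ U := by
    refine hsub ((hγc s (Ico_subset_Icc_self hs2)) ?_)
    rw [← show β s = γ s from hs1]
    exact hU
  have e3 : ∀ᶠ u in 𝓝[≥] s, u < 1 := nhdsWithin_le_nhds (gt_mem_nhds hs2.2)
  obtain ⟨d, hd, hd'⟩ := mem_nhdsGE_iff_exists_Icc_subset.mp
    (((e1.and e2).and e3).and (hγ s hs2 hs1))
  have hda : ∀ u ∈ Ico s d, Icc (0 : ℝ) 1 ∈ 𝓝[≥] u := fun u hu => by
    have hu1 := (hd' (Ico_subset_Icc_self hu)).1.2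
    rw [← nhdsWithin_Icc_eq_nhdsGE hu1]
    exact mem_of_superset self_mem_nhdsWithin (Icc_subset_Icc_left (hs2.1.trans hu.1))
  have hsd : Icc s d ⊆ Icc 0 1 := fun u hu => ⟨hs2.1.trans hu.1, (hd' hu).1.2.le⟩
  have key := ODE_solution_unique_of_mem_Icc_right (v := fun _ => F) (s := fun _ => U) (K := K)
    (fun _ _ => hLip) (hβc.mono hsd)
    (fun u hu => (hβ u (hsd (Ico_subset_Icc_self hu))).mono_of_mem_nhdsWithin (hda u hu))
    (fun u hu => (hd' (Ico_subset_Icc_self hu)).1.1.1) (hγc.mono hsd)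
    (fun u hu => (hd' (Ico_subset_Icc_self hu)).2.mono_of_mem_nhdsWithin (hda u hu))
    (fun u hu => (hd' (Ico_subset_Icc_self hu)).1.1.2) hs1
  exact mem_of_superset (Ioo_mem_nhdsGT hd) fun u hu => key (Ioo_subset_Icc_self hu)

/-- The geodesics `c v` of the model metric from the origin with small initial velocity `v`, and
their velocities `w v`. -/
structure IsModelFlow (κ : ℝ) (c w : (Fin 3 → ℝ) → ℝ → Fin 3 → ℝ) : Prop where
  start : ∀ᶠ v in 𝓝 0, c v 0 = 0 ∧ w v 0 = v
  hasDeriv : ∀ᶠ v in 𝓝 0, ∀ s ∈ Icc (0 : ℝ) 1, HasDerivWithinAt (c v) (w v s) (Icc 0 1) s ∧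
    HasDerivWithinAt (w v) (modelAccel κ (c v s) (w v s)) (Icc 0 1) s
  axis : ∀ᶠ v in 𝓝 (0 : Fin 3 → ℝ), v 0 = 0 → v 1 = 0 →
    ∀ s ∈ Icc (0 : ℝ) 1, c v s = s • v ∧ w v s = v
  pos_ord : ∀ i, VanishOrd 0 fun v s => c v s i
  vel_ord : ∀ i, VanishOrd 0 fun v s => w v s i

/-- Picard–Lindelöf at the zero of the field gives solutions on [-ε, ε], Lipschitz in the initial
data. Starting with velocity v/ε and running time εs yields geodesics on [0, 1] with velocity v. -/
theorem exists_isModelFlow (κ : ℝ) : ∃ c w, IsModelFlow κ c w := by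
  have h00 : ContDiffAt ℝ 1 (modelField κ) 0 := modelField_contDiffAt (by simp) (by simp)
  obtain ⟨ε, hε, a, r, L, K, hr, hpl⟩ := IsPicardLindelof.of_contDiffAt_one h00
  obtain ⟨φ, hφ, L', hL'⟩ :=
    (hpl 0).exists_forall_mem_closedBall_eq_hasDerivWithinAt_lipschitzOnWith
  simp only [zero_sub, zero_add] at hφ hL'
  set y : (Fin 3 → ℝ) → ℝ → (Fin 3 → ℝ) × (Fin 3 → ℝ) := fun v s => φ (0, ε⁻¹ • v) (ε * s) with hy
  have hball : ∀ᶠ v in 𝓝 (0 : Fin 3 → ℝ),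
      ((0, ε⁻¹ • v) : (Fin 3 → ℝ) × (Fin 3 → ℝ)) ∈ Metric.closedBall 0 (r : ℝ) := by
    have : Continuous fun v : Fin 3 → ℝ => ((0, ε⁻¹ • v) : (Fin 3 → ℝ) × (Fin 3 → ℝ)) := by fun_prop
    exact this.continuousAt (Metric.closedBall_mem_nhds_of_mem (by simpa using hr))
  have hmem : ∀ s ∈ Icc (0 : ℝ) 1, ε * s ∈ Icc (-ε) ε := fun s hs =>
    ⟨by nlinarith [hs.1], by nlinarith [hs.2]⟩
  have hstart : ∀ᶠ v in 𝓝 (0 : Fin 3 → ℝ), (y v 0).1 = 0 ∧ ε • (y v 0).2 = v := by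
    filter_upwards [hball] with v hv
    simp [hy, (hφ _ hv).1, smul_smul, hε.ne']
  have hder : ∀ᶠ v in 𝓝 (0 : Fin 3 → ℝ), ∀ s ∈ Icc (0 : ℝ) 1,
      HasDerivWithinAt (fun s => (y v s).1) (ε • (y v s).2) (Icc 0 1) s ∧
      HasDerivWithinAt (fun s => ε • (y v s).2)
        (modelAccel κ (y v s).1 (ε • (y v s).2)) (Icc 0 1) s := by
    filter_upwards [hball] with v hv s hs
    have h1 := (hφ _ hv).2 _ (hmem s hs)
    have h2 : HasDerivWithinAt (fun s : ℝ => ε * s) ε (Icc 0 1) s := by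
      simpa using (hasDerivWithinAt_id s (Icc (0 : ℝ) 1)).const_mul ε
    have h3 : HasDerivWithinAt (y v) (ε • modelField κ (y v s)) (Icc 0 1) s :=
      h1.scomp s h2 fun u hu => hmem u hu
    refine ⟨h3.fst, ?_⟩
    have h4 : HasDerivWithinAt (fun s => (y v s).2)
        (ε • modelAccel κ (y v s).1 (y v s).2) (Icc 0 1) s := h3.snd
    rw [modelAccel_smul, sq, mul_smul]
    exact h4.const_smul ε
  have haxis : ∀ᶠ v in 𝓝 (0 : Fin 3 → ℝ), v 0 = 0 → v 1 = 0 → ∀ s ∈ Icc (0 : ℝ) 1,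
      (y v s).1 = s • v ∧ ε • (y v s).2 = v := by
    filter_upwards [hstart, hder] with v h1 h2 hv0 hv1
    -- On the ξ-axis the log-derivatives of f and sin r all vanish, so straight lines along it are
    -- geodesics. Uniqueness identifies them with the flow.
    have hacc (s : ℝ) : modelAccel κ (s • v) v = 0 := by
      ext i
      fin_cases i <;> simp [modelAccel, warpAccel, hv0, hv1]
    have h3 := eqOn_of_locally_solution (F := modelField κ) (β := fun s => (s • v, v))
      (γ := fun s => ((y v s).1, ε • (y v s).2)) (fun s _ => ?_) (fun s _ => ?_) ?_
      (fun s hs => ?_) (fun s hs _ => ?_)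
    · intro s hs
      have := h3 hs
      simp only [Prod.mk.injEq] at this
      exact ⟨this.1.symm, this.2.symm⟩
    · simp only [modelField, hacc]
      have := (hasDerivWithinAt_id s (Icc (0 : ℝ) 1)).smul_const v
      rw [one_smul] at this
      exact this.prodMk (hasDerivWithinAt_const _ _ _)
    · exact modelField_contDiffAt (by simp [hv0]) (by simp [hv0])
    · simp [h1]
    · exact (h2 s hs).1.continuousWithinAt.prodMk (h2 s hs).2.continuousWithinAt
    · have : Icc (0 : ℝ) 1 ∈ 𝓝[≥] s := by
        rw [← nhdsWithin_Icc_eq_nhdsGE hs.2]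
        exact mem_of_superset self_mem_nhdsWithin (Icc_subset_Icc_left hs.1)
      filter_upwards [this] with u hu using (h2 u hu).1.prodMk (h2 u hu).2
  have hzero : ∀ s ∈ Icc (0 : ℝ) 1, (y 0 s).1 = 0 ∧ ε • (y 0 s).2 = 0 := fun s hs => by
    simpa using haxis.self_of_nhds rfl rfl s hs
  have hlip : ∀ᶠ q in pairFilter, ‖y q.1.1 q.2 - y q.1.2 q.2‖ ≤ L' * (ε⁻¹ * ‖q.1.1 - q.1.2‖) := by
    filter_upwards [tendsto_pairFilter_fst.eventually hball,
      tendsto_pairFilter_snd.eventually hball, eventually_pairFilter_mem] with q h1 h2 h3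
    refine ((hL' _ (hmem _ h3)).norm_sub_le h1 h2).trans_eq ?_
    rw [Prod.mk_sub_mk, sub_zero, ← smul_sub, Prod.norm_mk, norm_zero, norm_smul,
      Real.norm_of_nonneg (inv_nonneg.mpr hε.le), max_eq_right (by positivity)]
  refine ⟨fun v s => (y v s).1, fun v s => ε • (y v s).2, hstart, hder, haxis, fun i => ⟨?_, ?_⟩,
    fun i => ⟨?_, ?_⟩⟩
  · intro s hs
    simp [(hzero s hs).1]
  · refine Asymptotics.IsBigO.of_bound (L' * ε⁻¹) (hlip.mono fun q hq => ?_)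
    rw [pow_zero, one_mul, norm_norm, mul_assoc]
    refine le_trans ?_ hq
    rw [← Pi.sub_apply, ← Prod.fst_sub]
    exact (norm_le_pi_norm _ i).trans (norm_fst_le _)
  · intro s hs
    exact congrFun (hzero s hs).2 i
  · refine Asymptotics.IsBigO.of_bound (ε * (L' * ε⁻¹)) (hlip.mono fun q hq => ?_)
    rw [pow_zero, one_mul, norm_norm, mul_assoc, mul_assoc]
    rw [← Pi.sub_apply, ← smul_sub, ← Prod.snd_sub]
    refine (norm_le_pi_norm _ i).trans ?_
    rw [norm_smul, Real.norm_of_nonneg hε.le]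
    gcongr
    exact (norm_snd_le _).trans hq

/-! ### Third-order expansion of the exponential map -/

/-- The leading part of `modelAccel` at the origin. -/
noncomputable def cubicForm (κ : ℝ) (c w : Fin 3 → ℝ) : Fin 3 → ℝ :=
  ![κ * c 1 * w 0 ^ 2 + 2 * κ * c 0 * w 0 * w 1 - (κ * c 1 + c 0) * w 1 ^ 2 + κ * c 1 * w 2 ^ 2,
    -κ * c 0 * w 0 ^ 2 + 2 * (κ * c 1 + c 0) * w 0 * w 1 + κ * c 0 * w 1 ^ 2 + κ * c 0 * w 2 ^ 2,
    -2 * κ * (c 1 * w 0 + c 0 * w 1) * w 2]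

namespace VanishOrd

variable {m n : ℕ} {f g : (Fin 3 → ℝ) → ℝ → ℝ}

/-- `(1 + f) (1 + g) - 1`. -/
theorem one_add_mul (hf : VanishOrd m f) (hg : VanishOrd m g) :
    VanishOrd m fun v s => (1 + f v s) * (1 + g v s) - 1 :=
  ((hf.add hg).add (hf.mul_le hg (by lia))).congr fun v s => by ring

theorem inv_one_add (hf : VanishOrd m f) : VanishOrd m fun v s => (1 + f v s)⁻¹ - 1 := by
  refine (comp (h := fun x => (1 + x)⁻¹ - 1) (j := 0) (by simp) ?_ hf).mono (by lia)
  exact isBigO_sub_of_contDiffAt (((contDiffAt_const.add contDiffAt_id).inv (by simp)).sub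
    contDiffAt_const)

/-- Composition with a function that vanishes to second order. -/
theorem comp_two {h : ℝ → ℝ} (h0 : h 0 = 0) (hc : ContDiffAt ℝ 2 h 0) (hd : HasDerivAt h 0 0)
    (hf : VanishOrd 0 f) : VanishOrd 1 fun v s => h (f v s) :=
  (comp h0 (isBigO_sub_of_deriv_eq_zero hc hd.deriv) hf).mono (by lia)

theorem cos_sq (hf : VanishOrd 0 f) : VanishOrd 1 fun v s => Real.cos (f v s) ^ 2 - 1 := by
  refine comp_two (h := fun x => Real.cos x ^ 2 - 1) (by simp) ?_ ?_ hf
  · exact ((Real.contDiff_cos.pow 2).sub contDiff_const).contDiffAt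
  · simpa using ((Real.hasDerivAt_cos 0).pow 2).sub_const 1

theorem cos_mul_sin (hf : VanishOrd 0 f) :
    VanishOrd 1 fun v s => Real.cos (f v s) * Real.sin (f v s) - f v s := by
  refine comp_two (h := fun x => Real.cos x * Real.sin x - x) (by simp) ?_ ?_ hf
  · exact ((Real.contDiff_cos.mul Real.contDiff_sin).sub contDiff_id).contDiffAt
  · simpa using ((Real.hasDerivAt_cos 0).fun_mul (Real.hasDerivAt_sin 0)).fun_sub
      (hasDerivAt_id' 0)

theorem tan (hf : VanishOrd 0 f) :
    VanishOrd 1 fun v s => Real.sin (f v s) / Real.cos (f v s) - f v s := by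
  refine comp_two (h := fun x => Real.sin x / Real.cos x - x) (by simp) ?_ ?_ hf
  · exact (Real.contDiff_sin.contDiffAt.div Real.contDiff_cos.contDiffAt (by simp)).sub contDiffAt_id
  · simpa using ((Real.hasDerivAt_sin 0).fun_div (Real.hasDerivAt_cos 0) (by simp)).fun_sub
      (hasDerivAt_id' 0)

theorem inv_cos_sq (hf : VanishOrd 0 f) : VanishOrd 1 fun v s => (Real.cos (f v s) ^ 2)⁻¹ - 1 :=
  hf.cos_sq.inv_one_add.congr fun v s => by ring_nf

theorem of_cubicForm {κ : ℝ} {c w : (Fin 3 → ℝ) → ℝ → Fin 3 → ℝ}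
    (hc : ∀ i, VanishOrd 0 fun v s => c v s i) (hw : ∀ i, VanishOrd 0 fun v s => w v s i)
    (i : Fin 3) : VanishOrd 2 fun v s => cubicForm κ (c v s) (w v s) i := by
  have t (i j k : Fin 3) : VanishOrd 2 fun v s => c v s i * w v s j * w v s k :=
    ((hc i).mul (hw j)).mul (hw k)
  fin_cases i
  · exact (((((t 1 0 0).const_mul κ).add ((t 0 0 1).const_mul (2 * κ))).sub
      (((t 1 1 1).const_mul κ).add (t 0 1 1))).add ((t 1 2 2).const_mul κ)).congr fun v s => by
        simp [cubicForm]; ring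
  · exact (((((t 0 0 0).const_mul (-κ)).add ((t 1 0 1).const_mul (2 * κ))).add
      ((t 0 0 1).const_mul 2)).add (((t 0 1 1).const_mul κ).add ((t 0 2 2).const_mul κ))).congr
        fun v s => by simp [cubicForm]; ring
  · exact (((t 1 0 2).const_mul (-2 * κ)).add ((t 0 1 2).const_mul (-2 * κ))).congr
      fun v s => by simp [cubicForm]; ring

/-- The geodesic acceleration agrees with its leading part to order `4`. -/
theorem modelAccel_sub {κ : ℝ} {c w : (Fin 3 → ℝ) → ℝ → Fin 3 → ℝ}
    (hc : ∀ i, VanishOrd 0 fun v s => c v s i) (hw : ∀ i, VanishOrd 0 fun v s => w v s i)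
    (i : Fin 3) : VanishOrd 3 fun v s =>
      modelAccel κ (c v s) (w v s) i - cubicForm κ (c v s) (w v s) i := by
  have hu : VanishOrd 1 fun v s => κ * (c v s 0 * c v s 1) := ((hc 0).mul (hc 1)).const_mul κ
  have hg := hu.inv_one_add
  have hsq := hu.one_add_mul hu
  have hcb := (hsq.one_add_mul hu).one_add_mul hu
  have hk := (hc 0).cos_sq
  have hi := (hc 0).inv_cos_sq
  have hsc := (hc 0).cos_mul_sin
  have htn := (hc 0).tan
  have h4 := hcb.one_add_mul hg
  have h2 := hg.one_add_mul hk
  have h3 := hg.one_add_mul hi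
  have h5 := h4.one_add_mul hi
  have T {e : (Fin 3 → ℝ) → ℝ → ℝ} (he : VanishOrd 1 e) (i j k : Fin 3) :
      VanishOrd 3 fun v s => c v s i * e v s * w v s j * w v s k :=
    ((((hc i).mul he).mul (hw j)).mul (hw k)).mono (by lia)
  have S {e : (Fin 3 → ℝ) → ℝ → ℝ} (he : VanishOrd 1 e) (j k : Fin 3) :
      VanishOrd 3 fun v s => e v s * w v s j * w v s k :=
    (he.mul (hw j)).mul (hw k)
  fin_cases i
  · exact (((((T hg 1 0 0).const_mul κ).add ((T hg 0 0 1).const_mul (2 * κ))).sub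
      (((T h2 1 1 1).const_mul κ).add (S hsc 1 1))).add ((T h4 1 2 2).const_mul κ)).congr
        fun v s => by simp [cubicForm, modelAccel, warpAccel, div_eq_mul_inv]; ring
  · exact (((((T h3 0 0 0).const_mul (-κ)).add ((T hg 1 0 1).const_mul (2 * κ))).add
      ((S htn 0 1).const_mul 2)).add (((T hg 0 1 1).const_mul κ).add
        ((T h5 0 2 2).const_mul κ))).congr
        fun v s => by simp [cubicForm, modelAccel, warpAccel, div_eq_mul_inv]; ring
  · exact (((T hg 1 0 2).const_mul (-2 * κ)).add ((T hg 0 1 2).const_mul (-2 * κ))).congr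
      fun v s => by simp [cubicForm, modelAccel, warpAccel, div_eq_mul_inv]; ring

end VanishOrd

namespace IsModelFlow

variable {κ : ℝ} {c w : (Fin 3 → ℝ) → ℝ → Fin 3 → ℝ}

theorem zero_eq (h : IsModelFlow κ c w) {s : ℝ} (hs : s ∈ Icc (0 : ℝ) 1) :
    c 0 s = 0 ∧ w 0 s = 0 := by
  simpa using h.axis.self_of_nhds rfl rfl s hs

/-- The Christoffel symbols of the model vanish at the origin, so the acceleration is of order
three. Integration from w(0) = v preserves the order. -/
theorem vel_sub_ord (h : IsModelFlow κ c w) (i : Fin 3) :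
    VanishOrd 2 fun v s => w v s i - v i := by
  have ha : VanishOrd 2 fun v s => modelAccel κ (c v s) (w v s) i :=
    (((VanishOrd.modelAccel_sub h.pos_ord h.vel_ord i).mono (by lia)).add
      (VanishOrd.of_cubicForm h.pos_ord h.vel_ord i)).congr fun v s => by ring
  refine VanishOrd.of_hasDerivWithinAt ha ?_ (fun s hs => ?_) ?_
  · filter_upwards [h.start] with v hv
    simp [hv.2]
  · simp [(h.zero_eq hs).2]
  · filter_upwards [h.hasDeriv] with v hv s hs
    exact ((hasDerivWithinAt_pi.mp (hv s hs).2) i).sub_const _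

theorem pos_sub_ord (h : IsModelFlow κ c w) (i : Fin 3) :
    VanishOrd 2 fun v s => c v s i - s * v i := by
  refine VanishOrd.of_hasDerivWithinAt (h.vel_sub_ord i) ?_ (fun s hs => ?_) ?_
  · filter_upwards [h.start] with v hv
    simp [hv.1]
  · simp [(h.zero_eq hs).1]
  · filter_upwards [h.hasDeriv] with v hv s hs
    have := (hasDerivWithinAt_id s (Icc (0 : ℝ) 1)).mul_const (v i)
    rw [one_mul] at this
    exact ((hasDerivWithinAt_pi.mp (hv s hs).1) i).fun_sub this

/-- The leading part is trilinear in position and velocities. Replacing c by sv and w by v, each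
correct up to order three, leaves an error of order at least four. -/
theorem accel_sub_ord (h : IsModelFlow κ c w) (i : Fin 3) :
    VanishOrd 3 fun v s => modelAccel κ (c v s) (w v s) i - s * cubicForm κ v v i := by
  have t (i j k : Fin 3) : VanishOrd 3 fun v s =>
      c v s i * w v s j * w v s k - s * v i * v j * v k :=
    VanishOrd.triple_sub (h.vel_ord j) (h.vel_ord k) (VanishOrd.coord i).time_mul
      (VanishOrd.coord j) (h.pos_sub_ord i) (h.vel_sub_ord j) (h.vel_sub_ord k)
  have hT : VanishOrd 3 fun v s =>
      cubicForm κ (c v s) (w v s) i - s * cubicForm κ v v i := by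
    fin_cases i
    · exact (((((t 1 0 0).const_mul κ).add ((t 0 0 1).const_mul (2 * κ))).sub
        (((t 1 1 1).const_mul κ).add (t 0 1 1))).add ((t 1 2 2).const_mul κ)).congr fun v s => by
          simp [cubicForm]; ring
    · exact (((((t 0 0 0).const_mul (-κ)).add ((t 1 0 1).const_mul (2 * κ))).add
        ((t 0 0 1).const_mul 2)).add (((t 0 1 1).const_mul κ).add ((t 0 2 2).const_mul κ))).congr
          fun v s => by simp [cubicForm]; ring
    · exact (((t 1 0 2).const_mul (-2 * κ)).add ((t 0 1 2).const_mul (-2 * κ))).congr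
        fun v s => by simp [cubicForm]; ring
  exact ((VanishOrd.modelAccel_sub h.pos_ord h.vel_ord i).add hT).congr fun v s => by ring

/-- Two integrations of the acceleration s · `cubicForm` produce s²/2 in the velocity and s³/6 in
the position. -/
theorem pos_expansion (h : IsModelFlow κ c w) (i : Fin 3) :
    VanishOrd 3 fun v s => c v s i - s * v i - s ^ 3 / 6 * cubicForm κ v v i := by
  have z (i : Fin 3) : cubicForm κ 0 0 i = 0 := by
    fin_cases i <;> simp [cubicForm]
  have hw : VanishOrd 3 fun v s => w v s i - v i - s ^ 2 / 2 * cubicForm κ v v i := by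
    refine VanishOrd.of_hasDerivWithinAt (h.accel_sub_ord i) ?_ (fun s hs => ?_) ?_
    · filter_upwards [h.start] with v hv
      simp [hv.2]
    · simp [(h.zero_eq hs).2, z]
    · filter_upwards [h.hasDeriv] with v hv s hs
      have := (((hasDerivWithinAt_id s (Icc (0 : ℝ) 1)).pow 2).div_const 2).mul_const
        (cubicForm κ v v i)
      refine ((((hasDerivWithinAt_pi.mp (hv s hs).2) i).sub_const (v i)).fun_sub
        this).congr_deriv ?_
      simp
  refine VanishOrd.of_hasDerivWithinAt hw ?_ (fun s hs => ?_) ?_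
  · filter_upwards [h.start] with v hv
    simp [hv.1]
  · simp [(h.zero_eq hs).1, z]
  · filter_upwards [h.hasDeriv] with v hv s hs
    have h1 := (hasDerivWithinAt_id s (Icc (0 : ℝ) 1)).mul_const (v i)
    have h2 := (((hasDerivWithinAt_id s (Icc (0 : ℝ) 1)).pow 3).div_const 6).mul_const
      (cubicForm κ v v i)
    refine ((((hasDerivWithinAt_pi.mp (hv s hs).1) i).fun_sub h1).fun_sub h2).congr_deriv ?_
    simp
    left
    ring

end IsModelFlow

/-! ### Geodesics with initial velocity in the wedge -/

/-- The planar cone `σ r θ > 0`, `β |r| ≤ |θ|`, `β |θ| ≤ |r|`. -/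
def planeCone (σ β : ℝ) : Set (Fin 3 → ℝ) :=
  {x | 0 < σ * (x 0 * x 1) ∧ β * |x 0| ≤ |x 1| ∧ β * |x 1| ≤ |x 0|}

/-- An open region on which the warping function is `1 + k σ r θ`. -/
def unitRegion (σ α k : ℝ) : Set (Fin 3 → ℝ) :=
  {x | 0 < σ * (x 0 * x 1) ∧ |x 0| < rhoStar α k ∧ |x 1| < rhoStar α k ∧
    |x 0| ^ (1 / α) < |x 1| ∧ |x 1| ^ (1 / α) < |x 0|}

theorem isOpen_unitRegion (σ k : ℝ) {α : ℝ} (hα : 0 < α) : IsOpen (unitRegion σ α k) := by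
  have h : ∀ i : Fin 3, Continuous fun x : Fin 3 → ℝ => |x i| := fun i => by fun_prop
  have hp : ∀ i : Fin 3, Continuous fun x : Fin 3 → ℝ => |x i| ^ (1 / α) := fun i =>
    (h i).rpow_const fun _ => Or.inr (by positivity)
  have h01 : Continuous fun x : Fin 3 → ℝ => σ * (x 0 * x 1) := by fun_prop
  refine (isOpen_lt continuous_const h01).inter ((isOpen_lt (h 0) continuous_const).inter
    ((isOpen_lt (h 1) continuous_const).inter ((isOpen_lt (hp 0) (h 1)).inter
      (isOpen_lt (hp 1) (h 0)))))

/-- Since 1/α > 1, |x|^{1/α} = |x|^{1/α-1}|x| is smaller than β|x| near 0. Hence the curved boundary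
of the region is tangent to the axes and every cone enters it. -/
theorem planeCone_subset_unitRegion (σ k : ℝ) {α β : ℝ} (hα0 : 0 < α) (hα1 : α < 1) (hβ : 0 < β) :
    ∀ᶠ x in 𝓝 (0 : Fin 3 → ℝ), x ∈ planeCone σ β → x ∈ unitRegion σ α k := by
  have hρ := rhoStar_pos (k := k) hα0
  have he : 0 < 1 / α - 1 := by
    rw [sub_pos, lt_div_iff₀ hα0]
    linarith
  have h (i : Fin 3) : ∀ᶠ x in 𝓝 (0 : Fin 3 → ℝ), |x i| < rhoStar α k :=
    (continuous_apply i).abs.continuousAt.eventually (gt_mem_nhds (by simpa using hρ))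
  have hp (i : Fin 3) : ∀ᶠ x in 𝓝 (0 : Fin 3 → ℝ), |x i| ^ (1 / α - 1) < β := by
    have hc : Continuous fun x : Fin 3 → ℝ => |x i| ^ (1 / α - 1) :=
      (continuous_apply i).abs.rpow_const fun _ => Or.inr he.le
    exact hc.continuousAt.eventually (gt_mem_nhds (by
      simp only [Pi.zero_apply, abs_zero, Real.zero_rpow he.ne', hβ]))
  filter_upwards [h 0, h 1, hp 0, hp 1] with x h0 h1 p0 p1 ⟨hx, hx0, hx1⟩
  have n0 : x 0 ≠ 0 := fun h => by simp [h] at hx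
  have n1 : x 1 ≠ 0 := fun h => by simp [h] at hx
  have key (a : ℝ) (ha : a ≠ 0) (hlt : |a| ^ (1 / α - 1) < β) : |a| ^ (1 / α) < β * |a| := by
    have ha' := abs_pos.mpr ha
    rw [Real.rpow_sub_one ha'.ne', div_lt_iff₀ ha'] at hlt
    exact hlt
  exact ⟨hx, h0, h1, (key _ n0 p0).trans_le hx0, (key _ n1 p1).trans_le hx1⟩

/-- Perturbing the coordinates of a point of a cone by at most a third. -/
theorem mem_planeCone_of_near {σ α : ℝ} (hα : 0 < α) {v x : Fin 3 → ℝ} (hv : v ∈ planeCone σ α)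
    {s : ℝ} (hs : 0 < s) (h0 : |x 0 - s * v 0| ≤ 1 / 3 * (s * |v 0|))
    (h1 : |x 1 - s * v 1| ≤ 1 / 3 * (s * |v 1|)) : x ∈ planeCone σ (α / 2) := by
  obtain ⟨hv, hv0, hv1⟩ := hv
  have n0 : v 0 ≠ 0 := fun h => by simp [h] at hv
  have n1 : v 1 ≠ 0 := fun h => by simp [h] at hv
  have key (a u : ℝ) (hu : u ≠ 0) (h : |a - s * u| ≤ 1 / 3 * (s * |u|)) :
      ∃ e, a = e * (s * u) ∧ 2 / 3 ≤ e ∧ e ≤ 4 / 3 := by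
    refine ⟨a / (s * u), by field_simp, ?_⟩
    have hsu : s * u ≠ 0 := mul_ne_zero hs.ne' hu
    have h' : |a / (s * u) - 1| ≤ 1 / 3 := by
      rw [div_sub_one hsu, abs_div, div_le_iff₀ (abs_pos.mpr hsu), abs_mul s, abs_of_pos hs]
      exact h
    rw [abs_le] at h'
    constructor <;> linarith
  -- Both coordinates are multiplied by factors in [2/3, 4/3], so their ratio changes by at most a
  -- factor 2. This is why α/2 suffices.
  obtain ⟨e, he, e1, e2⟩ := key _ _ n0 h0
  obtain ⟨d, hd, d1, d2⟩ := key _ _ n1 h1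
  have he' : |x 0| = e * s * |v 0| := by
    rw [he, abs_mul, abs_mul, abs_of_pos hs, abs_of_pos (by linarith)]
    ring
  have hd' : |x 1| = d * s * |v 1| := by
    rw [hd, abs_mul, abs_mul, abs_of_pos hs, abs_of_pos (by linarith)]
    ring
  refine ⟨?_, ?_, ?_⟩
  · have : σ * (x 0 * x 1) = e * d * s ^ 2 * (σ * (v 0 * v 1)) := by rw [he, hd]; ring
    rw [this]
    have : 0 < e := by linarith
    have : 0 < d := by linarith
    positivity
  · rw [he', hd']
    calc α / 2 * (e * s * |v 0|) = (e / 2) * s * (α * |v 0|) := by ring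
      _ ≤ d * s * |v 1| := by gcongr; linarith
  · rw [he', hd']
    calc α / 2 * (d * s * |v 1|) = (d / 2) * s * (α * |v 1|) := by ring
      _ ≤ e * s * |v 0| := by gcongr; linarith

section Christoffel

variable {α k σ : ℝ} {b : ℝ → ℝ} {χ : ℝ × ℝ → ℝ}

theorem warpCoord_of_mem_unitRegion (hα : 0 < α) (hb : IsTransition b) (hχ : IsPlaneCutoff χ)
    (hσ : σ = 1 ∨ σ = -1) {x : Fin 3 → ℝ} (hx : x ∈ unitRegion σ α k) :
    warpCoord α k b χ (x 0) (x 1) = 1 + k * σ * (x 0 * x 1) := by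
  obtain ⟨hx, h0, h1, p0, p1⟩ := hx
  have hρ := rhoStar_pos (k := k) hα
  have n0 : x 0 ≠ 0 := fun h => by simp [h] at hx
  have n1 : x 1 ≠ 0 := fun h => by simp [h] at hx
  have hχ1 : χ (x 0 / rhoStar α k, x 1 / rhoStar α k) = 1 := by
    refine hχ.eq_one _ ?_ ?_ <;>
      simp only [abs_div, abs_of_pos hρ, div_le_one hρ, h0.le, h1.le]
  have b0 : b (|x 1| / |x 0| ^ (1 / α)) = 1 :=
    hb.eq_one _ ((one_le_div (Real.rpow_pos_of_pos (abs_pos.mpr n0) _)).mpr p0.le)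
  have b1 : b (|x 0| / |x 1| ^ (1 / α)) = 1 :=
    hb.eq_one _ ((one_le_div (Real.rpow_pos_of_pos (abs_pos.mpr n1) _)).mpr p1.le)
  have habs : |x 0 * x 1| = σ * (x 0 * x 1) := by
    rcases hσ with rfl | rfl
    · rw [one_mul] at hx ⊢
      exact abs_of_pos hx
    · rw [neg_one_mul] at hx ⊢
      exact abs_of_neg (by linarith)
  rw [warpCoord, hχ1, psi, b0, b1, habs]
  ring

theorem abs_lt_quarter_of_mem_unitRegion {x : Fin 3 → ℝ} (hx : x ∈ unitRegion σ α k) :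
    |x 0| < 1 / 4 ∧ |x 1| < 1 / 4 :=
  ⟨hx.2.1.trans_le (rhoStar_le_quarter α k), hx.2.2.1.trans_le (rhoStar_le_quarter α k)⟩

theorem warp_eventuallyEq_of_mem_unitRegion (hα : 0 < α) (hb : IsTransition b)
    (hχ : IsPlaneCutoff χ) (hσ : σ = 1 ∨ σ = -1) {x : Fin 3 → ℝ} (hx : x ∈ unitRegion σ α k) :
    (fun y => warp α k b χ (polarParam y).1) =ᶠ[𝓝 x] fun y => 1 + k * σ * (y 0 * y 1) := by
  obtain ⟨h0, h1⟩ := abs_lt_quarter_of_mem_unitRegion hx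
  have hpi := Real.pi_gt_three
  filter_upwards [warp_polarParam_eventuallyEq hχ hα k b (h0.trans (by linarith))
    ⟨by linarith [(abs_lt.mp h1).1], by linarith [(abs_lt.mp h1).2]⟩,
    (isOpen_unitRegion σ k hα).mem_nhds hx] with y hy hy'
  rw [hy, warpCoord_of_mem_unitRegion hα hb hχ hσ hy']

theorem one_add_ge_of_mem_unitRegion (hα : 0 < α) (hb : IsTransition b)
    (hχ : IsPlaneCutoff χ) (hσ : σ = 1 ∨ σ = -1) {x : Fin 3 → ℝ} (hx : x ∈ unitRegion σ α k) :
    3 / 4 ≤ 1 + k * σ * (x 0 * x 1) := by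
  rw [← warpCoord_of_mem_unitRegion hα hb hχ hσ hx]
  exact warpCoord_ge hχ hb hα k _ _

theorem cos_pos_of_mem_unitRegion {x : Fin 3 → ℝ} (hx : x ∈ unitRegion σ α k) :
    0 < Real.cos (x 0) := by
  have h := abs_lt.mp (abs_lt_quarter_of_mem_unitRegion hx).1
  exact Real.cos_pos_of_mem_Ioo ⟨by linarith [Real.pi_gt_three], by linarith [Real.pi_gt_three]⟩

/-- The perturbation is at most |k||rθ|, hence quadratic, so the first derivative exists and
vanishes even where the metric is not smooth. -/
theorem warp_hasFDerivAt_zero (hα : 0 < α) (hb : IsTransition b) (hχ : IsPlaneCutoff χ) :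
    HasFDerivAt (fun y => warp α k b χ (polarParam y).1) (0 : (Fin 3 → ℝ) →L[ℝ] ℝ) 0 := by
  have hpi := Real.pi_gt_three
  have hO : (fun y : Fin 3 → ℝ => k * χ (y 0 / rhoStar α k, y 1 / rhoStar α k) *
      psi α b (y 0) (y 1)) =O[𝓝 0] fun y => ‖y - 0‖ ^ 2 := by
    refine Asymptotics.IsBigO.of_bound |k| (Eventually.of_forall fun y => ?_)
    rw [sub_zero, norm_pow, norm_norm, norm_mul, norm_mul, Real.norm_eq_abs k,
      Real.norm_of_nonneg (hχ.nonneg _), Real.norm_of_nonneg (psi_nonneg hb _ _ _)]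
    calc _ ≤ |k| * 1 * (‖y‖ * ‖y‖) := by
          gcongr
          · exact psi_nonneg hb _ _ _
          · exact hχ.le_one _
          · refine (psi_le hb _ _ _).trans ?_
            rw [abs_mul]
            exact mul_le_mul (norm_le_pi_norm y 0) (norm_le_pi_norm y 1) (abs_nonneg _)
              (norm_nonneg _)
      _ = _ := by ring
  have h := (Asymptotics.IsBigO.hasFDerivAt (𝕜 := ℝ) hO one_lt_two).const_add (1 : ℝ)
  refine h.congr_of_eventuallyEq ?_
  exact warp_polarParam_eventuallyEq hχ hα k b (x := 0) (by simp; linarith)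
    ⟨by simp; linarith, by simp; linarith⟩

/-- Where the geodesic field of the metric is that of the model metric. -/
theorem geodesicField_eq (hα : 0 < α) (hb : IsTransition b)
    (hχ : IsPlaneCutoff χ) (hσ : σ = 1 ∨ σ = -1) {x : Fin 3 → ℝ}
    (hx : x = 0 ∨ x ∈ unitRegion σ α k) (w : Fin 3 → ℝ) :
    (fun m => - ∑ i, ∑ j, christoffel (metricMatrix α k b χ polarParam) m i j x * w i * w j) =
      modelAccel (k * σ) x w := by
  rw [modelAccel, ← neg_sum_warpChristoffel, metricMatrix_polarParam_eq]
  suffices h : ∀ m i j, christoffel (warpDiag fun x => warp α k b χ (polarParam x).1) m i j x =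
      warpChristoffel m i j (1 + k * σ * (x 0 * x 1)) (k * σ * x 1 / (1 + k * σ * (x 0 * x 1)))
        (k * σ * x 0 / (1 + k * σ * (x 0 * x 1))) (x 0) by
    simp only [h]
  intro m i j
  rcases hx with rfl | hx
  · have hd := warp_hasFDerivAt_zero (k := k) hα hb hχ
    have h1 : warp α k b χ (polarParam 0).1 = 1 := by
      refine (warp_polarParam_eventuallyEq hχ hα k b (x := 0)
        (by simp; linarith [Real.pi_gt_three]) ⟨by simp; linarith [Real.pi_gt_three],
          by simp; linarith [Real.pi_gt_three]⟩).self_of_nhds.trans ?_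
      simp [warpCoord, psi]
    have hp (i : Fin 3) : partialDeriv i (fun y => warp α k b χ (polarParam y).1) 0 = 0 := by
      rw [partialDeriv, hd.fderiv]
      rfl
    rw [christoffel_warpDiag hd.differentiableAt (by rw [h1]; norm_num) (by simp) (hp 2), hp, hp,
      h1]
    simp
  · have he := warp_eventuallyEq_of_mem_unitRegion hα hb hχ hσ hx
    have hge := one_add_ge_of_mem_unitRegion hα hb hχ hσ hx
    have hd : HasFDerivAt (fun y : Fin 3 → ℝ => 1 + k * σ * (y 0 * y 1)) _ x :=
      (((hasFDerivAt_coord 0 x).mul (hasFDerivAt_coord 1 x)).const_mul (k * σ)).const_add 1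
    have hp (i : Fin 3) : partialDeriv i (fun y => warp α k b χ (polarParam y).1) x =
        k * σ * (x 0 * (Pi.single i 1 : Fin 3 → ℝ) 1 + x 1 * (Pi.single i 1 : Fin 3 → ℝ) 0) := by
      rw [partialDeriv_congr he, partialDeriv, hd.fderiv]
      simp
      ring
    have hx1 : warp α k b χ (polarParam x).1 = 1 + k * σ * (x 0 * x 1) := he.self_of_nhds
    rw [christoffel_warpDiag (hd.differentiableAt.congr_of_eventuallyEq he)
      (by rw [hx1]; linarith) (cos_pos_of_mem_unitRegion hx).ne' (by simp [hp]), hp, hp, hx1]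
    simp

end Christoffel

/-- Geodesics of the model metric with small initial velocity in a cone stay in a wider cone. -/
theorem IsModelFlow.mem_planeCone {κ : ℝ} {c w : (Fin 3 → ℝ) → ℝ → Fin 3 → ℝ}
    (h : IsModelFlow κ c w) (σ : ℝ) {α : ℝ} (hα : 0 < α) (hα1 : α < 1) :
    ∀ᶠ v in 𝓝 (0 : Fin 3 → ℝ), v ∈ planeCone σ α → ∀ s ∈ Ioc (0 : ℝ) 1,
      c v s ∈ planeCone σ (α / 2) := by
  -- The planar part of v may be tiny compared with its ξ-component, so an error bounded by powers
  -- of ‖v‖ would not preserve the cone. Comparison with the axis geodesic of velocity (0, 0, v₂),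
  -- which is straight, makes the error proportional to max(|v₀|, |v₁|).
  have hproj : Tendsto (fun v : Fin 3 → ℝ => (v, ![0, 0, v 2])) (𝓝 0) (𝓝 0) := by
    have hc : Continuous fun v : Fin 3 → ℝ => (![0, 0, v 2] : Fin 3 → ℝ) :=
      continuous_pi fun i => by fin_cases i <;> simp <;> fun_prop
    have := (continuous_id.prodMk hc).tendsto (0 : Fin 3 → ℝ)
    simpa [← Prod.zero_eq_mk, show (![0, 0, 0] : Fin 3 → ℝ) = 0 by ext i; fin_cases i <;> rfl]
      using this
  have hw (i : Fin 3) (hi : i = 0 ∨ i = 1) : ∀ᶠ v in 𝓝 (0 : Fin 3 → ℝ), ∀ s ∈ Icc (0 : ℝ) 1,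
      |w v s i - v i| ≤ α / 3 * max |v 0| |v 1| := by
    obtain ⟨C, hC⟩ := (h.vel_sub_ord i).isBigO.bound
    have h1 := hproj.eventually (eventually_prod_principal_iff.mp hC)
    have h2 := (((continuous_snd.tendsto (0 : (Fin 3 → ℝ) × (Fin 3 → ℝ))).comp hproj)).eventually
      h.axis
    have h3 : ∀ᶠ v in 𝓝 (0 : Fin 3 → ℝ), C * (‖v‖ + ‖(![0, 0, v 2] : Fin 3 → ℝ)‖) ^ 2 < α / 3 := by
      have : Tendsto (fun v : Fin 3 → ℝ => C * (‖v‖ + ‖(![0, 0, v 2] : Fin 3 → ℝ)‖) ^ 2) (𝓝 0)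
          (𝓝 (C * (‖(0 : Fin 3 → ℝ)‖ + ‖(0 : Fin 3 → ℝ)‖) ^ 2)) :=
        ((((continuous_fst.tendsto _).comp hproj).norm.add
          ((continuous_snd.tendsto _).comp hproj).norm).pow 2).const_mul C
      refine this.eventually (gt_mem_nhds ?_)
      simp [hα]
    filter_upwards [h1, h2, h3] with v h1 h2 h3 s hs
    have h1' := h1 s hs
    have h2' := (h2 rfl rfl s hs).2
    simp only [Function.comp_apply] at h2'
    have h0 : (![0, 0, v 2] : Fin 3 → ℝ) i = 0 := by rcases hi with rfl | rfl <;> rfl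
    simp only [h2', h0, sub_zero] at h1'
    have hn : ‖v - ![0, 0, v 2]‖ = max |v 0| |v 1| := by
      apply le_antisymm
      · refine (pi_norm_le_iff_of_nonneg (by positivity)).mpr fun j => ?_
        fin_cases j <;> simp
      · refine max_le ?_ ?_
        · simpa using norm_le_pi_norm (v - ![0, 0, v 2]) 0
        · simpa using norm_le_pi_norm (v - ![0, 0, v 2]) 1
    rw [norm_mul, norm_pow, Real.norm_of_nonneg (by positivity : 0 ≤ ‖v‖ + ‖(![0, 0, v 2] :
      Fin 3 → ℝ)‖), norm_norm, hn, ← mul_assoc] at h1'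
    exact h1'.trans (by gcongr)
  filter_upwards [hw 0 (Or.inl rfl), hw 1 (Or.inr rfl), h.start, h.hasDeriv] with v w0 w1 hst hd hv
    s hs
  -- In the cone both planar components dominate α times the larger one, so the error becomes at
  -- most a third of each.
  have hmax : α * max |v 0| |v 1| ≤ |v 0| ∧ α * max |v 0| |v 1| ≤ |v 1| := by
    rcases max_cases |v 0| |v 1| with ⟨h, h'⟩ | ⟨h, h'⟩ <;> rw [h]
    · exact ⟨mul_le_of_le_one_left (abs_nonneg _) hα1.le, hv.2.1⟩
    · exact ⟨hv.2.2, mul_le_of_le_one_left (abs_nonneg _) hα1.le⟩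
  have key (i : Fin 3) (hi : ∀ s ∈ Icc (0 : ℝ) 1, |w v s i - v i| ≤ 1 / 3 * |v i|) :
      |c v s i - s * v i| ≤ 1 / 3 * (s * |v i|) := by
    have hder : ∀ u ∈ Icc (0 : ℝ) 1, HasDerivWithinAt (fun u => c v u i - u * v i)
        (w v u i - v i) (Icc 0 1) u := fun u hu => by
      have := (hasDerivWithinAt_id u (Icc (0 : ℝ) 1)).mul_const (v i)
      rw [one_mul] at this
      exact ((hasDerivWithinAt_pi.mp (hd u hu).1) i).fun_sub this
    have := (convex_Icc (0 : ℝ) 1).norm_image_sub_le_of_norm_hasDerivWithin_le hder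
      (fun u hu => hi u hu) (left_mem_Icc.mpr zero_le_one) (Ioc_subset_Icc_self hs)
    simp only [hst.1, Pi.zero_apply, zero_mul, sub_zero, Real.norm_eq_abs, abs_of_pos hs.1] at this
    linarith
  refine mem_planeCone_of_near hα hv hs.1 (key 0 fun u hu => (w0 u hu).trans ?_)
    (key 1 fun u hu => (w1 u hu).trans ?_)
  · linarith [hmax.1]
  · linarith [hmax.2]

/-- For small initial velocities in the cone, the geodesics of the metric are those of the model
metric. -/
theorem IsModelFlow.isGeodesicFrom {α k σ : ℝ} {b : ℝ → ℝ} {χ : ℝ × ℝ → ℝ}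
    {c w : (Fin 3 → ℝ) → ℝ → Fin 3 → ℝ} (h : IsModelFlow (k * σ) c w) (hα : 0 < α) (hα1 : α < 1)
    (hb : IsTransition b) (hχ : IsPlaneCutoff χ) (hσ : σ = 1 ∨ σ = -1) :
    ∀ᶠ v in 𝓝 (0 : Fin 3 → ℝ), v ∈ planeCone σ α → c v 1 ∈ unitRegion σ α k ∧
      IsGeodesicFrom α k b χ v (c v) (w v) ∧
      ∀ c' w', IsGeodesicFrom α k b χ v c' w' → EqOn (c v) c' (Icc 0 1) := by
  have hreg := planeCone_subset_unitRegion σ k hα hα1 (half_pos hα)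
  obtain ⟨ε, hε, hball⟩ := Metric.eventually_nhds_iff.mp hreg
  have hsmall : ∀ᶠ v in 𝓝 (0 : Fin 3 → ℝ), ∀ s ∈ Icc (0 : ℝ) 1, ‖c v s‖ < ε := by
    filter_upwards [eventually_all.mpr fun i => (h.pos_ord i).eventually_abs_lt hε] with v hv s hs
    exact (pi_norm_lt_iff hε).mpr fun i => hv i s hs
  filter_upwards [h.mem_planeCone σ hα hα1, hsmall, h.start, h.hasDeriv] with v hcone hsm hst hd hv
  have hmem : ∀ s ∈ Icc (0 : ℝ) 1, c v s = 0 ∨ c v s ∈ unitRegion σ α k := fun s hs => by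
    rcases hs.1.eq_or_lt with rfl | hs0
    · exact Or.inl hst.1
    · exact Or.inr (hball (by simpa using hsm s hs) (hcone hv s ⟨hs0, hs.2⟩))
  have hmem' : ∀ s ∈ Ioc (0 : ℝ) 1, c v s ∈ unitRegion σ α k := fun s hs =>
    hball (by simpa using hsm s (Ioc_subset_Icc_self hs)) (hcone hv s hs)
  refine ⟨hmem' 1 (by simp), ⟨hst.1, hst.2, fun s hs => ?_, fun s hs => (hd s hs).1,
    fun s hs => ?_⟩, fun c' w' hg => ?_⟩
  · rcases hmem s hs with h0 | h0
    · simp [h0, Real.pi_pos]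
    · exact (abs_lt_quarter_of_mem_unitRegion h0).1.trans (by linarith [Real.pi_gt_three])
  · rw [geodesicField_eq hα hb hχ hσ (hmem s hs)]
    exact (hd s hs).2
  · have hcc : ContinuousOn c' (Icc 0 1) := fun s hs => (hg.hasDeriv_pos s hs).continuousWithinAt
    have hwc : ContinuousOn w' (Icc 0 1) := fun s hs => (hg.hasDeriv_vel s hs).continuousWithinAt
    have key := eqOn_of_locally_solution (F := modelField (k * σ)) (β := fun s => (c v s, w v s))
      (γ := fun s => (c' s, w' s)) (fun s hs => (hd s hs).1.prodMk (hd s hs).2)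
      (fun s hs => ?_) (by simp [hst, hg.start_pos, hg.start_vel]) (hcc.prodMk hwc)
      (fun s hs heq => ?_)
    · intro s hs
      exact congrArg Prod.fst (key hs)
    · rcases hmem s hs with h0 | h0
      · exact modelField_contDiffAt (by simp [h0]) (by simp [h0])
      · exact modelField_contDiffAt
          (by linarith [one_add_ge_of_mem_unitRegion hα hb hχ hσ h0])
          (cos_pos_of_mem_unitRegion h0).ne'
    · have hfil : 𝓝[≥] s = 𝓝[Icc s 1] s := (nhdsWithin_Icc_eq_nhdsGE hs.2).symm
      have hle : 𝓝[≥] s ≤ 𝓝[Icc 0 1] s := by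
        rw [hfil]
        exact nhdsWithin_mono _ (Icc_subset_Icc_left hs.1)
      have hIcc : ∀ᶠ u in 𝓝[≥] s, u ∈ Icc (0 : ℝ) 1 := hle self_mem_nhdsWithin
      -- A competing geodesic is only known to solve the model equation inside the region. At a
      -- later time of agreement openness suffices. At time 0, where q lies on the boundary, its
      -- initial velocity forces it into the wider cone.
      have hreg' : ∀ᶠ u in 𝓝[≥] s, c' u = 0 ∨ c' u ∈ unitRegion σ α k := by
        rcases hs.1.eq_or_lt with rfl | hs0
        · have hc0 := hg.hasDeriv_pos 0 (by simp)
          rw [hg.start_vel] at hc0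
          have hnear (i : Fin 3) (hi : v i ≠ 0) : ∀ᶠ u in 𝓝[≥] (0 : ℝ),
              |c' u i - u * v i| ≤ 1 / 3 * (u * |v i|) := by
            have h1 := (hasDerivWithinAt_pi.mp hc0 i).isLittleO
            have h2 := h1.bound (c := 1 / 3 * |v i|) (by positivity)
            filter_upwards [hle h2, hIcc] with u hu hu'
            simp only [hg.start_pos, Pi.zero_apply, sub_zero, smul_eq_mul, Real.norm_eq_abs,
              abs_of_nonneg hu'.1] at hu
            linarith
          have n0 : v 0 ≠ 0 := fun h => by simp [planeCone, h] at hv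
          have n1 : v 1 ≠ 0 := fun h => by simp [planeCone, h] at hv
          have hsm' : ∀ᶠ u in 𝓝[≥] (0 : ℝ), c' u ∈ planeCone σ (α / 2) →
              c' u ∈ unitRegion σ α k := by
            have h1 := (hcc 0 (by simp)).tendsto
            rw [hg.start_pos] at h1
            exact hle (h1.eventually hreg)
          filter_upwards [hnear 0 n0, hnear 1 n1, hsm', hIcc] with u u0 u1 u2 u3
          rcases u3.1.eq_or_lt with rfl | hu
          · exact Or.inl hg.start_pos
          · exact Or.inr (u2 (mem_planeCone_of_near hα hv hu u0 u1))
        · have h0 : c' s ∈ unitRegion σ α k := by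
            rw [← show c v s = c' s from congrArg Prod.fst heq]
            exact hmem' s ⟨hs0, hs.2.le⟩
          filter_upwards [hle ((hcc s (Ico_subset_Icc_self hs)).tendsto.eventually
            ((isOpen_unitRegion σ k hα).mem_nhds h0))] with u hu using Or.inr hu
      filter_upwards [hreg', hIcc] with u hu hu'
      refine (hg.hasDeriv_pos u hu').prodMk ?_
      have := hg.hasDeriv_vel u hu'
      rw [geodesicField_eq hα hb hχ hσ hu] at this
      exact this

/-! ### Volumes of images of small dilated sets -/

section Volume

open MeasureTheory

/-- The hypothesis makes f factor through g by a K-Lipschitz map on g(S). In the sup norm Lebesgue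
measure is the three-dimensional Hausdorff measure, which such a map enlarges by at most K³. No
measurability or differentiability is required. -/
theorem volume_image_le_of_dist_le {f g : (Fin 3 → ℝ) → Fin 3 → ℝ} {S : Set (Fin 3 → ℝ)}
    {K : ℝ} (hK : 0 ≤ K) (h : ∀ x ∈ S, ∀ y ∈ S, ‖f x - f y‖ ≤ K * ‖g x - g y‖) :
    volume (f '' S) ≤ ENNReal.ofReal K ^ 3 * volume (g '' S) := by
  set φ : (Fin 3 → ℝ) → Fin 3 → ℝ := f ∘ Function.invFunOn g S with hφ
  have hinv : ∀ p ∈ g '' S, Function.invFunOn g S p ∈ S ∧ g (Function.invFunOn g S p) = p :=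
    fun p hp => ⟨Function.invFunOn_mem hp, Function.invFunOn_eq hp⟩
  have hLip : LipschitzOnWith K.toNNReal φ (g '' S) := by
    refine LipschitzOnWith.of_dist_le_mul fun p hp q hq => ?_
    obtain ⟨hp1, hp2⟩ := hinv p hp
    obtain ⟨hq1, hq2⟩ := hinv q hq
    have := h _ hp1 _ hq1
    rw [hp2, hq2] at this
    rw [dist_eq_norm, dist_eq_norm, Real.coe_toNNReal K hK]
    exact this
  have hsub : f '' S ⊆ φ '' (g '' S) := by
    rintro _ ⟨x, hx, rfl⟩
    refine ⟨g x, mem_image_of_mem g hx, ?_⟩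
    obtain ⟨h1, h2⟩ := hinv (g x) (mem_image_of_mem g hx)
    have := h _ h1 _ hx
    rw [h2, sub_self, norm_zero, mul_zero] at this
    exact sub_eq_zero.mp (norm_le_zero_iff.mp this)
  have hH := hLip.hausdorffMeasure_image_le (d := 3) (by norm_num)
  have h3 : (Measure.hausdorffMeasure 3 : Measure (Fin 3 → ℝ)) = volume := by
    have := hausdorffMeasure_pi_real (ι := Fin 3)
    simpa using this
  rw [h3] at hH
  refine (measure_mono hsub).trans (hH.trans_eq ?_)
  congr 1
  rw [show (3 : ℝ) = ((3 : ℕ) : ℝ) by norm_num, ENNReal.rpow_natCast]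
  rfl

theorem eventually_forall_dilate {P : (Fin 3 → ℝ) → Prop} (hP : ∀ᶠ v in 𝓝 0, P v)
    {Ω : Set (Fin 3 → ℝ)} {R : ℝ} (hΩ : ∀ v ∈ Ω, ‖v‖ ≤ R) :
    ∀ᶠ t : ℝ in 𝓝[>] 0, ∀ v ∈ dilate t Ω, P v := by
  obtain ⟨ε, hε, hball⟩ := Metric.eventually_nhds_iff.mp hP
  have h : ∀ᶠ t : ℝ in 𝓝[>] 0, t * R < ε := by
    have : Tendsto (fun t : ℝ => t * R) (𝓝[>] 0) (𝓝 (0 * R)) :=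
      (tendsto_id.mul_const R).mono_left nhdsWithin_le_nhds
    exact this.eventually (gt_mem_nhds (by simpa using hε))
  filter_upwards [h, self_mem_nhdsWithin] with t ht ht0
  rintro _ ⟨v, hv, rfl⟩
  refine hball ?_
  rw [dist_zero_right, norm_smul, Real.norm_of_nonneg (le_of_lt ht0)]
  exact (mul_le_mul_of_nonneg_left (hΩ v hv) (le_of_lt ht0)).trans_lt ht

theorem eventually_forall_dilate_pair {P : (Fin 3 → ℝ) × (Fin 3 → ℝ) → Prop}
    (hP : ∀ᶠ p in 𝓝 0, P p) {Ω : Set (Fin 3 → ℝ)} {R : ℝ} (hΩ : ∀ v ∈ Ω, ‖v‖ ≤ R) :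
    ∀ᶠ t : ℝ in 𝓝[>] 0, ∀ v ∈ dilate t Ω, ∀ v' ∈ dilate t Ω, P (v, v') := by
  rw [← Prod.mk_zero_zero, nhds_prod_eq] at hP
  obtain ⟨U, hU, V, hV, h⟩ := mem_prod_iff.mp hP
  filter_upwards [eventually_forall_dilate (hP := hU) hΩ, eventually_forall_dilate (hP := hV) hΩ]
    with t h1 h2 v hv v' hv' using h ⟨h1 v hv, h2 v' hv'⟩

theorem exists_bound_of_vanishOrd {m : ℕ} {F G : (Fin 3 → ℝ) → Fin 3 → ℝ}
    (h : ∀ i, VanishOrd m fun v _ => F v i - G v i) :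
    ∃ C, 0 ≤ C ∧ ∀ᶠ p : (Fin 3 → ℝ) × (Fin 3 → ℝ) in 𝓝 0, ‖(F p.1 - F p.2) - (G p.1 - G p.2)‖ ≤
      C * ((‖p.1‖ + ‖p.2‖) ^ m * ‖p.1 - p.2‖) := by
  choose C hC using fun i => (h i).isBigO.bound
  refine ⟨∑ i, |C i|, by positivity, ?_⟩
  filter_upwards [eventually_all.mpr fun i => eventually_prod_principal_iff.mp (hC i)] with p hp
  have hN : 0 ≤ (‖p.1‖ + ‖p.2‖) ^ m * ‖p.1 - p.2‖ := by positivity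
  refine (pi_norm_le_iff_of_nonneg (by positivity)).mpr fun i => ?_
  have h1 := hp i 0 (by simp)
  simp only [Real.norm_of_nonneg hN] at h1
  have h2 : ((F p.1 - F p.2) - (G p.1 - G p.2)) i = F p.1 i - G p.1 i - (F p.2 i - G p.2 i) := by
    simp only [Pi.sub_apply]
    ring
  rw [h2]
  refine h1.trans (mul_le_mul_of_nonneg_right ?_ hN)
  exact (le_abs_self _).trans
    (Finset.single_le_sum (f := fun i => |C i|) (fun i _ => abs_nonneg _) (Finset.mem_univ i))

/-- A map that is the identity up to order `3` is nearly isometric on small balls. -/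
theorem eventually_near_id {G : (Fin 3 → ℝ) → Fin 3 → ℝ}
    (h : ∀ i, VanishOrd 2 fun v _ => G v i - v i) :
    ∀ᶠ p : (Fin 3 → ℝ) × (Fin 3 → ℝ) in 𝓝 0,
      ‖(G p.1 - G p.2) - (p.1 - p.2)‖ ≤ 1 / 2 * ‖p.1 - p.2‖ := by
  obtain ⟨C, hC0, hC⟩ := exists_bound_of_vanishOrd (F := G) (G := fun v => v) h
  have ht : Tendsto (fun p : (Fin 3 → ℝ) × (Fin 3 → ℝ) => C * (‖p.1‖ + ‖p.2‖) ^ 2) (𝓝 0) (𝓝 0) := by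
    have : Continuous fun p : (Fin 3 → ℝ) × (Fin 3 → ℝ) => C * (‖p.1‖ + ‖p.2‖) ^ 2 := by fun_prop
    exact this.tendsto' _ _ (by simp)
  filter_upwards [hC, ht.eventually (gt_mem_nhds (show (0 : ℝ) < 1 / 2 by norm_num))] with p h1 h2
  refine h1.trans ?_
  rw [← mul_assoc]
  gcongr

theorem norm_sub_le_of_near_id {a b : Fin 3 → ℝ} (h : ‖a - b‖ ≤ 1 / 2 * ‖b‖) :
    ‖a‖ ≤ 3 / 2 * ‖b‖ ∧ ‖b‖ ≤ 2 * ‖a‖ := by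
  have h1 : ‖a‖ ≤ ‖a - b‖ + ‖b‖ := norm_le_norm_sub_add a b
  have h2 : ‖b‖ ≤ ‖a - b‖ + ‖a‖ := by
    rw [norm_sub_rev]
    exact norm_le_norm_sub_add b a
  constructor <;> linarith

theorem injOn_dilate_of_near_id {G : (Fin 3 → ℝ) → Fin 3 → ℝ}
    (h : ∀ i, VanishOrd 2 fun v _ => G v i - v i) {Ω : Set (Fin 3 → ℝ)} {R : ℝ}
    (hΩ : ∀ v ∈ Ω, ‖v‖ ≤ R) :
    ∀ᶠ t : ℝ in 𝓝[>] 0, InjOn G (dilate t Ω) ∧ ContinuousOn G (dilate t Ω) := by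
  filter_upwards [eventually_forall_dilate_pair (eventually_near_id h) hΩ] with t ht
  refine ⟨fun v hv v' hv' heq => ?_, ?_⟩
  · have := (norm_sub_le_of_near_id (ht v hv v' hv')).2
    simp only [heq, sub_self, norm_zero, mul_zero] at this
    exact sub_eq_zero.mp (norm_le_zero_iff.mp this)
  · refine LipschitzOnWith.continuousOn (K := 3 / 2) (LipschitzOnWith.of_dist_le_mul fun v hv v' hv' => ?_)
    rw [dist_eq_norm, dist_eq_norm]
    exact (norm_sub_le_of_near_id (ht v hv v' hv')).1

theorem volume_dilate (Ω : Set (Fin 3 → ℝ)) {t : ℝ} (ht : 0 ≤ t) :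
    volume (dilate t Ω) = ENNReal.ofReal (t ^ 3) * volume Ω := by
  have := Measure.addHaar_smul (volume : Measure (Fin 3 → ℝ)) t Ω
  rw [Module.finrank_fin_fun, abs_of_nonneg (by positivity)] at this
  exact this

/-- For δ ≤ 1/2 the cubes are at most 1 + 5δ and 1 + 14δ, and a ≤ 4g. The constant is 56 = 14 · 4.
-/
theorem abs_sub_le_of_cube_le {a g δ : ℝ} (hδ0 : 0 ≤ δ) (hδ : δ ≤ 1 / 2) (ha0 : 0 ≤ a)
    (hg0 : 0 ≤ g) (ha : a ≤ (1 + δ) ^ 3 * g) (hg : g ≤ (1 + 2 * δ) ^ 3 * a) :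
    |a - g| ≤ 56 * δ * g := by
  have hsq : δ ^ 2 ≤ δ / 2 := by nlinarith
  have hcb : δ ^ 3 ≤ δ / 4 := by nlinarith
  have h1 : (1 + δ) ^ 3 ≤ 1 + 5 * δ := by nlinarith
  have h2 : (1 + 2 * δ) ^ 3 ≤ 1 + 14 * δ := by nlinarith
  have h3 : (1 + δ) ^ 3 ≤ 4 := by linarith
  have h4 : a ≤ (1 + 5 * δ) * g := ha.trans (by gcongr)
  have h5 : a ≤ 4 * g := by nlinarith
  have h6 : g ≤ (1 + 14 * δ) * a := hg.trans (by gcongr)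
  rw [abs_le]
  constructor <;> nlinarith [mul_nonneg hδ0 hg0, mul_le_mul_of_nonneg_left h5 hδ0]

/-- If `F` and `G` agree to order `4`, the volumes of `F (tΩ)` and `G (tΩ)` agree to order `6`. -/
theorem volume_image_sub_isBigO {F G : (Fin 3 → ℝ) → Fin 3 → ℝ}
    (hFG : ∀ i, VanishOrd 3 fun v _ => F v i - G v i)
    (hG : ∀ i, VanishOrd 2 fun v _ => G v i - v i) {Ω : Set (Fin 3 → ℝ)} {R : ℝ}
    (hΩ : ∀ v ∈ Ω, ‖v‖ ≤ R) :
    (fun t : ℝ => (volume (F '' dilate t Ω)).toReal - (volume (G '' dilate t Ω)).toReal)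
      =O[𝓝[>] 0] fun t : ℝ => t ^ 6 := by
  obtain ⟨C, hC0, hC⟩ := exists_bound_of_vanishOrd hFG
  have hvol : volume Ω ≠ ⊤ := by
    refine ((measure_mono fun v hv => ?_).trans_lt (measure_closedBall_lt_top (x := (0 : Fin 3 → ℝ))
      (r := R))).ne
    simpa using hΩ v hv
  -- The sum of norms is at most 2Rt, whence (2R)³. The last factor 2 comes from ‖v - v'‖ ≤ 2‖G v -
  -- G v'‖.
  set D := C * (2 * R) ^ 3 * 2 with hD
  have hδ : ∀ᶠ t : ℝ in 𝓝[>] 0, |D| * t ^ 3 < 1 / 2 := by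
    have : Tendsto (fun t : ℝ => |D| * t ^ 3) (𝓝[>] 0) (𝓝 (|D| * 0 ^ 3)) :=
      ((tendsto_id.pow 3).const_mul _).mono_left nhdsWithin_le_nhds
    exact this.eventually (gt_mem_nhds (by norm_num))
  refine Asymptotics.IsBigO.of_bound (56 * |D| * ((3 / 2) ^ 3 * (volume Ω).toReal)) ?_
  filter_upwards [eventually_forall_dilate_pair (eventually_near_id hG) hΩ,
    eventually_forall_dilate_pair hC hΩ, hδ, self_mem_nhdsWithin] with t h1 h2 hδ ht
  have ht0 : (0 : ℝ) < t := ht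
  have hsize : ∀ v ∈ dilate t Ω, ‖v‖ ≤ t * R := by
    rintro _ ⟨v, hv, rfl⟩
    rw [norm_smul, Real.norm_of_nonneg ht0.le]
    exact mul_le_mul_of_nonneg_left (hΩ v hv) ht0.le
  set δ := |D| * t ^ 3 with hδdef
  have hδ0 : 0 ≤ δ := by positivity
  have key : ∀ v ∈ dilate t Ω, ∀ v' ∈ dilate t Ω,
      ‖(F v - F v') - (G v - G v')‖ ≤ δ * ‖G v - G v'‖ := fun v hv v' hv' => by
    have k1 := (norm_sub_le_of_near_id (h1 v hv v' hv')).2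
    have k2 := h2 v hv v' hv'
    have k3 : (‖v‖ + ‖v'‖) ^ 3 ≤ (2 * R) ^ 3 * t ^ 3 := by
      rw [← mul_pow]
      gcongr
      linarith [hsize v hv, hsize v' hv']
    calc _ ≤ C * ((‖v‖ + ‖v'‖) ^ 3 * ‖v - v'‖) := k2
      _ ≤ C * (((2 * R) ^ 3 * t ^ 3) * (2 * ‖G v - G v'‖)) := by
          gcongr
          exact (by positivity : 0 ≤ (‖v‖ + ‖v'‖) ^ 3).trans k3
      _ = D * t ^ 3 * ‖G v - G v'‖ := by ring
      _ ≤ δ * ‖G v - G v'‖ := by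
          rw [hδdef]
          gcongr
          exact le_abs_self _
  have e1 := volume_image_le_of_dist_le (f := F) (g := G) (S := dilate t Ω) (K := 1 + δ)
    (by positivity) fun v hv v' hv' => by
      have := norm_le_norm_sub_add (F v - F v') (G v - G v')
      linarith [key v hv v' hv']
  -- From ‖ΔF‖ ≥ (1 - δ)‖ΔG‖ and (1 + 2δ)(1 - δ) = 1 + δ(1 - 2δ) ≥ 1 one gets the constant 1 + 2δ
  -- for the reverse comparison.
  have e2 := volume_image_le_of_dist_le (f := G) (g := F) (S := dilate t Ω) (K := 1 + 2 * δ)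
    (by positivity) fun v hv v' hv' => by
      have := norm_le_norm_sub_add (G v - G v') (F v - F v')
      rw [norm_sub_rev (G v - G v') (F v - F v')] at this
      have hk := key v hv v' hv'
      have h3 : (1 - δ) * ‖G v - G v'‖ ≤ ‖F v - F v'‖ := by linarith
      have h4 := mul_le_mul_of_nonneg_left h3 (by positivity : 0 ≤ 1 + 2 * δ)
      nlinarith [mul_nonneg (mul_nonneg hδ0 (by linarith : 0 ≤ 1 - 2 * δ))
        (norm_nonneg (G v - G v'))]
  have e3 := volume_image_le_of_dist_le (f := G) (g := fun v => v) (S := dilate t Ω) (K := 3 / 2)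
    (by positivity) fun v hv v' hv' => (norm_sub_le_of_near_id (h1 v hv v' hv')).1
  rw [image_id', volume_dilate Ω ht0.le] at e3
  have hGfin : volume (G '' dilate t Ω) ≠ ⊤ :=
    ne_top_of_le_ne_top (by finiteness) e3
  have hFfin : volume (F '' dilate t Ω) ≠ ⊤ :=
    ne_top_of_le_ne_top (by finiteness) e1
  have r1 := ENNReal.toReal_mono (by finiteness) e1
  have r2 := ENNReal.toReal_mono (by finiteness) e2
  have r3 := ENNReal.toReal_mono (by finiteness) e3
  rw [ENNReal.toReal_mul, ENNReal.toReal_pow, ENNReal.toReal_ofReal (by positivity)] at r1 r2 r3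
  rw [ENNReal.toReal_mul, ENNReal.toReal_ofReal (by positivity)] at r3
  have := abs_sub_le_of_cube_le hδ0 hδ.le ENNReal.toReal_nonneg ENNReal.toReal_nonneg r1 r2
  rw [Real.norm_eq_abs, Real.norm_of_nonneg (by positivity)]
  calc _ ≤ 56 * δ * _ := this
    _ ≤ 56 * δ * ((3 / 2) ^ 3 * (t ^ 3 * (volume Ω).toReal)) := by gcongr
    _ = _ := by rw [hδdef]; ring

end Volume

/-! ### Volume in the model metric -/

/-- A map that carries the volume of the metric with warping function `1 + κ r θ` to Lebesgue
measure. -/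
noncomputable def flatten (κ : ℝ) (x : Fin 3 → ℝ) : Fin 3 → ℝ :=
  ![x 0, x 1, x 2 * (Real.cos (x 0) * (1 + κ * (x 0 * x 1))⁻¹)]

/-- The third-order Taylor polynomial of `flatten κ` composed with the exponential map. -/
noncomputable def flatTaylor (κ : ℝ) (v : Fin 3 → ℝ) : Fin 3 → ℝ :=
  ![v 0 + cubicForm κ v v 0 / 6, v 1 + cubicForm κ v v 1 / 6,
    v 2 + cubicForm κ v v 2 / 6 - κ * (v 2 * v 0 * v 1) - v 2 * v 0 * v 0 / 2]

theorem flatTaylor_sub_ord (κ : ℝ) (i : Fin 3) :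
    VanishOrd 2 fun v _ => flatTaylor κ v i - v i := by
  have hC := VanishOrd.of_cubicForm (κ := κ) (c := fun v _ => v) (w := fun v _ => v)
    VanishOrd.coord VanishOrd.coord i
  have t (i j k : Fin 3) : VanishOrd 2 fun v (_ : ℝ) => v i * v j * v k :=
    ((VanishOrd.coord i).mul (VanishOrd.coord j)).mul (VanishOrd.coord k)
  fin_cases i
  · exact (hC.const_mul (1 / 6)).congr fun v s => by simp [flatTaylor]; ring
  · exact (hC.const_mul (1 / 6)).congr fun v s => by simp [flatTaylor]; ring
  · exact (((hC.const_mul (1 / 6)).sub ((t 2 0 1).const_mul κ)).sub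
      ((t 2 0 0).const_mul (1 / 2))).congr fun v s => by simp [flatTaylor]; ring

theorem VanishOrd.cos_taylor {f : (Fin 3 → ℝ) → ℝ → ℝ} (hf : VanishOrd 0 f) :
    VanishOrd 2 fun v s => Real.cos (f v s) - 1 + f v s ^ 2 / 2 := by
  refine (comp (h := fun x => Real.cos x - 1 + x ^ 2 / 2) (j := 2) (by simp)
    (isBigO_sub_of_deriv (h := fun x => Real.cos x - 1 + x ^ 2 / 2)
      (h' := fun x => - Real.sin x + x) ?_ ?_) hf).mono (by lia)
  · refine Eventually.of_forall fun x => ?_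
    refine ((((Real.hasDerivAt_cos x).sub_const 1)).fun_add
      ((hasDerivAt_pow 2 x).div_const 2)).congr_deriv ?_
    simp
  · have h := isBigO_sub_of_deriv_eq_zero (h := fun x => - Real.sin x + x)
      (Real.contDiff_sin.neg.add contDiff_id).contDiffAt
      (by simp)
    have ht : Tendsto (fun x : ℝ => (x, (0 : ℝ))) (𝓝 0) (𝓝 0) :=
      (continuous_id.prodMk continuous_const).tendsto' _ _ rfl
    refine (h.comp_tendsto ht).congr (fun x => by simp) fun x => ?_
    simp [pow_two]

theorem VanishOrd.inv_taylor {f : (Fin 3 → ℝ) → ℝ → ℝ} (hf : VanishOrd 1 f) :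
    VanishOrd 3 fun v s => (1 + f v s)⁻¹ - 1 + f v s := by
  refine (comp (h := fun x => (1 + x)⁻¹ - 1 + x) (j := 1) (by simp)
    (isBigO_sub_of_deriv_eq_zero (h := fun x => (1 + x)⁻¹ - 1 + x) ?_ ?_) hf).mono (by lia)
  · exact (((contDiffAt_const.add contDiffAt_id).inv (by simp)).sub
      contDiffAt_const).add contDiffAt_id
  · have h1 : HasDerivAt (fun x : ℝ => 1 + x) 1 0 := (hasDerivAt_id' 0).const_add 1
    simpa using (((h1.fun_inv (by simp)).sub_const 1).fun_add (hasDerivAt_id' 0)).deriv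

theorem IsModelFlow.flatten_sub_ord {κ : ℝ} {c w : (Fin 3 → ℝ) → ℝ → Fin 3 → ℝ}
    (h : IsModelFlow κ c w) (i : Fin 3) :
    VanishOrd 3 fun v _ => flatten κ (c v 1) i - flatTaylor κ v i := by
  have hX := (h.pos_expansion i).eval_one
  fin_cases i
  · exact hX.congr fun v s => by simp [flatten, flatTaylor]; ring
  · exact hX.congr fun v s => by simp [flatten, flatTaylor]; ring
  · have hE (i : Fin 3) := (h.pos_ord i).eval_one
    have hd (i : Fin 3) : VanishOrd 2 fun v _ => c v 1 i - v i :=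
      (h.pos_sub_ord i).eval_one.congr fun v s => by ring
    have t (i j k : Fin 3) : VanishOrd 3 fun v (_ : ℝ) =>
        c v 1 i * c v 1 j * c v 1 k - v i * v j * v k :=
      VanishOrd.triple_sub (hE j) (hE k) (VanishOrd.coord i) (VanishOrd.coord j) (hd i) (hd j) (hd k)
    have hu := ((hE 0).mul (hE 1)).const_mul κ
    have hk := (hE 0).cos_taylor
    have hm := hu.inv_taylor
    have hg := hu.inv_one_add
    -- This is cos r - 1, written as a sum of small terms. The product z · cos r · (1 + u)⁻¹, with u
    -- = κrθ, splits as z + z(cos r - 1) + z((1 + u)⁻¹ - 1) plus the product of z with both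
    -- brackets. Only -zr²/2 and -zu survive beyond z to order three.
    have hP := ((((hE 0).mul (hE 0)).const_mul (-1 / 2)).add (hk.mono (m := 1) (by lia)))
    refine (((((hX.sub ((t 2 0 0).const_mul (1 / 2))).sub ((t 2 0 1).const_mul κ)).add
      ((hE 2).mul_le hk (by lia))).add ((hE 2).mul_le hm (by lia))).add
      (((hE 2).mul hP).mul_le hg (by lia))).congr fun v s => ?_
    simp [flatten, flatTaylor]
    ring

/-! ### The Jacobian of the cubic Taylor map -/

section

open MeasureTheory Asymptotics
open scoped Pointwise

/-- The derivative of `flatTaylor κ` is `1 + flatMatrix κ v`. -/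
noncomputable def flatMatrix (κ : ℝ) (v : Fin 3 → ℝ) : Matrix (Fin 3) (Fin 3) ℝ :=
  !![κ * (v 0 * v 1) - v 1 * v 1 / 6,
      (3 * κ * (v 0 * v 0) - 3 * κ * (v 1 * v 1) - 2 * (v 0 * v 1) + κ * (v 2 * v 2)) / 6,
      κ * (v 1 * v 2) / 3;
    (-3 * κ * (v 0 * v 0) + 3 * κ * (v 1 * v 1) + 4 * (v 0 * v 1) + κ * (v 2 * v 2)) / 6,
      κ * (v 0 * v 1) + v 0 * v 0 / 3,
      κ * (v 0 * v 2) / 3;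
    -(5 / 3) * κ * (v 1 * v 2) - v 0 * v 2,
      -(5 / 3) * κ * (v 0 * v 2),
      -(5 / 3) * κ * (v 0 * v 1) - v 0 * v 0 / 2]

/-- The continuous linear map of a `3 × 3` matrix. -/
noncomputable def matrixCLM (M : Matrix (Fin 3) (Fin 3) ℝ) : (Fin 3 → ℝ) →L[ℝ] (Fin 3 → ℝ) :=
  LinearMap.toContinuousLinearMap (Matrix.toLin' M)

theorem det_matrixCLM (M : Matrix (Fin 3) (Fin 3) ℝ) : (matrixCLM M).det = M.det := by
  simp [matrixCLM, ContinuousLinearMap.det, LinearMap.det_toLin']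

theorem hasFDerivAt_of_rows {f : (Fin 3 → ℝ) → Fin 3 → ℝ} {M : Matrix (Fin 3) (Fin 3) ℝ}
    {x : Fin 3 → ℝ} (h : ∀ i, ∃ L : (Fin 3 → ℝ) →L[ℝ] ℝ, HasFDerivAt (fun y => f y i) L x ∧
      ∀ v, L v = M i 0 * v 0 + M i 1 * v 1 + M i 2 * v 2) :
    HasFDerivAt f (matrixCLM M) x := by
  rw [hasFDerivAt_pi']
  intro i
  obtain ⟨L, hL, hv⟩ := h i
  refine hL.congr_fderiv ?_
  ext1 v
  simp [hv, matrixCLM, Matrix.toLin'_apply, Matrix.mulVec, dotProduct, Fin.sum_univ_three]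

theorem hasFDerivAt_flatTaylor (κ : ℝ) (x : Fin 3 → ℝ) :
    HasFDerivAt (flatTaylor κ) (matrixCLM (1 + flatMatrix κ x)) x := by
  have hx := fun i => hasFDerivAt_coord i x
  have t (i j k : Fin 3) := ((hx i).fun_mul (hx j)).fun_mul (hx k)
  refine hasFDerivAt_of_rows fun i => ?_
  fin_cases i
  · have e := (hx 0).fun_add ((((((t 0 0 1).const_mul (3 * κ)).fun_sub ((t 1 1 1).const_mul κ)).fun_sub
      (t 0 1 1)).fun_add ((t 1 2 2).const_mul κ)).const_mul (1 / 6))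
    refine ⟨_, e.congr_of_eventuallyEq (Eventually.of_forall fun v => ?_), fun v => ?_⟩
    · simp [flatTaylor, cubicForm]; ring
    · simp [flatMatrix]; ring
  · have e := (hx 1).fun_add ((((((t 0 1 1).const_mul (3 * κ)).fun_sub ((t 0 0 0).const_mul κ)).fun_add
      ((t 0 0 1).const_mul 2)).fun_add ((t 0 2 2).const_mul κ)).const_mul (1 / 6))
    refine ⟨_, e.congr_of_eventuallyEq (Eventually.of_forall fun v => ?_), fun v => ?_⟩
    · simp [flatTaylor, cubicForm]; ring
    · simp [flatMatrix]; ring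
  · have e := ((hx 2).fun_sub ((t 2 0 1).const_mul (5 / 3 * κ))).fun_sub ((t 2 0 0).const_mul (1 / 2))
    refine ⟨_, e.congr_of_eventuallyEq (Eventually.of_forall fun v => ?_), fun v => ?_⟩
    · simp [flatTaylor, cubicForm]; ring
    · simp [flatMatrix]; ring

/-- The trace of `flatMatrix κ v`. -/
noncomputable def flatTrace (κ : ℝ) (v : Fin 3 → ℝ) : ℝ :=
  κ / 3 * (v 0 * v 1) - (v 0 ^ 2 + v 1 ^ 2) / 6

/-- All entries are quadratic in v, so in the expansion of the determinant everything beyond 1 plus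
the trace is a product of at least two entries. The trace is -Ric(v,v)/6 of the model metric at q.
-/
theorem det_one_add_flatMatrix_sub_isBigO (κ : ℝ) :
    (fun v => (1 + flatMatrix κ v).det - 1 - flatTrace κ v) =O[𝓝 0]
      fun v : Fin 3 → ℝ => ‖v‖ ^ 4 := by
  have hp (i j : Fin 3) : (fun v : Fin 3 → ℝ => v i * v j) =O[𝓝 0] fun v => ‖v‖ ^ 2 := by
    refine IsBigO.of_bound 1 (Eventually.of_forall fun v => ?_)
    rw [norm_mul, one_mul, norm_pow, norm_norm, pow_two]
    exact mul_le_mul (norm_le_pi_norm v i) (norm_le_pi_norm v j) (norm_nonneg _) (norm_nonneg _)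
  have hA (i j : Fin 3) : (fun v => flatMatrix κ v i j) =O[𝓝 0] fun v : Fin 3 → ℝ => ‖v‖ ^ 2 := by
    have hc (a b d e g : ℝ) (i j : Fin 3) : (fun v : Fin 3 → ℝ => a * (v 0 * v 0) + b * (v 1 * v 1)
        + d * (v 2 * v 2) + e * (v 0 * v 1) + g * (v i * v j)) =O[𝓝 0] fun v => ‖v‖ ^ 2 :=
      (((((hp 0 0).const_mul_left a).add ((hp 1 1).const_mul_left b)).add
        ((hp 2 2).const_mul_left d)).add ((hp 0 1).const_mul_left e)).add
          ((hp i j).const_mul_left g)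
    fin_cases i <;> fin_cases j
    · exact (hc 0 (-1 / 6) 0 κ 0 0 2).congr_left fun v => by simp [flatMatrix]; ring
    · exact (hc (κ / 2) (-κ / 2) (κ / 6) (-1 / 3) 0 0 2).congr_left fun v => by
        simp [flatMatrix]; ring
    · exact (hc 0 0 0 0 (κ / 3) 1 2).congr_left fun v => by simp [flatMatrix]; ring
    · exact (hc (-κ / 2) (κ / 2) (κ / 6) (2 / 3) 0 0 2).congr_left fun v => by
        simp [flatMatrix]; ring
    · exact (hc (1 / 3) 0 0 κ 0 0 2).congr_left fun v => by simp [flatMatrix]; ring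
    · exact (hc 0 0 0 0 (κ / 3) 0 2).congr_left fun v => by simp [flatMatrix]; ring
    · exact ((hc 0 0 0 0 (-(5 / 3) * κ) 1 2).sub (hp 0 2)).congr_left fun v => by
        simp [flatMatrix]
    · exact (hc 0 0 0 0 (-(5 / 3) * κ) 0 2).congr_left fun v => by simp [flatMatrix]
    · exact (hc (-1 / 2) 0 0 (-(5 / 3) * κ) 0 0 2).congr_left fun v => by
        simp [flatMatrix]; ring
  have h1 : (fun v : Fin 3 → ℝ => ‖v‖ ^ 2) =O[𝓝 0] fun _ => (1 : ℝ) := by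
    have : Continuous fun v : Fin 3 → ℝ => ‖v‖ ^ 2 := by fun_prop
    exact this.continuousAt.norm.isBoundedUnder_le.isBigO_one ℝ
  have h2 (i j k l : Fin 3) : (fun v => flatMatrix κ v i j * flatMatrix κ v k l) =O[𝓝 0]
      fun v : Fin 3 → ℝ => ‖v‖ ^ 4 :=
    ((hA i j).mul (hA k l)).congr_right fun v => by ring
  have h3 (i j k l m n : Fin 3) :
      (fun v => flatMatrix κ v i j * flatMatrix κ v k l * flatMatrix κ v m n) =O[𝓝 0]
      fun v : Fin 3 → ℝ => ‖v‖ ^ 4 :=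
    ((h2 i j k l).mul ((hA m n).trans h1)).congr_right fun v => by ring
  have e2 := ((((h2 0 0 1 1).add (h2 0 0 2 2)).add (h2 1 1 2 2)).sub (h2 0 1 1 0)).sub
    ((h2 0 2 2 0).add (h2 1 2 2 1))
  have e3 := (((((h3 0 0 1 1 2 2).sub (h3 0 0 1 2 2 1)).sub (h3 0 1 1 0 2 2)).add
    (h3 0 1 1 2 2 0)).add (h3 0 2 1 0 2 1)).sub (h3 0 2 1 1 2 0)
  refine (e2.add e3).congr_left fun v => ?_
  have htr : flatTrace κ v = flatMatrix κ v 0 0 + flatMatrix κ v 1 1 + flatMatrix κ v 2 2 := by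
    simp [flatTrace, flatMatrix]; ring
  rw [htr, Matrix.det_fin_three]
  simp
  ring

theorem continuous_flatMatrix (κ : ℝ) : Continuous (flatMatrix κ) := by
  refine continuous_matrix fun i j => ?_
  fin_cases i <;> fin_cases j <;> simp [flatMatrix] <;> fun_prop

theorem continuous_flatTrace (κ : ℝ) : Continuous (flatTrace κ) := by
  unfold flatTrace
  fun_prop

/-- Quadratic homogeneity contributes t² and the volume element t³. -/
theorem integral_dilate_flatTrace (κ : ℝ) (Ω : Set (Fin 3 → ℝ)) {t : ℝ} (ht : 0 < t) :
    ∫ v in dilate t Ω, flatTrace κ v = t ^ 5 * ∫ v in Ω, flatTrace κ v := by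
  have h := Measure.setIntegral_comp_smul_of_pos (volume : Measure (Fin 3 → ℝ)) (flatTrace κ) Ω ht
  have h2 : ∀ v, flatTrace κ (t • v) = t ^ 2 * flatTrace κ v := fun v => by
    simp [flatTrace]; ring
  simp only [h2, integral_const_mul, Module.finrank_fin_fun, smul_eq_mul] at h
  have h' : ∫ v in dilate t Ω, flatTrace κ v = ∫ v in t • Ω, flatTrace κ v := rfl
  rw [h']
  field_simp at h
  linear_combination -h

theorem integrableOn_of_norm_le {f : (Fin 3 → ℝ) → ℝ} (hf : Continuous f)
    {Ω : Set (Fin 3 → ℝ)} {R : ℝ} (hΩ : ∀ v ∈ Ω, ‖v‖ ≤ R) : IntegrableOn f Ω :=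
  (hf.continuousOn.integrableOn_compact (isCompact_closedBall 0 R)).mono_set
    fun v hv => by simpa using hΩ v hv

theorem measurableSet_dilate {Ω : Set (Fin 3 → ℝ)} (hm : MeasurableSet Ω) {t : ℝ} (ht : t ≠ 0) :
    MeasurableSet (dilate t Ω) :=
  hm.const_smul_of_ne_zero ht

/-- The change of variables formula expresses the volume as the integral of the Jacobian. Its
quartic remainder over a set of volume O(t³) contributes O(t⁷), which is more than needed. -/
theorem volume_flatTaylor_image (κ : ℝ) {Ω : Set (Fin 3 → ℝ)} (hm : MeasurableSet Ω) {R : ℝ}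
    (hΩ : ∀ v ∈ Ω, ‖v‖ ≤ R) :
    (fun t : ℝ => (volume (flatTaylor κ '' dilate t Ω)).toReal - t ^ 3 * (volume Ω).toReal
      - t ^ 5 * ∫ v in Ω, flatTrace κ v) =O[𝓝[>] 0] fun t : ℝ => t ^ 6 := by
  obtain ⟨C, hC0, hC⟩ := (det_one_add_flatMatrix_sub_isBigO κ).exists_nonneg
  have hpos : ∀ᶠ v in 𝓝 (0 : Fin 3 → ℝ), 0 < (1 + flatMatrix κ v).det := by
    have : Continuous fun v => (1 + flatMatrix κ v).det :=
      (continuous_const.add (continuous_flatMatrix κ)).matrix_det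
    refine this.continuousAt.eventually (lt_mem_nhds ?_)
    have : flatMatrix κ 0 = 0 := by
      ext i j
      fin_cases i <;> fin_cases j <;> simp [flatMatrix]
    simp [this]
  refine IsBigO.of_bound (C * R ^ 4 * (volume Ω).toReal) ?_
  filter_upwards [injOn_dilate_of_near_id (flatTaylor_sub_ord κ) hΩ,
    eventually_forall_dilate hC.bound hΩ, eventually_forall_dilate hpos hΩ, self_mem_nhdsWithin,
    Ioo_mem_nhdsGT one_pos] with t hinj hb hp ht0 ht1
  have ht0 : 0 < t := ht0
  set S := dilate t Ω with hS
  have hsize : ∀ v ∈ S, ‖v‖ ≤ t * R := by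
    rintro _ ⟨v, hv, rfl⟩
    rw [norm_smul, Real.norm_of_nonneg ht0.le]
    exact mul_le_mul_of_nonneg_left (hΩ v hv) ht0.le
  have hSm : MeasurableSet S := measurableSet_dilate hm ht0.ne'
  have hvolS : (volume S).toReal = t ^ 3 * (volume Ω).toReal := by
    rw [hS, volume_dilate Ω ht0.le, ENNReal.toReal_mul, ENNReal.toReal_ofReal (by positivity)]
  have hSfin : volume S < ⊤ := by
    refine (measure_mono fun v hv => ?_).trans_lt (measure_closedBall_lt_top (x := (0 : Fin 3 → ℝ))
      (r := t * R))
    simpa using hsize v hv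
  have hvol := integral_image_eq_integral_abs_det_fderiv_smul volume hSm
    (fun x _ => (hasFDerivAt_flatTaylor κ x).hasFDerivWithinAt) hinj.1 fun _ => (1 : ℝ)
  simp only [setIntegral_const, smul_eq_mul, mul_one, det_matrixCLM] at hvol
  rw [setIntegral_congr_fun hSm (g := fun v => (1 + flatMatrix κ v).det)
    fun v hv => abs_of_pos (hp v hv)] at hvol
  have i1 : IntegrableOn (fun v => (1 + flatMatrix κ v).det) S :=
    integrableOn_of_norm_le
      (continuous_const.add (continuous_flatMatrix κ)).matrix_det hsize
  have i2 : IntegrableOn (fun _ => (1 : ℝ)) S :=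
    integrableOn_of_norm_le continuous_const hsize
  have i3 : IntegrableOn (flatTrace κ) S :=
    integrableOn_of_norm_le (continuous_flatTrace κ) hsize
  have hsub : ∫ v in S, ((1 + flatMatrix κ v).det - 1 - flatTrace κ v) =
      (volume (flatTaylor κ '' S)).toReal - t ^ 3 * (volume Ω).toReal
        - t ^ 5 * ∫ v in Ω, flatTrace κ v := by
    have i12 : IntegrableOn (fun v => (1 + flatMatrix κ v).det - 1) S := i1.sub i2
    rw [integral_sub i12 i3, integral_sub i1 i2, ← hvol, setIntegral_const, smul_eq_mul,
      mul_one, hS, integral_dilate_flatTrace κ Ω ht0, ← hS, ← hvolS]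
    rfl
  rw [← hsub]
  by_cases hne : S.Nonempty
  · obtain ⟨v₀, hv₀⟩ := hne
    have hR : 0 ≤ R := by
      have := (norm_nonneg _).trans (hsize v₀ hv₀)
      exact nonneg_of_mul_nonneg_right this ht0
    refine (norm_setIntegral_le_of_norm_le_const hSfin (C := C * (t * R) ^ 4)
      fun v hv => (hb v hv).trans ?_).trans ?_
    · rw [Real.norm_of_nonneg (by positivity)]
      gcongr
      exact hsize v hv
    · have : (volume.real S) = t ^ 3 * (volume Ω).toReal := hvolS
      rw [this, Real.norm_of_nonneg (by positivity)]
      have h7 : t ^ 7 ≤ t ^ 6 := pow_le_pow_of_le_one ht0.le ht1.2.le (by lia)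
      calc C * (t * R) ^ 4 * (t ^ 3 * (volume Ω).toReal)
          = C * R ^ 4 * (volume Ω).toReal * t ^ 7 := by ring
        _ ≤ _ := by gcongr
  · rw [not_nonempty_iff_eq_empty.mp hne]
    simp only [Measure.restrict_empty, integral_zero_measure, norm_zero]
    positivity

theorem IsModelFlow.volume_flatten_image {κ : ℝ} {c w : (Fin 3 → ℝ) → ℝ → Fin 3 → ℝ}
    (h : IsModelFlow κ c w) {Ω : Set (Fin 3 → ℝ)} (hm : MeasurableSet Ω) {R : ℝ}
    (hΩ : ∀ v ∈ Ω, ‖v‖ ≤ R) :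
    (fun t : ℝ => (volume ((fun v => flatten κ (c v 1)) '' dilate t Ω)).toReal
      - t ^ 3 * (volume Ω).toReal - t ^ 5 * ∫ v in Ω, flatTrace κ v)
      =O[𝓝[>] 0] fun t : ℝ => t ^ 6 :=
  ((volume_image_sub_isBigO h.flatten_sub_ord (flatTaylor_sub_ord κ) hΩ).add
    (volume_flatTaylor_image κ hm hΩ)).congr_left fun t => by ring

end

/-! ### The Riemannian volume of the image of the exponential map -/

section

open MeasureTheory

theorem injOn_polarParam : InjOn polarParam polarBox := by
  rintro x ⟨hx0, hx1, hx2⟩ y ⟨hy0, hy1, hy2⟩ h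
  have e1 : (polarParam x).1 = (polarParam y).1 := congrArg Prod.fst h
  have e2 : (polarParam x).2 = (polarParam y).2 := congrArg Prod.snd h
  have a0 := congrArg (fun p : EuclideanSpace ℝ (Fin 3) => p 0) e1
  have a1 := congrArg (fun p : EuclideanSpace ℝ (Fin 3) => p 1) e1
  have a2 := congrArg (fun p : EuclideanSpace ℝ (Fin 3) => p 2) e1
  simp only [polarParam] at a0 a1 a2 e2
  simp at a0 a1 a2
  have h0 : x 0 = y 0 := Real.injOn_sin ⟨hx0.1.le, hx0.2.le⟩ ⟨hy0.1.le, hy0.2.le⟩ a2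
  have hc := (Real.cos_pos_of_mem_Ioo hy0).ne'
  rw [h0] at a0 a1
  have k0 := mul_left_cancel₀ hc a0
  have k1 := mul_left_cancel₀ hc a1
  have h1 : x 1 = y 1 := by
    rw [← Complex.arg_cos_add_sin_mul_I hx1, ← Complex.arg_cos_add_sin_mul_I hy1,
      ← Complex.ofReal_cos, ← Complex.ofReal_sin, k0, k1, Complex.ofReal_cos, Complex.ofReal_sin]
  have h2 : x 2 = y 2 := by
    rw [← Complex.arg_cos_add_sin_mul_I hx2, ← Complex.arg_cos_add_sin_mul_I hy2,
      ← Complex.exp_mul_I, ← Complex.exp_mul_I, e2]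
  ext i
  fin_cases i <;> assumption

theorem riemVol_image_polarParam (α k : ℝ) (b : ℝ → ℝ) (χ : ℝ × ℝ → ℝ) {B : Set (Fin 3 → ℝ)}
    (hB : B ⊆ polarBox) : riemVol α k b χ (polarParam '' B) =
      ∫⁻ x in B, ENNReal.ofReal (√ (metricMatrix α k b χ polarParam x).det) := by
  rw [riemVol, inter_comm, injOn_polarParam.preimage_image_inter hB]

variable {α k σ : ℝ} {b : ℝ → ℝ} {χ : ℝ × ℝ → ℝ}

theorem exists_hasFDerivAt_flatten {κ : ℝ} {x : Fin 3 → ℝ} (h : 1 + κ * (x 0 * x 1) ≠ 0) :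
    ∃ p q, HasFDerivAt (flatten κ)
      (matrixCLM !![1, 0, 0; 0, 1, 0; p, q, Real.cos (x 0) * (1 + κ * (x 0 * x 1))⁻¹]) x := by
  have hx := fun i => hasFDerivAt_coord i x
  have hu := (((hx 0).fun_mul (hx 1)).const_mul κ).const_add 1
  have e := (hx 2).fun_mul ((hx 0).cos.fun_mul ((hasDerivAt_inv h).comp_hasFDerivAt x hu))
  refine ⟨-x 2 * (Real.sin (x 0) * (1 + κ * (x 0 * x 1))⁻¹
      + Real.cos (x 0) * ((1 + κ * (x 0 * x 1)) ^ 2)⁻¹ * (κ * x 1)),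
    -x 2 * Real.cos (x 0) * ((1 + κ * (x 0 * x 1)) ^ 2)⁻¹ * (κ * x 0),
    hasFDerivAt_of_rows fun i => ?_⟩
  fin_cases i
  · exact ⟨_, hx 0, fun v => by simp⟩
  · exact ⟨_, hx 1, fun v => by simp⟩
  · refine ⟨_, e, fun v => ?_⟩
    simp
    ring

theorem fderiv_flatten_det {κ : ℝ} {x : Fin 3 → ℝ} (h : 1 + κ * (x 0 * x 1) ≠ 0) :
    DifferentiableAt ℝ (flatten κ) x ∧
      (fderiv ℝ (flatten κ) x).det = Real.cos (x 0) * (1 + κ * (x 0 * x 1))⁻¹ := by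
  obtain ⟨p, q, hd⟩ := exists_hasFDerivAt_flatten h
  refine ⟨hd.differentiableAt, ?_⟩
  rw [hd.fderiv, det_matrixCLM, Matrix.det_fin_three]
  simp

/-- The determinant is f⁻⁴ cos² r · f²: the circle factor compensates only half of the shrinking of
the sphere. -/
theorem sqrt_det_metricMatrix (hα : 0 < α) (hb : IsTransition b) (hχ : IsPlaneCutoff χ)
    (hσ : σ = 1 ∨ σ = -1) {x : Fin 3 → ℝ} (hx : x ∈ unitRegion σ α k) :
    √ (metricMatrix α k b χ polarParam x).det =
      Real.cos (x 0) * (1 + k * σ * (x 0 * x 1))⁻¹ := by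
  have hf := one_add_ge_of_mem_unitRegion hα hb hχ hσ hx
  have hc := cos_pos_of_mem_unitRegion hx
  rw [metricMatrix_polarParam, Matrix.det_diagonal, Fin.prod_univ_three,
    (warp_eventuallyEq_of_mem_unitRegion hα hb hχ hσ hx).eq_of_nhds]
  set f := 1 + k * σ * (x 0 * x 1) with hfdef
  have hf0 : 0 < f := by linarith
  have : (![(f ^ 2)⁻¹, (f ^ 2)⁻¹ * Real.cos (x 0) ^ 2, f ^ 2] : Fin 3 → ℝ) 0 *
      (![(f ^ 2)⁻¹, (f ^ 2)⁻¹ * Real.cos (x 0) ^ 2, f ^ 2] : Fin 3 → ℝ) 1 *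
      (![(f ^ 2)⁻¹, (f ^ 2)⁻¹ * Real.cos (x 0) ^ 2, f ^ 2] : Fin 3 → ℝ) 2 =
      (Real.cos (x 0) * f⁻¹) ^ 2 := by
    simp
    field_simp
  rw [this, Real.sqrt_sq (by positivity)]

theorem injOn_flatten (hα : 0 < α) (hb : IsTransition b) (hχ : IsPlaneCutoff χ)
    (hσ : σ = 1 ∨ σ = -1) : InjOn (flatten (k * σ)) (unitRegion σ α k) := by
  intro x hx y hy h
  have h0 : x 0 = y 0 := congrFun h 0
  have h1 : x 1 = y 1 := congrFun h 1
  have h2 : x 2 * (Real.cos (x 0) * (1 + k * σ * (x 0 * x 1))⁻¹) =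
      y 2 * (Real.cos (y 0) * (1 + k * σ * (y 0 * y 1))⁻¹) := congrFun h 2
  have hf := one_add_ge_of_mem_unitRegion hα hb hχ hσ hy
  have hc := cos_pos_of_mem_unitRegion hy
  rw [h0, h1] at h2
  have hne : Real.cos (y 0) * (1 + k * σ * (y 0 * y 1))⁻¹ ≠ 0 :=
    mul_ne_zero hc.ne' (inv_ne_zero (by linarith))
  have h2' := mul_right_cancel₀ hne h2
  ext i
  fin_cases i <;> assumption

/-- The ξ-rescaling in `flatten` has triangular Jacobian with determinant exactly the Riemannian
density, so this is a change of variables. -/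
theorem lintegral_sqrt_det_eq_volume_flatten (hα : 0 < α) (hb : IsTransition b)
    (hχ : IsPlaneCutoff χ) (hσ : σ = 1 ∨ σ = -1) {B : Set (Fin 3 → ℝ)} (hm : MeasurableSet B)
    (hB : B ⊆ unitRegion σ α k) :
    ∫⁻ x in B, ENNReal.ofReal (√ (metricMatrix α k b χ polarParam x).det) =
      volume (flatten (k * σ) '' B) := by
  have hne : ∀ x ∈ B, 1 + k * σ * (x 0 * x 1) ≠ 0 := fun x hx => by
    have := one_add_ge_of_mem_unitRegion hα hb hχ hσ (hB hx)
    linarith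
  rw [← lintegral_abs_det_fderiv_eq_addHaar_image volume hm
    (fun x hx => (fderiv_flatten_det (hne x hx)).1.hasFDerivAt.hasFDerivWithinAt)
    ((injOn_flatten hα hb hχ hσ).mono hB)]
  refine setLIntegral_congr_fun hm fun x hx => ?_
  rw [sqrt_det_metricMatrix hα hb hχ hσ (hB hx), (fderiv_flatten_det (hne x hx)).2, abs_of_nonneg]
  have := one_add_ge_of_mem_unitRegion hα hb hχ hσ (hB hx)
  have hc := cos_pos_of_mem_unitRegion (hB hx)
  exact mul_nonneg hc.le (inv_nonneg.mpr (by linarith))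

/-- The two pieces are disjoint because rθ has opposite signs on them. The bound on ξ keeps them in
one period, where the parametrization is injective. -/
theorem riemVol_image_union (hα : 0 < α) (hb : IsTransition b) (hχ : IsPlaneCutoff χ)
    {B B' : Set (Fin 3 → ℝ)} (hm : MeasurableSet B) (hm' : MeasurableSet B')
    (hB : B ⊆ unitRegion 1 α k) (hB' : B' ⊆ unitRegion (-1) α k)
    (h2 : ∀ x ∈ B ∪ B', |x 2| < Real.pi) :
    riemVol α k b χ (polarParam '' (B ∪ B')) =
      volume (flatten (k * 1) '' B) + volume (flatten (k * (-1)) '' B') := by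
  have hpi := Real.pi_gt_three
  have hbox : B ∪ B' ⊆ polarBox := fun x hx => by
    have h01 : |x 0| < 1 / 4 ∧ |x 1| < 1 / 4 := by
      rcases hx with hx | hx
      · exact abs_lt_quarter_of_mem_unitRegion (hB hx)
      · exact abs_lt_quarter_of_mem_unitRegion (hB' hx)
    have h2 := h2 x hx
    rw [abs_lt, abs_lt] at h01
    rw [abs_lt] at h2
    refine ⟨⟨?_, ?_⟩, ⟨?_, ?_⟩, ⟨h2.1, h2.2.le⟩⟩ <;> linarith
  have hdisj : Disjoint B B' := Set.disjoint_left.mpr fun x hx hx' => by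
    have e1 := (hB hx).1
    have e2 := (hB' hx').1
    linarith
  rw [riemVol_image_polarParam α k b χ hbox, lintegral_union hm' hdisj,
    lintegral_sqrt_det_eq_volume_flatten hα hb hχ (Or.inl rfl) hm hB,
    lintegral_sqrt_det_eq_volume_flatten hα hb hχ (Or.inr rfl) hm' hB']

/-- `expAt` chooses an arbitrary geodesic; uniqueness makes its endpoint independent of the choice.
-/
theorem expAt_eq {v : Fin 3 → ℝ} {c w : ℝ → Fin 3 → ℝ} (h : IsGeodesicFrom α k b χ v c w)
    (hu : ∀ c' w', IsGeodesicFrom α k b χ v c' w' → EqOn c c' (Icc 0 1)) :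
    expAt α k b χ v = polarParam (c 1) := by
  have hex : ∃ c : ℝ → Fin 3 → ℝ, ∃ w, IsGeodesicFrom α k b χ v c w := ⟨c, w, h⟩
  rw [expAt, dif_pos hex]
  obtain ⟨w', hw'⟩ := hex.choose_spec
  rw [hu _ w' hw' (by simp)]

/-! ### The wedge -/

theorem norm_le_of_mem_wedgePart {ρ₀ : ℝ} {v : Fin 3 → ℝ} (hv : v ∈ wedgePart σ α ρ₀) :
    ‖v‖ ≤ ρ₀ := by
  obtain ⟨h1, -, -, -, h2⟩ := hv
  have hρ : 0 ≤ ρ₀ := (Real.sqrt_nonneg _).trans h1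
  have h3 : √3 ≤ 2 := by
    rw [Real.sqrt_le_left (by norm_num)]
    norm_num
  refine (pi_norm_le_iff_of_nonneg hρ).mpr fun i => ?_
  rw [Real.norm_eq_abs]
  fin_cases i
  · exact (Real.abs_le_sqrt (le_add_of_nonneg_right (sq_nonneg _))).trans h1
  · exact (Real.abs_le_sqrt (le_add_of_nonneg_left (sq_nonneg _))).trans h1
  · exact (abs_lt.mpr h2).le.trans (by nlinarith)

theorem measurableSet_wedgePart (σ α ρ₀ : ℝ) : MeasurableSet (wedgePart σ α ρ₀) := by
  have c (i : Fin 3) : Measurable fun v : Fin 3 → ℝ => v i := measurable_pi_apply i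
  have h1 : Measurable fun v : Fin 3 → ℝ => √(v 0 ^ 2 + v 1 ^ 2) := by fun_prop
  have h2 : Measurable fun v : Fin 3 → ℝ => σ * (v 0 * v 1) := by fun_prop
  have a (i : Fin 3) : Measurable fun v : Fin 3 → ℝ => |v i| := (c i).abs
  exact (measurableSet_le h1 measurable_const).inter ((measurableSet_lt measurable_const h2).inter
    ((measurableSet_le ((a 0).const_mul α) (a 1)).inter
      ((measurableSet_le (a 1) ((a 0).const_mul (1 / α))).inter (c 2 measurableSet_Ioo))))

theorem dilate_wedgePart_subset (hα : 0 < α) {ρ₀ t : ℝ} (ht : 0 < t) :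
    dilate t (wedgePart σ α ρ₀) ⊆ planeCone σ α := by
  rintro _ ⟨v, ⟨-, h1, h2, h3, -⟩, rfl⟩
  have h4 : α * |v 1| ≤ |v 0| := by
    rwa [one_div_mul_eq_div, le_div_iff₀' hα] at h3
  refine ⟨?_, ?_, ?_⟩
  · have : σ * ((t • v) 0 * (t • v) 1) = t ^ 2 * (σ * (v 0 * v 1)) := by simp; ring
    rw [this]
    positivity
  · simp only [Pi.smul_apply, smul_eq_mul, abs_mul, abs_of_pos ht]
    nlinarith
  · simp only [Pi.smul_apply, smul_eq_mul, abs_mul, abs_of_pos ht]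
    nlinarith

theorem volume_image_dilate_ne_top {G : (Fin 3 → ℝ) → Fin 3 → ℝ}
    (h : ∀ i, VanishOrd 2 fun v _ => G v i - v i) {Ω : Set (Fin 3 → ℝ)} {R : ℝ}
    (hΩ : ∀ v ∈ Ω, ‖v‖ ≤ R) : ∀ᶠ t : ℝ in 𝓝[>] 0, volume (G '' dilate t Ω) ≠ ⊤ := by
  have hvol : volume Ω ≠ ⊤ := by
    refine ((measure_mono fun v hv => ?_).trans_lt (measure_closedBall_lt_top (x := (0 : Fin 3 → ℝ))
      (r := R))).ne
    simpa using hΩ v hv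
  filter_upwards [eventually_forall_dilate_pair (eventually_near_id h) hΩ, self_mem_nhdsWithin]
    with t ht ht0
  have e := volume_image_le_of_dist_le (f := G) (g := fun v => v) (S := dilate t Ω) (K := 3 / 2)
    (by positivity) fun v hv v' hv' => (norm_sub_le_of_near_id (ht v hv v' hv')).1
  rw [image_id', volume_dilate Ω (le_of_lt ht0)] at e
  exact ne_top_of_le_ne_top (by finiteness) e

/-- The geodesics with initial velocity in a small dilate of the wedge are those of the model
metrics. -/
theorem IsModelFlow.eventually_wedgePart {c w : (Fin 3 → ℝ) → ℝ → Fin 3 → ℝ}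
    (h : IsModelFlow (k * σ) c w) (hα : 0 < α) (hα1 : α < 1) (hb : IsTransition b)
    (hχ : IsPlaneCutoff χ) (hσ : σ = 1 ∨ σ = -1) (ρ₀ : ℝ) :
    ∀ᶠ t : ℝ in 𝓝[>] 0, ∀ v ∈ dilate t (wedgePart σ α ρ₀), c v 1 ∈ unitRegion σ α k ∧
      IsGeodesicFrom α k b χ v (c v) (w v) ∧
      ∀ c' w', IsGeodesicFrom α k b χ v c' w' → EqOn (c v) c' (Icc 0 1) := by
  filter_upwards [eventually_forall_dilate (h.isGeodesicFrom hα hα1 hb hχ hσ)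
    fun v hv => norm_le_of_mem_wedgePart (σ := σ) (α := α) (ρ₀ := ρ₀) hv, self_mem_nhdsWithin]
    with t ht ht0 v hv using ht v hv (dilate_wedgePart_subset hα ht0 hv)

theorem riemVol_exp_wedge {c w c' w' : (Fin 3 → ℝ) → ℝ → Fin 3 → ℝ}
    (h : IsModelFlow (k * 1) c w) (h' : IsModelFlow (k * (-1)) c' w') (hα : 0 < α) (hα1 : α < 1)
    (hb : IsTransition b) (hχ : IsPlaneCutoff χ) (ρ₀ : ℝ) :
    ∀ᶠ t : ℝ in 𝓝[>] 0, (riemVol α k b χ (expAt α k b χ '' dilate t (wedge α ρ₀))).toReal =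
      (volume ((fun v => flatten (k * 1) (c v 1)) '' dilate t (wedgePart 1 α ρ₀))).toReal +
      (volume ((fun v => flatten (k * (-1)) (c' v 1)) '' dilate t (wedgePart (-1) α ρ₀))).toReal := by
  have near {κ : ℝ} {c w : (Fin 3 → ℝ) → ℝ → Fin 3 → ℝ} (h : IsModelFlow κ c w) (i : Fin 3) :
      VanishOrd 2 fun v _ => flatten κ (c v 1) i - v i :=
    (((h.flatten_sub_ord i).mono (by lia)).add (flatTaylor_sub_ord κ i)).congr fun v s => by ring
  have near' {κ : ℝ} {c w : (Fin 3 → ℝ) → ℝ → Fin 3 → ℝ} (h : IsModelFlow κ c w) (i : Fin 3) :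
      VanishOrd 2 fun v _ => c v 1 i - v i :=
    (h.pos_sub_ord i).eval_one.congr fun v s => by ring
  have b1 : ∀ v ∈ wedgePart 1 α ρ₀, ‖v‖ ≤ ρ₀ := fun v hv => norm_le_of_mem_wedgePart hv
  have b2 : ∀ v ∈ wedgePart (-1) α ρ₀, ‖v‖ ≤ ρ₀ := fun v hv => norm_le_of_mem_wedgePart hv
  filter_upwards [volume_image_dilate_ne_top (near h) b1, volume_image_dilate_ne_top (near h') b2,
    injOn_dilate_of_near_id (near' h) b1, injOn_dilate_of_near_id (near' h') b2,
    h.eventually_wedgePart hα hα1 hb hχ (Or.inl rfl) ρ₀,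
    h'.eventually_wedgePart hα hα1 hb hχ (Or.inr rfl) ρ₀,
    eventually_forall_dilate ((h.pos_ord 2).eventually_abs_lt Real.pi_pos) b1,
    eventually_forall_dilate ((h'.pos_ord 2).eventually_abs_lt Real.pi_pos) b2,
    self_mem_nhdsWithin] with t f1 f2 i1 i2 g1 g2 s1 s2 ht
  have ht0 : t ≠ 0 := ne_of_gt ht
  have himg : expAt α k b χ '' dilate t (wedge α ρ₀) = polarParam ''
      ((fun v => c v 1) '' dilate t (wedgePart 1 α ρ₀) ∪
        (fun v => c' v 1) '' dilate t (wedgePart (-1) α ρ₀)) := by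
    rw [dilate, wedge, image_union, image_union, image_union, image_image polarParam,
      image_image polarParam]
    congr 1
    · exact image_congr fun v hv => expAt_eq (g1 v hv).2.1 (g1 v hv).2.2
    · exact image_congr fun v hv => expAt_eq (g2 v hv).2.1 (g2 v hv).2.2
  rw [himg, riemVol_image_union hα hb hχ, image_image, image_image, ENNReal.toReal_add f1 f2]
  -- An injective continuous image of a Borel set is Borel. Injectivity holds because the endpoint
  -- map is close to the identity in the Lipschitz sense.
  · exact (measurableSet_dilate (measurableSet_wedgePart _ _ _) ht0).image_of_continuousOn_injOn
      i1.2 i1.1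
  · exact (measurableSet_dilate (measurableSet_wedgePart _ _ _) ht0).image_of_continuousOn_injOn
      i2.2 i2.1
  · rintro _ ⟨v, hv, rfl⟩
    exact (g1 v hv).1
  · rintro _ ⟨v, hv, rfl⟩
    exact (g2 v hv).1
  · rintro _ (⟨v, hv, rfl⟩ | ⟨v, hv, rfl⟩)
    · exact s1 v hv 1 (by simp)
    · exact s2 v hv 1 (by simp)

end

/-! ### The fifth-order coefficient -/

section

open MeasureTheory

theorem mem_pi_cons {A B C : Set ℝ} {x : Fin 3 → ℝ} :
    x ∈ pi univ ![A, B, C] ↔ x 0 ∈ A ∧ x 1 ∈ B ∧ x 2 ∈ C := by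
  simp [Set.mem_pi, Fin.forall_fin_succ]

/-- Cylindrical coordinates in the sector with signs `a, d`. -/
noncomputable def sectorParam (a d : ℝ) (x : Fin 3 → ℝ) : Fin 3 → ℝ :=
  ![a * (x 0 * Real.cos (x 1)), d * (x 0 * Real.sin (x 1)), x 2]

/-- The cylindrical coordinates of the wedge. -/
noncomputable def sectorBox (α ρ₀ : ℝ) : Set (Fin 3 → ℝ) :=
  pi univ ![Ioc 0 ρ₀, Icc (Real.arctan α) (Real.arctan (1 / α)),
    Ioo (-(√3 / 2 * ρ₀)) (√3 / 2 * ρ₀)]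

/-- The part of the wedge in the sector with signs `a, d`. -/
def sector (a d α ρ₀ : ℝ) : Set (Fin 3 → ℝ) :=
  {v | √(v 0 ^ 2 + v 1 ^ 2) ≤ ρ₀ ∧ 0 < a * v 0 ∧ 0 < d * v 1 ∧
    α * |v 0| ≤ |v 1| ∧ |v 1| ≤ 1 / α * |v 0| ∧
    v 2 ∈ Ioo (-(√3 / 2 * ρ₀)) (√3 / 2 * ρ₀)}

theorem measurableSet_sectorBox (α ρ₀ : ℝ) : MeasurableSet (sectorBox α ρ₀) := by
  refine MeasurableSet.univ_pi fun i => ?_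
  fin_cases i
  · exact measurableSet_Ioc
  · exact measurableSet_Icc
  · exact measurableSet_Ioo

theorem hasFDerivAt_sectorParam (a d : ℝ) (x : Fin 3 → ℝ) :
    HasFDerivAt (sectorParam a d) (matrixCLM
      !![a * Real.cos (x 1), -a * (x 0 * Real.sin (x 1)), 0;
        d * Real.sin (x 1), d * (x 0 * Real.cos (x 1)), 0; 0, 0, 1]) x := by
  have hx := fun i => hasFDerivAt_coord i x
  refine hasFDerivAt_of_rows fun i => ?_
  fin_cases i
  · refine ⟨_, ((hx 0).fun_mul (hx 1).cos).const_mul a, fun v => ?_⟩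
    simp; ring
  · refine ⟨_, ((hx 0).fun_mul (hx 1).sin).const_mul d, fun v => ?_⟩
    simp; ring
  · exact ⟨_, hx 2, fun v => by simp⟩

theorem sq_eq_one_of_sign {a : ℝ} (ha : a = 1 ∨ a = -1) : a * a = 1 := by
  rcases ha with rfl | rfl <;> norm_num

theorem mem_sectorBox_angle {α ρ₀ : ℝ} (hα : 0 < α) {x : Fin 3 → ℝ} (hx : x ∈ sectorBox α ρ₀) :
    0 < x 1 ∧ x 1 < Real.pi / 2 := by
  obtain ⟨-, h, -⟩ := mem_pi_cons.mp hx
  exact ⟨(Real.arctan_pos.mpr hα).trans_le h.1, h.2.trans_lt (Real.arctan_lt_pi_div_two _)⟩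

theorem injOn_sectorParam {a d α ρ₀ : ℝ} (hα : 0 < α) (ha : a = 1 ∨ a = -1) (hd : d = 1 ∨ d = -1) :
    InjOn (sectorParam a d) (sectorBox α ρ₀) := by
  intro x hx y hy h
  have na : a ≠ 0 := fun h => by simp [h] at ha
  have nd : d ≠ 0 := fun h => by simp [h] at hd
  have e0 : x 0 * Real.cos (x 1) = y 0 * Real.cos (y 1) := mul_left_cancel₀ na (congrFun h 0)
  have e1 : x 0 * Real.sin (x 1) = y 0 * Real.sin (y 1) := mul_left_cancel₀ nd (congrFun h 1)
  have e2 : x 2 = y 2 := congrFun h 2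
  have px := (mem_pi_cons.mp hx).1.1
  have py := (mem_pi_cons.mp hy).1.1
  have ax := mem_sectorBox_angle hα hx
  have ay := mem_sectorBox_angle hα hy
  have h0 : x 0 = y 0 := by
    refine (pow_left_inj₀ px.le py.le two_ne_zero).mp ?_
    have s1 := Real.sin_sq_add_cos_sq (x 1)
    have s2 := Real.sin_sq_add_cos_sq (y 1)
    calc x 0 ^ 2 = (x 0 * Real.cos (x 1)) ^ 2 + (x 0 * Real.sin (x 1)) ^ 2 := by
          linear_combination -x 0 ^ 2 * s1
      _ = y 0 ^ 2 := by
          rw [e0, e1]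
          linear_combination y 0 ^ 2 * s2
  have h1 : x 1 = y 1 := by
    rw [h0] at e0
    exact Real.injOn_cos ⟨ax.1.le, by linarith [ax.2]⟩ ⟨ay.1.le, by linarith [ay.2]⟩
      (mul_left_cancel₀ py.ne' e0)
  ext i
  fin_cases i <;> assumption

theorem sectorParam_image {a d α ρ₀ : ℝ} (hα : 0 < α) (ha : a = 1 ∨ a = -1)
    (hd : d = 1 ∨ d = -1) : sectorParam a d '' sectorBox α ρ₀ = sector a d α ρ₀ := by
  have ha2 := sq_eq_one_of_sign ha
  have hd2 := sq_eq_one_of_sign hd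
  have haa : |a| = 1 := by rcases ha with rfl | rfl <;> simp
  have hda : |d| = 1 := by rcases hd with rfl | rfl <;> simp
  ext v
  constructor
  · rintro ⟨x, hx, rfl⟩
    obtain ⟨h0, h1⟩ := mem_sectorBox_angle hα hx
    obtain ⟨hr, hφ, hz⟩ := mem_pi_cons.mp hx
    have hc : 0 < Real.cos (x 1) := Real.cos_pos_of_mem_Ioo ⟨by linarith, h1⟩
    have hs : 0 < Real.sin (x 1) := Real.sin_pos_of_pos_of_lt_pi h0 (by linarith)
    have pc := mul_pos hr.1 hc
    have ps := mul_pos hr.1 hs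
    have e0 : sectorParam a d x 0 = a * (x 0 * Real.cos (x 1)) := rfl
    have e1 : sectorParam a d x 1 = d * (x 0 * Real.sin (x 1)) := rfl
    have a0 : |sectorParam a d x 0| = x 0 * Real.cos (x 1) := by
      rw [e0, abs_mul, haa, one_mul, abs_of_pos pc]
    have a1 : |sectorParam a d x 1| = x 0 * Real.sin (x 1) := by
      rw [e1, abs_mul, hda, one_mul, abs_of_pos ps]
    have htan : Real.sin (x 1) = Real.tan (x 1) * Real.cos (x 1) :=
      (Real.tan_mul_cos hc.ne').symm
    have t1 : α ≤ Real.tan (x 1) := by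
      rw [← Real.tan_arctan α]
      exact Real.strictMonoOn_tan.monotoneOn (Real.arctan_mem_Ioo α) ⟨by linarith, h1⟩ hφ.1
    have t2 : Real.tan (x 1) ≤ 1 / α := by
      rw [← Real.tan_arctan (1 / α)]
      exact Real.strictMonoOn_tan.monotoneOn ⟨by linarith, h1⟩ (Real.arctan_mem_Ioo _) hφ.2
    refine ⟨?_, ?_, ?_, ?_, ?_, hz⟩
    · have : sectorParam a d x 0 ^ 2 + sectorParam a d x 1 ^ 2 = x 0 ^ 2 := by
        rw [e0, e1]
        linear_combination (x 0 * Real.cos (x 1)) ^ 2 * ha2 + (x 0 * Real.sin (x 1)) ^ 2 * hd2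
          + x 0 ^ 2 * Real.sin_sq_add_cos_sq (x 1)
      rw [this, Real.sqrt_sq hr.1.le]
      exact hr.2
    · rwa [e0, ← mul_assoc, ha2, one_mul]
    · rwa [e1, ← mul_assoc, hd2, one_mul]
    · rw [a0, a1, htan]
      calc α * (x 0 * Real.cos (x 1)) ≤ Real.tan (x 1) * (x 0 * Real.cos (x 1)) := by gcongr
        _ = _ := by ring
    · rw [a0, a1, htan]
      calc _ = Real.tan (x 1) * (x 0 * Real.cos (x 1)) := by ring
        _ ≤ _ := by gcongr
  · rintro ⟨hr, h0, h1, hα1, hα2, hz⟩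
    set X := a * v 0 with hX
    set Y := d * v 1 with hY
    have hX' : |v 0| = X := by
      rw [← abs_of_pos h0, hX, abs_mul, haa, one_mul]
    have hY' : |v 1| = Y := by
      rw [← abs_of_pos h1, hY, abs_mul, hda, one_mul]
    rw [hX', hY'] at hα1 hα2
    have hsq : v 0 ^ 2 + v 1 ^ 2 = X ^ 2 + Y ^ 2 := by rw [← hX', ← hY', sq_abs, sq_abs]
    set ρ := √(v 0 ^ 2 + v 1 ^ 2) with hρ
    have hρ2 : ρ ^ 2 = X ^ 2 + Y ^ 2 := by
      rw [hρ, Real.sq_sqrt (by positivity), hsq]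
    have hρ0 : 0 < ρ := by
      rw [hρ, hsq]
      positivity
    set φ := Real.arctan (Y / X) with hφ
    have hc : 0 < Real.cos φ := Real.cos_arctan_pos _
    have hs : Real.sin φ = Y / X * Real.cos φ := by
      rw [← Real.tan_mul_cos hc.ne', Real.tan_arctan]
    have c1 : ρ * Real.cos φ = X := by
      refine (pow_left_inj₀ (by positivity) h0.le two_ne_zero).mp ?_
      have := Real.sin_sq_add_cos_sq φ
      rw [hs] at this
      rw [mul_pow, hρ2]
      field_simp at this
      linear_combination this
    have c2 : ρ * Real.sin φ = Y := by
      rw [hs, show ρ * (Y / X * Real.cos φ) = Y / X * (ρ * Real.cos φ) by ring, c1,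
        div_mul_cancel₀ _ h0.ne']
    refine ⟨![ρ, φ, v 2], mem_pi_cons.mpr ⟨⟨hρ0, hr⟩, ⟨?_, ?_⟩, hz⟩, ?_⟩
    · exact Real.arctan_mono ((le_div_iff₀ h0).mpr hα1)
    · exact Real.arctan_mono ((div_le_iff₀ h0).mpr hα2)
    · ext i
      fin_cases i
      · simp [sectorParam, c1, hX, ← mul_assoc, ha2]
      · simp [sectorParam, c2, hY, ← mul_assoc, hd2]
      · simp [sectorParam]

/-- In the sector with signs a, d one has xy = ad · ρ² sin φ cos φ, and this sign cancels against
that of κ = k·ad. All four sectors therefore give the same integral, with Jacobian ρ in absolute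
value. -/
theorem integral_sector {a d α ρ₀ : ℝ} (hα : 0 < α) (ha : a = 1 ∨ a = -1)
    (hd : d = 1 ∨ d = -1) (k : ℝ) :
    ∫ v in sector a d α ρ₀, flatTrace (k * (a * d)) v = ∫ x in sectorBox α ρ₀,
      x 0 ^ 3 * (k / 3 * (Real.sin (x 1) * Real.cos (x 1)) - 1 / 6) := by
  have ha2 := sq_eq_one_of_sign ha
  have hd2 := sq_eq_one_of_sign hd
  rw [← sectorParam_image hα ha hd, integral_image_eq_integral_abs_det_fderiv_smul volume
    (measurableSet_sectorBox α ρ₀) (fun x _ => (hasFDerivAt_sectorParam a d x).hasFDerivWithinAt)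
    (injOn_sectorParam hα ha hd)]
  refine setIntegral_congr_fun (measurableSet_sectorBox α ρ₀) fun x hx => ?_
  have hr := (mem_pi_cons.mp hx).1.1
  have hdet : (!![a * Real.cos (x 1), -a * (x 0 * Real.sin (x 1)), 0;
      d * Real.sin (x 1), d * (x 0 * Real.cos (x 1)), 0; 0, 0, 1] :
      Matrix (Fin 3) (Fin 3) ℝ).det = a * d * x 0 := by
    rw [Matrix.det_fin_three]
    simp
    linear_combination a * d * x 0 * Real.sin_sq_add_cos_sq (x 1)
  have habs : |a * d * x 0| = x 0 := by
    rw [abs_mul, abs_of_pos hr]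
    rcases ha with rfl | rfl <;> rcases hd with rfl | rfl <;> simp
  rw [det_matrixCLM, hdet, habs, smul_eq_mul]
  simp only [flatTrace, sectorParam, Matrix.cons_val_zero, Matrix.cons_val_one]
  linear_combination (x 0 ^ 3 * k / 3 * Real.sin (x 1) * Real.cos (x 1) * (a * a))
      * hd2 + (x 0 ^ 3 * k / 3 * Real.sin (x 1) * Real.cos (x 1)
      - x 0 ^ 3 / 6 * Real.cos (x 1) ^ 2) * ha2
      - x 0 ^ 3 / 6 * Real.sin (x 1) ^ 2 * hd2 - x 0 ^ 3 / 6 * Real.sin_sq_add_cos_sq (x 1)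

theorem integral_pi_cons (f g h : ℝ → ℝ) (A B C : Set ℝ) :
    ∫ x in pi univ ![A, B, C], f (x 0) * g (x 1) * h (x 2) =
      (∫ x in A, f x) * (∫ x in B, g x) * ∫ x in C, h x := by
  rw [volume_pi, Measure.restrict_pi_pi]
  have := integral_fintype_prod_eq_prod (μ := fun i => volume.restrict ((![A, B, C] : Fin 3 → Set ℝ) i))
    (fun i => (![f, g, h] : Fin 3 → ℝ → ℝ) i)
  simpa [Fin.prod_univ_three] using this

theorem sin_sq_arctan (x : ℝ) : Real.sin (Real.arctan x) ^ 2 = x ^ 2 / (1 + x ^ 2) := by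
  rw [Real.sin_arctan, div_pow, Real.sq_sqrt (by positivity)]

theorem integral_sectorBox {α ρ₀ : ℝ} (hα : 0 < α) (hα1 : α < 1) (hρ : 0 < ρ₀) (k : ℝ) :
    4 * ∫ x in sectorBox α ρ₀,
      x 0 ^ 3 * (k / 3 * (Real.sin (x 1) * Real.cos (x 1)) - 1 / 6) = fifthCoeff α k ρ₀ := by
  have h := integral_pi_cons (fun r => r ^ 3)
    (fun φ => k / 3 * (Real.sin φ * Real.cos φ) - 1 / 6) (fun _ => 1) (Ioc 0 ρ₀)
    (Icc (Real.arctan α) (Real.arctan (1 / α))) (Ioo (-(√3 / 2 * ρ₀)) (√3 / 2 * ρ₀))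
  simp only [mul_one] at h
  have hle : Real.arctan α ≤ Real.arctan (1 / α) :=
    Real.arctan_mono (hα1.le.trans ((one_le_div hα).mpr hα1.le))
  have i1 : ∫ r in Ioc 0 ρ₀, r ^ 3 = ρ₀ ^ 4 / 4 := by
    rw [← intervalIntegral.integral_of_le hρ.le, integral_pow]
    norm_num
  -- The antiderivative of sin φ cos φ is sin² φ / 2, and sin² takes the values 1/(1 + α²) and α²/(1
  -- + α²) at the endpoints.
  have i2 : ∫ φ in Icc (Real.arctan α) (Real.arctan (1 / α)),
      (k / 3 * (Real.sin φ * Real.cos φ) - 1 / 6) =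
      1 / 6 * (k * ((1 - α ^ 2) / (1 + α ^ 2)) - (Real.arctan (1 / α) - Real.arctan α)) := by
    rw [integral_Icc_eq_integral_Ioc, ← intervalIntegral.integral_of_le hle,
      intervalIntegral.integral_sub, intervalIntegral.integral_const_mul, integral_sin_mul_cos₁,
      sin_sq_arctan, sin_sq_arctan, intervalIntegral.integral_const, smul_eq_mul]
    · field_simp
      ring
    · exact Continuous.intervalIntegrable (by fun_prop) _ _
    · exact Continuous.intervalIntegrable (by fun_prop) _ _
  have i3 : ∫ _ in Ioo (-(√3 / 2 * ρ₀)) (√3 / 2 * ρ₀), (1 : ℝ) = √3 * ρ₀ := by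
    have : 0 ≤ √3 / 2 * ρ₀ := by positivity
    rw [setIntegral_const, Real.volume_real_Ioo_of_le (by linarith), smul_eq_mul]
    ring
  rw [sectorBox, h, i1, i2, i3, fifthCoeff]
  ring

/-- A prescribed sign of xy leaves two opposite quadrants. -/
theorem wedgePart_eq_union {σ α ρ₀ : ℝ} (hσ : σ = 1 ∨ σ = -1) :
    wedgePart σ α ρ₀ = sector 1 σ α ρ₀ ∪ sector (-1) (-σ) α ρ₀ := by
  ext v
  simp only [wedgePart, sector, mem_union, mem_ofPred_eq]
  have h : 0 < σ * (v 0 * v 1) ↔ (0 < 1 * v 0 ∧ 0 < σ * v 1) ∨ (0 < -1 * v 0 ∧ 0 < -σ * v 1) := by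
    rw [show σ * (v 0 * v 1) = v 0 * (σ * v 1) by ring, mul_pos_iff]
    simp
  rw [h]
  tauto

theorem integral_wedgePart {σ α ρ₀ : ℝ} (hσ : σ = 1 ∨ σ = -1) (hα : 0 < α) (hα1 : α < 1)
    (hρ : 0 < ρ₀) (k : ℝ) :
    2 * ∫ v in wedgePart σ α ρ₀, flatTrace (k * σ) v = fifthCoeff α k ρ₀ := by
  have hσ' : -σ = 1 ∨ -σ = -1 := by rcases hσ with rfl | rfl <;> simp
  have hdisj : Disjoint (sector 1 σ α ρ₀) (sector (-1) (-σ) α ρ₀) :=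
    Set.disjoint_left.mpr fun v hv hv' => by
      have e1 := hv.2.1
      have e2 := hv'.2.1
      linarith
  have hm : MeasurableSet (sector (-1) (-σ) α ρ₀) := by
    rw [← sectorParam_image hα (Or.inr rfl) hσ']
    exact (measurableSet_sectorBox α ρ₀).image_of_continuousOn_injOn
      (fun x _ => (hasFDerivAt_sectorParam _ _ x).continuousAt.continuousWithinAt)
      (injOn_sectorParam hα (Or.inr rfl) hσ')
  have hint : IntegrableOn (flatTrace (k * σ)) (wedgePart σ α ρ₀) :=
    integrableOn_of_norm_le (continuous_flatTrace _) fun v hv => norm_le_of_mem_wedgePart hv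
  have e1 := integral_sector (ρ₀ := ρ₀) hα (Or.inl rfl : (1 : ℝ) = 1 ∨ (1 : ℝ) = -1) hσ k
  have e2 := integral_sector (ρ₀ := ρ₀) hα (Or.inr rfl : (-1 : ℝ) = 1 ∨ (-1 : ℝ) = -1) hσ' k
  rw [one_mul] at e1
  rw [neg_mul_neg, one_mul] at e2
  rw [wedgePart_eq_union hσ] at hint ⊢
  rw [setIntegral_union hdisj hm (hint.mono_set subset_union_left)
    (hint.mono_set subset_union_right), e1, e2, ← integral_sectorBox hα hα1 hρ k]
  ring

theorem volume_wedge (α ρ₀ : ℝ) : (volume (wedge α ρ₀)).toReal =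
    (volume (wedgePart 1 α ρ₀)).toReal + (volume (wedgePart (-1) α ρ₀)).toReal := by
  have hfin (σ : ℝ) : volume (wedgePart σ α ρ₀) ≠ ⊤ := by
    refine ((measure_mono fun v hv => ?_).trans_lt (measure_closedBall_lt_top (x := (0 : Fin 3 → ℝ))
      (r := ρ₀))).ne
    simpa using norm_le_of_mem_wedgePart hv
  rw [wedge, measure_union _ (measurableSet_wedgePart _ _ _), ENNReal.toReal_add (hfin _) (hfin _)]
  refine Set.disjoint_left.mpr fun v hv hv' => ?_
  have e1 := hv.2.1
  have e2 := hv'.2.1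
  linarith

theorem fifthCoeff_pos_iff {α ρ₀ : ℝ} (hα : 0 < α) (hα1 : α < 1) (hρ : 0 < ρ₀) (k : ℝ) :
    0 < fifthCoeff α k ρ₀ ↔ kStar α < k := by
  have h1 : 0 < 1 - α ^ 2 := by nlinarith
  have h2 : 0 < 1 + α ^ 2 := by positivity
  have h3 : 0 < √3 * ρ₀ ^ 5 / 6 := by positivity
  rw [fifthCoeff, mul_pos_iff_of_pos_left h3, sub_pos, kStar, div_mul_eq_mul_div, div_lt_iff₀ h1,
    mul_div_assoc', lt_div_iff₀ h2, mul_comm (1 + α ^ 2)]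

end

/-! ### Assembly of the main theorem -/

theorem mainTheorem6 (α k ρ₀ : ℝ) (hα0 : 0 < α) (hα1 : α < 1)
    (b : ℝ → ℝ) (hb : IsTransition b) (χ : ℝ × ℝ → ℝ) (hχ : IsPlaneCutoff χ)
    (hρ0 : 0 < ρ₀)
    (hρ : ρ₀ ≤ min (rhoStar α k / 2) (√(1 + α ^ 2) * α ^ (α / (1 - α)))) :
    -- for small `t`, the exponential map is well defined on `tΩ`
    (∀ᶠ t : ℝ in 𝓝[>] 0, ∀ v ∈ dilate t (wedge α ρ₀),
      (∃ c w, IsGeodesicFrom α k b χ v c w) ∧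
      ∀ c w c' w', IsGeodesicFrom α k b χ v c w → IsGeodesicFrom α k b χ v c' w' →
        EqOn c c' (Icc 0 1)) ∧
    -- the volume expansion
    (fun t : ℝ =>
        (riemVol α k b χ (expAt α k b χ '' dilate t (wedge α ρ₀))).toReal
          - t ^ 3 * (MeasureTheory.volume (wedge α ρ₀)).toReal
          - fifthCoeff α k ρ₀ * t ^ 5)
      =O[𝓝[>] 0] (fun t : ℝ => t ^ 6) ∧
    -- the sign of the fifth-order coefficient
    (0 < fifthCoeff α k ρ₀ ↔ kStar α < k) ∧
    -- away from the singular circle the metric is smooth, with positive scalar curvature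
    (∀ p ∈ sphereCircle \ singularCircle, SmoothMetricAt α k b χ p) ∧
    ((∀ x, fderiv ℝ χ x (1, 0) ^ 2 + fderiv ℝ χ x (0, 1) ^ 2 ≤ 4) →
      ∀ p ∈ sphereCircle \ singularCircle, 5 / 8 ≤ scalarCurvature α k b χ p) := by
  obtain ⟨c₁, w₁, h₁⟩ := exists_isModelFlow (k * 1)
  obtain ⟨c₂, w₂, h₂⟩ := exists_isModelFlow (k * (-1))
  refine ⟨?_, ?_, fifthCoeff_pos_iff hα0 hα1 hρ0 k, fun p hp => smoothMetricAt hχ hb hα0 k hp,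
    fun hgrad p hp => scalarCurvature_ge hχ hb hα0 k hgrad hp⟩
  · filter_upwards [h₁.eventually_wedgePart hα0 hα1 hb hχ (Or.inl rfl) ρ₀,
      h₂.eventually_wedgePart hα0 hα1 hb hχ (Or.inr rfl) ρ₀] with t e₁ e₂ v hv
    rw [wedge, dilate, image_union] at hv
    rcases hv with hv | hv
    · obtain ⟨-, hg, hu⟩ := e₁ v hv
      exact ⟨⟨_, _, hg⟩, fun c w c' w' h h' => (hu c w h).symm.trans (hu c' w' h')⟩
    · obtain ⟨-, hg, hu⟩ := e₂ v hv
      exact ⟨⟨_, _, hg⟩, fun c w c' w' h h' => (hu c w h).symm.trans (hu c' w' h')⟩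
  · have v₁ := h₁.volume_flatten_image (measurableSet_wedgePart 1 α ρ₀)
      fun v hv => norm_le_of_mem_wedgePart hv
    have v₂ := h₂.volume_flatten_image (measurableSet_wedgePart (-1) α ρ₀)
      fun v hv => norm_le_of_mem_wedgePart hv
    have c₁ := integral_wedgePart (Or.inl rfl : (1 : ℝ) = 1 ∨ (1 : ℝ) = -1) hα0 hα1 hρ0 k
    have c₂ := integral_wedgePart (Or.inr rfl : (-1 : ℝ) = 1 ∨ (-1 : ℝ) = -1) hα0 hα1 hρ0 k
    refine (v₁.add v₂).congr' ?_ (EventuallyEq.refl _ _)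
    filter_upwards [riemVol_exp_wedge h₁ h₂ hα0 hα1 hb hχ ρ₀] with t ht
    rw [ht, volume_wedge]
    -- Each half of the wedge carries half of the fifth-order coefficient.
    linear_combination -(t ^ 5 / 2) * c₁ - t ^ 5 / 2 * c₂
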